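/- Let $E_0<0$. Let $\{V_\hbar\}_{\hbar\in(0,1]}$ be real-valued $C^1$ functions on $\mathbb{R}^3$ and let $\{A_\hbar\}_{\hbar\in(0,1]}$ be self-adjoint Hilbert--Schmidt operators on $L^2(\mathbb{R}^3)=L^2(\mathbb{R}^3;\mathbb{C})$ such that 1. $V_\hbar\le 0$ and $V_\hbar\not\equiv 0$ for every $\hbar\in(0,1]$; 2. $\|V_\hbar\|_{L^{3,\infty}(\mathbb{R}^3)}=\sup_{t>0}t\,|\{|V_\hbar|>t\}|^{1/3}$ and $\|V_\hbar\|_{C^1(\mathbb{R}^3)}=\sup|V_\hbar|+\sup|\nabla V_\hbar|$ are bounded uniformly in $\hbar\in(0,1]$; 3. $\|(V_\hbar-\tfrac{E_0}{2})_-\|_{L^{3/2}(\mathbb{R}^3)}$ is bounded uniformly in $\hbar\in(0,1]$, where $x_-=\min\{x,0\}$; 4. $\|A_\hbar\|_{\mathrm{HS}}=O(\sqrt{\hbar})$, i.e. $\|A_\hbar\|_{\mathrm{HS}}\le K\sqrt{\hbar}$ for all $\hbar\in(0,1]$ with some constant $K$. For $E<0$ let $E_1^\hbar\le E_2^\hbar\le\cdots<0$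 be the negative eigenvalues, counted with multiplicity, of the operator $\sqrt{1-\hbar^2\Delta}-1+V_\hbar+A_\hbar$ on $L^2(\mathbb{R}^3)$ with domain $H^1(\mathbb{R}^3)$, let $N^\hbar(E)$ be the number of those that are $<E$, and put $$S^\hbar(E)=(2\pi\hbar)^3\sum_{E_j^\hbar<E}(E_j^\hbar-E).$$ Then there is a constant $C$, which depends neither on $\hbar$ nor on the energy level, such that for every $\hbar\in(0,1]$ and every $E_\hbar\le E_0$ the quantities below are finite (in particular $N^\hbar(E_\hbar)<\infty$, the set $\{(q,p)\in\mathbb{R}^3\times\mathbb{R}^3:\sqrt{1+|p|^2}-1+V_\hbar(q)\le E_\hbar\}$ has finite measure and the integral converges absolutely) and $$\Big|S^\hbar(E_\hbar)-\iint_{\sqrt{1+|p|^2}-1+V_\hbar(q)<E_\hbar}\big(\sqrt{1+|p|^2}-1+V_\hbar(q)-E_\hbar\big)\,dq\,dp\Big|\le C\sqrt{\hbar},$$ $$\Big|(2\pi\hbar)^3N^\hbar(E_\hbar)-\big|\big\{(q,p)\in\mathbb{R}^3\times\mathbb{R}^3:\ \sqrt{1+|p|^2}-1+V_\hbar(q)\le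 E_\hbar\big\}\big|\Big|\le C\,\hbar^{1/4}.$$ -/

import Mathlib

open MeasureTheory Set
open scoped ENNReal NNReal FourierTransform

noncomputable section

/-- Euclidean space `ℝ³`. -/
abbrev R3 : Type := EuclideanSpace ℝ (Fin 3)

/-- The complex Hilbert space `L²(ℝ³)`. -/
abbrev L2R3 : Type := Lp (α := R3) ℂ 2 volume

/-- The subspace `{u ∈ L² : m u ∈ L²}` of `L²(ℝ³)`. -/
def mulDomain (m : R3 → ℝ) : Submodule ℂ L2R3 where
  carrier := {u | MemLp (fun x => (m x : ℂ) * u x) 2 volume}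
  add_mem' := by
    intro u v hu hv
    refine (memLp_congr_ae ?_).mpr (MemLp.add hu hv)
    filter_upwards [Lp.coeFn_add u v] with x hx
    simp only [hx, Pi.add_apply, mul_add]
  zero_mem' := by
    refine (memLp_congr_ae ?_).mpr (MemLp.zero' (α := R3) (ε := ℂ))
    filter_upwards [Lp.coeFn_zero (E := ℂ) (p := 2) (μ := (volume : Measure R3))] with x hx
    simp only [hx, Pi.zero_apply, mul_zero]
  smul_mem' := by
    intro c u hu
    refine (memLp_congr_ae ?_).mpr (MemLp.const_smul hu c)
    filter_upwards [Lp.coeFn_smul c u] with x hx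
    simp only [hx, Pi.smul_apply, smul_eq_mul]
    ring

lemma mem_mulDomain {m : R3 → ℝ} {u : L2R3} :
    u ∈ mulDomain m ↔ MemLp (fun x => (m x : ℂ) * u x) 2 volume := Iff.rfl

/-- Multiplication by the real function `m` in `L²(ℝ³)`, with its maximal domain
`{u ∈ L² : m u ∈ L²}`. -/
def mulOp (m : R3 → ℝ) : L2R3 →ₗ.[ℂ] L2R3 where
  domain := mulDomain m
  toFun :=
    { toFun := fun u => MemLp.toLp (fun x => (m x : ℂ) * (u : L2R3) x) (mem_mulDomain.1 u.2)
      map_add' := by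
        intro u v
        refine (MemLp.toLp_congr _ ((mem_mulDomain.1 u.2).add (mem_mulDomain.1 v.2)) ?_).trans
          (MemLp.toLp_add _ _)
        filter_upwards [Lp.coeFn_add (u : L2R3) (v : L2R3)] with x hx
        simp only [Submodule.coe_add, hx, Pi.add_apply, mul_add]
      map_smul' := by
        intro c u
        refine (MemLp.toLp_congr _ ((mem_mulDomain.1 u.2).const_smul c) ?_).trans
          (MemLp.toLp_const_smul _ _)
        filter_upwards [Lp.coeFn_smul c (u : L2R3)] with x hx
        simp only [Submodule.coe_smul, hx, Pi.smul_apply, smul_eq_mul]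
        ring }

/-- The Fourier multiplier `𝓕⁻¹ m 𝓕` in `L²(ℝ³)`, with its maximal domain
`{u ∈ L² : m û ∈ L²}`. Here `û(ξ) = ∫ u(x) exp(-2πi x·ξ) dx`. -/
def fourierMultiplierOp (m : R3 → ℝ) : L2R3 →ₗ.[ℂ] L2R3 where
  domain := (mulOp m).domain.comap (Lp.fourierTransformₗᵢ R3 ℂ).toLinearEquiv.toLinearMap
  toFun := (Lp.fourierTransformₗᵢ R3 ℂ).symm.toLinearEquiv.toLinearMap ∘ₗ (mulOp m).toFun ∘ₗ
    ((Lp.fourierTransformₗᵢ R3 ℂ).toLinearEquiv.toLinearMap.restrict (fun _ hu => hu))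

/-- The operator `√(1 - ħ²Δ) - 1`, with domain `H¹(ℝ³)` when `ħ ≠ 0`. With the above normalization
of the Fourier transform `-Δ` is multiplication by `(2π|ξ|)²` on the Fourier side. -/
def relKinetic (h : ℝ) : L2R3 →ₗ.[ℂ] L2R3 :=
  fourierMultiplierOp (fun ξ => √(1 + (h * (2 * Real.pi * ‖ξ‖)) ^ 2) - 1)

/-- The operator `√(1 - ħ²Δ) - 1 + V + A`, on the intersection of the domains. -/
def relHamiltonian (h : ℝ) (V : R3 → ℝ) (A : L2R3 →L[ℂ] L2R3) : L2R3 →ₗ.[ℂ] L2R3 :=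
  relKinetic h + mulOp V + A.toLinearMap.toPMap ⊤

/-- The eigenspace `{u ∈ D(H) : H u = l u}`. -/
def eigenspaceOf (H : L2R3 →ₗ.[ℂ] L2R3) (l : ℝ) : Submodule ℂ L2R3 where
  carrier := {u | ∃ hu : u ∈ H.domain, H ⟨u, hu⟩ = (l : ℂ) • u}
  add_mem' := by
    rintro u v ⟨hu, eu⟩ ⟨hv, ev⟩
    refine ⟨H.domain.add_mem hu hv, ?_⟩
    have : (⟨u + v, H.domain.add_mem hu hv⟩ : H.domain) = ⟨u, hu⟩ + ⟨v, hv⟩ := rfl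
    rw [this, LinearPMap.map_add, eu, ev, smul_add]
  zero_mem' := by
    refine ⟨H.domain.zero_mem, ?_⟩
    have : (⟨0, H.domain.zero_mem⟩ : H.domain) = 0 := rfl
    rw [this, LinearPMap.map_zero, smul_zero]
  smul_mem' := by
    rintro c u ⟨hu, eu⟩
    refine ⟨H.domain.smul_mem c hu, ?_⟩
    have : (⟨c • u, H.domain.smul_mem c hu⟩ : H.domain) = c • ⟨u, hu⟩ := rfl
    rw [this, LinearPMap.map_smul, eu, smul_comm]

/-- The multiplicity of `l` as an eigenvalue of `H` (`0` if it is not an eigenvalue, `∞` if the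
eigenspace is infinite dimensional). -/
def multiplicityOf (H : L2R3 →ₗ.[ℂ] L2R3) (l : ℝ) : ℕ∞ :=
  Cardinal.toENat (Module.rank ℂ (eigenspaceOf H l))

/-- The number of eigenvalues of `H` that are `< E`, counted with multiplicity. -/
def eigenvalueCount (H : L2R3 →ₗ.[ℂ] L2R3) (E : ℝ) : ℝ≥0∞ :=
  ∑' l : Set.Iio E, ((multiplicityOf H l : ℕ∞) : ℝ≥0∞)

/-- The Riesz sum `∑ (E_j - E)` over the eigenvalues `E_j < E` of `H`, with multiplicity. It is a
finite sum when `eigenvalueCount H E` is finite. -/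
def rieszSum (H : L2R3 →ₗ.[ℂ] L2R3) (E : ℝ) : ℝ :=
  ∑' l : Set.Iio E, ((multiplicityOf H l).toNat : ℝ) * ((l : ℝ) - E)

/-- `N^ħ(E; V, A)`. -/
def weylN (h : ℝ) (V : R3 → ℝ) (A : L2R3 →L[ℂ] L2R3) (E : ℝ) : ℝ≥0∞ :=
  eigenvalueCount (relHamiltonian h V A) E

/-- `S^ħ(E; V, A)`, including the factor `(2πħ)³`. -/
def weylS (h : ℝ) (V : R3 → ℝ) (A : L2R3 →L[ℂ] L2R3) (E : ℝ) : ℝ :=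
  (2 * Real.pi * h) ^ 3 * rieszSum (relHamiltonian h V A) E

/-- The classical Hamiltonian `√(1 + |p|²) - 1 + V(q)` at the phase space point `(q, p)`. -/
def classicalHamiltonian (V : R3 → ℝ) (z : R3 × R3) : ℝ :=
  √(1 + ‖z.2‖ ^ 2) - 1 + V z.1

/-- The Hilbert–Schmidt norm `Tr(T* T)^(1/2)`, the trace being computed in an orthonormal basis. -/
def hsNorm (T : L2R3 →L[ℂ] L2R3) : ℝ≥0∞ :=
  (∑' i, ‖T ((exists_hilbertBasis ℂ L2R3).choose_spec.choose i)‖ₑ ^ 2) ^ (1 / 2 : ℝ)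

lemma enorm_sq_eq_tsum {ι : Type*} (b : HilbertBasis ι ℂ L2R3) (x : L2R3) :
    ‖x‖ₑ ^ 2 = ∑' i, ‖inner ℂ (b i) x‖ₑ ^ 2 := by
  have h2 : HasSum (fun i => ‖inner ℂ (b i) x‖ ^ 2) (‖x‖ ^ 2) := by
    have h1 := lp.hasSum_norm (p := 2) (by norm_num) (b.repr x)
    simpa [b.repr_apply_apply] using h1
  have h3 := ENNReal.ofReal_tsum_of_nonneg (fun i => sq_nonneg ‖inner ℂ (b i) x‖) h2.summable
  rw [h2.tsum_eq] at h3
  simpa [ENNReal.ofReal_pow, ofReal_norm] using h3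

lemma tsum_enorm_sq_eq_adjoint {ι κ : Type*} (b : HilbertBasis ι ℂ L2R3)
    (c : HilbertBasis κ ℂ L2R3) (T : L2R3 →L[ℂ] L2R3) :
    ∑' i, ‖T (b i)‖ₑ ^ 2 = ∑' k, ‖ContinuousLinearMap.adjoint T (c k)‖ₑ ^ 2 := by
  simp_rw [enorm_sq_eq_tsum c (T _), enorm_sq_eq_tsum b (ContinuousLinearMap.adjoint T _)]
  rw [ENNReal.tsum_comm]
  refine tsum_congr fun k => tsum_congr fun i => ?_
  rw [ContinuousLinearMap.adjoint_inner_right, ← inner_conj_symm (T (b i)) (c k), RCLike.enorm_conj]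

/-- The Hilbert–Schmidt norm can be computed in any orthonormal basis. -/
theorem hsNorm_eq {ι : Type*} (b : HilbertBasis ι ℂ L2R3) (T : L2R3 →L[ℂ] L2R3) :
    hsNorm T = (∑' i, ‖T (b i)‖ₑ ^ 2) ^ (1 / 2 : ℝ) := by
  rw [hsNorm, tsum_enorm_sq_eq_adjoint _ b T, tsum_enorm_sq_eq_adjoint b b T]

/-- The weak `L^p` quasi-norm `‖f‖_{L^{p,∞}} = sup_{t > 0} t |{|f| > t}|^{1/p}`. -/
def weakLpNorm (f : R3 → ℝ) (p : ℝ) : ℝ≥0∞ :=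
  ⨆ t : ℝ≥0, (t : ℝ≥0∞) * volume {x | (t : ℝ) < |f x|} ^ (1 / p)

/-- The norm `sup |f| + sup |∇f|` of `C¹(ℝ³)`. -/
def c1Norm (f : R3 → ℝ) : ℝ≥0∞ :=
  (⨆ x, ‖f x‖ₑ) + ⨆ x, ‖fderiv ℝ f x‖ₑ

/-- The standing assumptions on the potentials `V_ħ` and the perturbations `A_ħ`, `ħ ∈ (0,1]`, with
reference energy `E₀`. -/
structure WeylAssumption (E₀ : ℝ) (V : ℝ → R3 → ℝ) (A : ℝ → L2R3 →L[ℂ] L2R3) : Prop where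
  E₀_neg : E₀ < 0
  nonpos : ∀ h ∈ Ioc (0 : ℝ) 1, ∀ x, V h x ≤ 0
  ne_zero : ∀ h ∈ Ioc (0 : ℝ) 1, V h ≠ 0
  contDiff : ∀ h ∈ Ioc (0 : ℝ) 1, ContDiff ℝ 1 (V h)
  weakL3_C1_bound : ∃ K : ℝ≥0, ∀ h ∈ Ioc (0 : ℝ) 1, weakLpNorm (V h) 3 + c1Norm (V h) ≤ K
  negPart_bound : ∃ K : ℝ≥0, ∀ h ∈ Ioc (0 : ℝ) 1,
    eLpNorm (fun x => min (V h x - E₀ / 2) 0) (3 / 2) volume ≤ K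
  selfAdjoint : ∀ h ∈ Ioc (0 : ℝ) 1, IsSelfAdjoint (A h)
  hs_bound : ∃ K : ℝ≥0, ∀ h ∈ Ioc (0 : ℝ) 1, hsNorm (A h) ≤ K * ENNReal.ofReal √h

end

open MeasureTheory Set Filter Topology
open scoped ENNReal NNReal FourierTransform SchwartzMap InnerProductSpace

noncomputable section

/-! Both laws are proved at a fixed `ħ` with explicit constants. Put `c = -E₀/2`, so that `E ≤ -2c`;
uniformity in `ħ` then means that the constants depend only on `c` and on the bounds in the
hypotheses.

Riesz sum. Gaussian coherent states of position width of order `√ħ` are used in both directions. The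
marginals of a Husimi density are Gaussian averages of `|f|²` and `|f̂|²`. The potential is
Lipschitz; the kinetic symbol is Lipschitz with constant `2πħ` in the frequency, where the Gaussian
has width of order `ħ^(-1/2)`. Hence averaging changes either energy by `O(√ħ)` only, and `A`
contributes at most its norm, again `O(√ħ)` (`re_inner_cohState_le`,
`integral_phaseSymbol_husimi_le`). For the lower bound, the Husimi densities of orthonormal
eigenvectors add up to at most `1`, so their total energy relative to `E` is at least the integral
of the negative part of the symbol (`integral_min_le_sum`). For the upper bound, the variational
inequality `∑ (e_i - E)|⟨f_i, u⟩|² ≤ ⟨u, (H - E)u⟩` is tested on the coherent states of the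
classically allowed region (`sum_le_integral_min`). The errors are `√ħ` times `(2πħ)³ N`,
respectively times a phase space volume, so a priori bounds on both are needed.

A priori bound. A normalized state of energy at most `-c` is either moved by `A` by a definite
amount or has definite mass in the well `V < -c/2` at frequencies `O(1/ħ)` (`one_le_of_energy_le`).
Summed over orthonormal eigenvectors, the first alternative is controlled by the Hilbert–Schmidt
norm and the second by Bessel's inequality for cut off plane waves, which gives `N = O(ħ⁻³)`
(`card_le`). Along weakly null sequences both quantities vanish, so the essential spectrum does not
reach below `-c`; with self-adjointness this yields the variational inequality
(`le_re_inner_of_orthogonal`, `sum_mul_inner_sq_le`).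

Counting. Difference quotients of the Riesz sum with step `δ` bracket `N`, and the classical ones
bracket the volume, which is Lipschitz in the energy (`volume_le_add`). The error is `√ħ/δ + δ` up
to constants, and `δ ~ ħ^(1/4)` balances it (`abs_weylN_sub_le`). -/

/-- The Fourier transform of `L²(ℝ³)` as a unitary operator. -/
abbrev FL2 : L2R3 ≃ₗᵢ[ℂ] L2R3 := Lp.fourierTransformₗᵢ R3 ℂ

/-! ### The unitary Fourier transform as an integral on `L¹ ∩ L²` -/

lemma continuous_fourier_of_integrable {f : R3 → ℂ} (hf : Integrable f) : Continuous (𝓕 f) :=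
  VectorFourier.fourierIntegral_continuous Real.continuous_fourierChar
    (innerSL ℝ).continuous₂ hf

lemma continuous_fourierInv_of_integrable {f : R3 → ℂ} (hf : Integrable f) :
    Continuous (𝓕⁻ f) := by
  have h := continuous_fourier_of_integrable hf
  have : 𝓕⁻ f = fun x => 𝓕 f (-x) := by
    ext x; exact Real.fourierInv_eq_fourier_neg f x
  rw [this]
  exact h.comp continuous_neg

lemma integral_fourier_smul_flip {f g : R3 → ℂ} (hf : Integrable f) (hg : Integrable g) :
    ∫ ξ, 𝓕 f ξ • g ξ = ∫ x, f x • 𝓕 g x := by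
  simpa using! (VectorFourier.integral_fourierIntegral_smul_eq_flip (L := innerₗ R3)
    Real.continuous_fourierChar continuous_inner hf hg)

lemma integral_fourierInv_smul_flip {f g : R3 → ℂ} (hf : Integrable f) (hg : Integrable g) :
    ∫ ξ, 𝓕⁻ f ξ • g ξ = ∫ x, f x • 𝓕⁻ g x := by
  have h := integral_fourier_smul_flip hf hg.comp_neg
  have h1 : ∀ x, 𝓕 (fun y => g (-y)) x = 𝓕⁻ g x := fun x => by
    rw [Real.fourierInv_eq_fourier_comp_neg]
  simp_rw [h1] at h
  rw [← h, ← integral_neg_eq_self]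
  simp_rw [Real.fourierInv_eq_fourier_neg, neg_neg]

/-- On `L¹ ∩ L²` the unitary Fourier transform is given by the Fourier integral. -/
lemma coeFn_FL2_toLp {f : R3 → ℂ} (hf : Integrable f) (hf2 : MemLp f 2) :
    (FL2 (hf2.toLp f) : R3 → ℂ) =ᵐ[volume] 𝓕 f := by
  apply ae_eq_of_integral_contDiff_smul_eq
  · exact (Lp.memLp _).locallyIntegrable (by norm_num)
  · exact (continuous_fourier_of_integrable hf).locallyIntegrable
  intro g hg hgc
  have hg₁ : HasCompactSupport (Complex.ofRealCLM ∘ g) := hgc.comp_left rfl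
  have hg₂ : ContDiff ℝ ((⊤ : ℕ∞) : WithTop ℕ∞) (Complex.ofRealCLM ∘ g) :=
    Complex.ofRealCLM.contDiff.comp hg
  set G : 𝓢(R3, ℂ) := hg₁.toSchwartzMap hg₂ with hG
  -- The unitary transform agrees with that of tempered distributions, so it moves to the test
  -- function; Fubini then moves it back to `f` as an integral.
  have h1 : (Lp.toTemperedDistribution (FL2 (hf2.toLp f))) G
      = Lp.toTemperedDistribution (hf2.toLp f) (𝓕 G) := by
    have := Lp.fourier_toTemperedDistribution_eq (hf2.toLp f)
    rw [← TemperedDistribution.fourier_apply, this]; rfl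
  rw [Lp.toTemperedDistribution_apply, Lp.toTemperedDistribution_apply] at h1
  have h2 : ∫ x, (𝓕 G) x • (hf2.toLp f : R3 → ℂ) x = ∫ x, (𝓕 G) x • f x := by
    apply integral_congr_ae
    filter_upwards [hf2.coeFn_toLp] with x hx
    rw [hx]
  have h3 : ∫ x, (𝓕 G) x • f x = ∫ x, G x • 𝓕 f x := by
    rw [SchwartzMap.fourier_coe]
    exact integral_fourier_smul_flip G.integrable hf
  rw [h2, h3] at h1
  simpa [hG] using h1

/-- On `L¹ ∩ L²` the inverse of the unitary Fourier transform is given by the inverse Fourier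
integral. -/
lemma coeFn_FL2_symm_toLp {f : R3 → ℂ} (hf : Integrable f) (hf2 : MemLp f 2) :
    (FL2.symm (hf2.toLp f) : R3 → ℂ) =ᵐ[volume] 𝓕⁻ f := by
  apply ae_eq_of_integral_contDiff_smul_eq
  · exact (Lp.memLp _).locallyIntegrable (by norm_num)
  · exact (continuous_fourierInv_of_integrable hf).locallyIntegrable
  intro g hg hgc
  have hg₁ : HasCompactSupport (Complex.ofRealCLM ∘ g) := hgc.comp_left rfl
  have hg₂ : ContDiff ℝ ((⊤ : ℕ∞) : WithTop ℕ∞) (Complex.ofRealCLM ∘ g) :=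
    Complex.ofRealCLM.contDiff.comp hg
  set G : 𝓢(R3, ℂ) := hg₁.toSchwartzMap hg₂ with hG
  have h1 : (Lp.toTemperedDistribution (FL2.symm (hf2.toLp f))) G
      = Lp.toTemperedDistribution (hf2.toLp f) (𝓕⁻ G) := by
    have := Lp.fourierInv_toTemperedDistribution_eq (hf2.toLp f)
    rw [← TemperedDistribution.fourierInv_apply, this]; rfl
  rw [Lp.toTemperedDistribution_apply, Lp.toTemperedDistribution_apply] at h1
  have h2 : ∫ x, (𝓕⁻ G) x • (hf2.toLp f : R3 → ℂ) x = ∫ x, (𝓕⁻ G) x • f x := by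
    apply integral_congr_ae
    filter_upwards [hf2.coeFn_toLp] with x hx
    rw [hx]
  have h3 : ∫ x, (𝓕⁻ G) x • f x = ∫ x, G x • 𝓕⁻ f x := by
    rw [SchwartzMap.fourierInv_coe]
    exact integral_fourierInv_smul_flip G.integrable hf
  rw [h2, h3] at h1
  simpa [hG] using h1

lemma lintegral_enorm_sq_Lp (u : L2R3) : ∫⁻ x, ‖u x‖ₑ ^ 2 = ‖u‖ₑ ^ 2 := by
  rw [Lp.enorm_def, eLpNorm_eq_lintegral_rpow_enorm_toReal (by norm_num) (by norm_num)]
  simp only [ENNReal.toReal_ofNat, ENNReal.rpow_ofNat, one_div]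
  rw [← ENNReal.rpow_natCast, ← ENNReal.rpow_mul]
  norm_num

/-- Plancherel's theorem for the Fourier integral on `L¹ ∩ L²`. -/
lemma lintegral_enorm_fourier_sq {f : R3 → ℂ} (hf : Integrable f) (hf2 : MemLp f 2) :
    ∫⁻ ξ, ‖𝓕 f ξ‖ₑ ^ 2 = ∫⁻ x, ‖f x‖ₑ ^ 2 := by
  have h1 : ∫⁻ ξ, ‖𝓕 f ξ‖ₑ ^ 2 = ∫⁻ ξ, ‖FL2 (hf2.toLp f) ξ‖ₑ ^ 2 := by
    apply lintegral_congr_ae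
    filter_upwards [coeFn_FL2_toLp hf hf2] with x hx
    rw [hx]
  have h2 : ∫⁻ ξ, ‖f ξ‖ₑ ^ 2 = ∫⁻ ξ, ‖(hf2.toLp f) ξ‖ₑ ^ 2 := by
    apply lintegral_congr_ae
    filter_upwards [hf2.coeFn_toLp] with x hx
    rw [hx]
  rw [h1, h2, lintegral_enorm_sq_Lp, lintegral_enorm_sq_Lp, ← ofReal_norm, ← ofReal_norm,
    LinearIsometryEquiv.norm_map]

/-! ### Gaussian densities and averages of Lipschitz functions -/

/-- The `L²`-normalized Gaussian of width `√s`. -/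
def gaussAmp (s : ℝ) (x : R3) : ℝ := (2 / s) ^ (3 / 4 : ℝ) * Real.exp (-Real.pi * ‖x‖ ^ 2 / s)

lemma gaussAmp_nonneg {s : ℝ} (hs : 0 < s) (x : R3) : 0 ≤ gaussAmp s x := by
  unfold gaussAmp; positivity

lemma continuous_gaussAmp (s : ℝ) : Continuous (gaussAmp s) := by
  unfold gaussAmp; fun_prop

lemma gaussAmp_le {s : ℝ} (hs : 0 < s) (x : R3) : gaussAmp s x ≤ (2 / s) ^ (3 / 4 : ℝ) := by
  unfold gaussAmp
  have : Real.exp (-Real.pi * ‖x‖ ^ 2 / s) ≤ 1 := by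
    rw [Real.exp_le_one_iff]
    have : 0 ≤ Real.pi * ‖x‖ ^ 2 / s := by positivity
    have h2 : -Real.pi * ‖x‖ ^ 2 / s = -(Real.pi * ‖x‖ ^ 2 / s) := by ring
    linarith
  exact mul_le_of_le_one_right (by positivity) this

lemma gaussAmp_neg (s : ℝ) (x : R3) : gaussAmp s (-x) = gaussAmp s x := by
  simp [gaussAmp]

lemma gaussAmp_sq {s : ℝ} (hs : 0 < s) (x : R3) :
    gaussAmp s x ^ 2 = (2 / s) ^ (3 / 2 : ℝ) * Real.exp (-(2 * Real.pi / s) * ‖x‖ ^ 2) := by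
  unfold gaussAmp
  rw [mul_pow, ← Real.rpow_natCast, ← Real.rpow_mul (by positivity), ← Real.exp_nat_mul]
  congr 2
  · norm_num
  · push_cast; ring

lemma integrable_exp_neg_mul_norm_sq {b : ℝ} (hb : 0 < b) :
    Integrable (fun x : R3 => Real.exp (-b * ‖x‖ ^ 2)) := by
  have := GaussianFourier.integrable_cexp_neg_mul_sq_norm_add (V := R3) (b := (b : ℂ))
    (by simpa using hb) 0 0
  refine this.re.congr (Filter.Eventually.of_forall fun x => ?_)
  simp only [zero_mul, add_zero]
  rw [show (-(b : ℂ) * (‖x‖ : ℂ) ^ 2) = ((-b * ‖x‖ ^ 2 : ℝ) : ℂ) by push_cast; ring,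
    ← Complex.ofReal_exp]
  rfl

lemma integral_exp_neg_mul_norm_sq {b : ℝ} (hb : 0 < b) :
    ∫ x : R3, Real.exp (-b * ‖x‖ ^ 2) = (Real.pi / b) ^ (3 / 2 : ℝ) := by
  have := GaussianFourier.integral_rexp_neg_mul_sq_norm (V := R3) hb
  rw [this]
  simp

lemma integrable_gaussAmp {s : ℝ} (hs : 0 < s) : Integrable (gaussAmp s) := by
  have := (integrable_exp_neg_mul_norm_sq (b := Real.pi / s) (by positivity)).const_mul
    ((2 / s) ^ (3 / 4 : ℝ))
  refine this.congr (Filter.Eventually.of_forall fun x => ?_)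
  simp only [gaussAmp]
  congr 2; ring

lemma integrable_gaussAmp_sq {s : ℝ} (hs : 0 < s) : Integrable (fun x => gaussAmp s x ^ 2) := by
  simp_rw [gaussAmp_sq hs]
  exact (integrable_exp_neg_mul_norm_sq (by positivity)).const_mul _

lemma integral_gaussAmp_sq {s : ℝ} (hs : 0 < s) : ∫ x, gaussAmp s x ^ 2 = 1 := by
  simp_rw [gaussAmp_sq hs]
  rw [integral_const_mul, integral_exp_neg_mul_norm_sq (by positivity),
    ← Real.mul_rpow (by positivity) (by positivity)]
  have : 2 / s * (Real.pi / (2 * Real.pi / s)) = 1 := by field_simp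
  rw [this, Real.one_rpow]

/-- With `t = ‖x‖/√s` this is `t ≤ t² + 1 ≤ exp(t²)`. It absorbs a linear weight into a small part
of the Gaussian decay, so that moments reduce to Gaussian integrals. -/
lemma norm_le_sqrt_mul_exp {s : ℝ} (hs : 0 < s) (x : R3) :
    ‖x‖ ≤ √s * Real.exp (‖x‖ ^ 2 / s) := by
  have h2 := Real.add_one_le_exp (‖x‖ ^ 2 / s)
  have h3 : ‖x‖ / √s ≤ ‖x‖ ^ 2 / s + 1 := by
    have : ‖x‖ ^ 2 / s = (‖x‖ / √s) ^ 2 := by rw [div_pow, Real.sq_sqrt hs.le]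
    rw [this]; nlinarith [sq_nonneg (‖x‖ / √s - 1), sq_nonneg (‖x‖ / √s)]
  have h4 : ‖x‖ / √s ≤ Real.exp (‖x‖ ^ 2 / s) := h3.trans h2
  rwa [div_le_iff₀' (by positivity)] at h4

lemma norm_mul_gaussAmp_sq_le {s : ℝ} (hs : 0 < s) (x : R3) :
    ‖x‖ * gaussAmp s x ^ 2 ≤
      √s * ((2 / s) ^ (3 / 2 : ℝ) * Real.exp (-(Real.pi / s) * ‖x‖ ^ 2)) := by
  rw [gaussAmp_sq hs]
  have h1 := norm_le_sqrt_mul_exp hs x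
  have h2 : Real.exp (‖x‖ ^ 2 / s) * Real.exp (-(2 * Real.pi / s) * ‖x‖ ^ 2) ≤
      Real.exp (-(Real.pi / s) * ‖x‖ ^ 2) := by
    rw [← Real.exp_add, Real.exp_le_exp]
    have h3 : 0 ≤ (Real.pi - 1) * (‖x‖ ^ 2 / s) :=
      mul_nonneg (by linarith [Real.pi_gt_three]) (by positivity)
    have h4 : ‖x‖ ^ 2 / s + -(2 * Real.pi / s) * ‖x‖ ^ 2 - -(Real.pi / s) * ‖x‖ ^ 2 =
      -((Real.pi - 1) * (‖x‖ ^ 2 / s)) := by ring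
    linarith
  have h5 : (0 : ℝ) ≤ (2 / s) ^ (3 / 2 : ℝ) := by positivity
  calc _ ≤ (√s * Real.exp (‖x‖ ^ 2 / s)) *
        ((2 / s) ^ (3 / 2 : ℝ) * Real.exp (-(2 * Real.pi / s) * ‖x‖ ^ 2)) := by gcongr
    _ = √s * ((2 / s) ^ (3 / 2 : ℝ) *
        (Real.exp (‖x‖ ^ 2 / s) * Real.exp (-(2 * Real.pi / s) * ‖x‖ ^ 2))) := by ring
    _ ≤ _ := by gcongr

lemma integrable_norm_mul_gaussAmp_sq {s : ℝ} (hs : 0 < s) :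
    Integrable (fun x => ‖x‖ * gaussAmp s x ^ 2) := by
  refine Integrable.mono' (((integrable_exp_neg_mul_norm_sq (b := Real.pi / s)
    (by positivity)).const_mul ((2 / s) ^ (3 / 2 : ℝ))).const_mul √s) ?_
    (Filter.Eventually.of_forall fun x => ?_)
  · exact (continuous_norm.mul ((continuous_gaussAmp s).pow 2)).aestronglyMeasurable
  · rw [Real.norm_of_nonneg (by positivity)]
    exact norm_mul_gaussAmp_sq_le hs x

/-- The first moment of the Gaussian density. -/
lemma integral_norm_mul_gaussAmp_sq_le {s : ℝ} (hs : 0 < s) :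
    ∫ x, ‖x‖ * gaussAmp s x ^ 2 ≤ 3 * √s := by
  calc _ ≤ ∫ x : R3, √s * ((2 / s) ^ (3 / 2 : ℝ) * Real.exp (-(Real.pi / s) * ‖x‖ ^ 2)) :=
        integral_mono (integrable_norm_mul_gaussAmp_sq hs)
          (((integrable_exp_neg_mul_norm_sq (by positivity)).const_mul _).const_mul _)
          (norm_mul_gaussAmp_sq_le hs)
    _ = √s * 2 ^ (3 / 2 : ℝ) := by
        rw [integral_const_mul, integral_const_mul, integral_exp_neg_mul_norm_sq (by positivity),
          ← Real.mul_rpow (by positivity) (by positivity)]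
        congr 2
        field_simp
    _ ≤ √s * 3 := by
        gcongr
        have h1 : (2 : ℝ) ^ (3 / 2 : ℝ) = √8 := by
          rw [Real.sqrt_eq_rpow, show (8 : ℝ) = 2 ^ (3 : ℝ) by norm_num,
            ← Real.rpow_mul (by norm_num)]
          norm_num
        rw [h1, Real.sqrt_le_left (by norm_num)]
        norm_num
    _ = 3 * √s := mul_comm _ _

/-- Averaging a Lipschitz function against the Gaussian density. -/
lemma lipschitz_mul_gaussAmp_sq {s L : ℝ} (hs : 0 < s) {a : R3 → ℝ}
    (ha : ∀ x y, |a x - a y| ≤ L * ‖x - y‖) (x : R3) :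
    Integrable (fun q => a q * gaussAmp s (x - q) ^ 2) ∧
      |(∫ q, a q * gaussAmp s (x - q) ^ 2) - a x| ≤ L * (3 * √s) := by
  -- The sign of `L` is forced by the Lipschitz bound at two distinct points.
  have hL : 0 ≤ L := by
    obtain ⟨v, hv⟩ := exists_ne (0 : R3)
    have h1 := (abs_nonneg _).trans (ha v 0)
    rw [sub_zero] at h1
    exact nonneg_of_mul_nonneg_left h1 (norm_pos_iff.mpr hv)
  have hac : Continuous a := by
    have : LipschitzWith ⟨L, hL⟩ a := LipschitzWith.of_dist_le_mul fun x y => by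
      rw [Real.dist_eq, dist_eq_norm]; exact ha x y
    exact this.continuous
  have hm := (integrable_norm_mul_gaussAmp_sq hs).comp_sub_left x
  have h2 := (integrable_gaussAmp_sq hs).comp_sub_left x
  have hd : Integrable (fun q => (a q - a x) * gaussAmp s (x - q) ^ 2) := by
    refine Integrable.mono' (hm.const_mul L) ?_ (Filter.Eventually.of_forall fun q => ?_)
    · refine Continuous.aestronglyMeasurable ?_
      have := continuous_gaussAmp s
      fun_prop
    · rw [norm_mul, Real.norm_eq_abs, Real.norm_of_nonneg (sq_nonneg _), ← mul_assoc,
        norm_sub_rev]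
      gcongr; exact ha q x
  have hi : Integrable (fun q => a q * gaussAmp s (x - q) ^ 2) := by
    refine (hd.add (h2.const_mul (a x))).congr (Filter.Eventually.of_forall fun q => ?_)
    simp only [Pi.add_apply]; ring
  refine ⟨hi, ?_⟩
  have h1 : ∫ q, gaussAmp s (x - q) ^ 2 = 1 := by
    rw [integral_sub_left_eq_self (fun q => gaussAmp s q ^ 2) volume x, integral_gaussAmp_sq hs]
  have h3 : (∫ q, a q * gaussAmp s (x - q) ^ 2) - a x =
      ∫ q, (a q - a x) * gaussAmp s (x - q) ^ 2 := by
    simp_rw [sub_mul]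
    rw [integral_sub hi (h2.const_mul _), integral_const_mul, h1, mul_one]
  rw [h3]
  calc _ ≤ ∫ q, ‖(a q - a x) * gaussAmp s (x - q) ^ 2‖ := norm_integral_le_integral_norm _
    _ ≤ ∫ q, L * (‖x - q‖ * gaussAmp s (x - q) ^ 2) := by
        refine integral_mono hd.norm (hm.const_mul L) fun q => ?_
        simp only
        rw [norm_mul, Real.norm_eq_abs, Real.norm_of_nonneg (sq_nonneg _), ← mul_assoc,
          norm_sub_rev]
        gcongr; exact ha q x
    _ = L * ∫ q, ‖q‖ * gaussAmp s q ^ 2 := by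
        rw [integral_const_mul,
          integral_sub_left_eq_self (fun q => ‖q‖ * gaussAmp s q ^ 2) volume x]
    _ ≤ _ := by gcongr; exact integral_norm_mul_gaussAmp_sq_le hs

/-! ### Coherent states, Husimi densities and the position marginal -/

/-- The Gaussian coherent state centred at the phase space point `(q, η)`, as a function. -/
def cohFun (s : ℝ) (q η : R3) (x : R3) : ℂ := 𝐞 ⟪η, x⟫_ℝ • (gaussAmp s (x - q) : ℂ)

lemma continuous_cohFun (s : ℝ) (q η : R3) : Continuous (cohFun s q η) := by
  have h1 := continuous_gaussAmp s
  have h2 : Continuous fun x : R3 => 𝐞 ⟪η, x⟫_ℝ :=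
    Real.continuous_fourierChar.comp (continuous_const.inner continuous_id)
  exact h2.smul (Complex.continuous_ofReal.comp (h1.comp (continuous_id.sub continuous_const)))

lemma norm_cohFun {s : ℝ} (hs : 0 < s) (q η x : R3) : ‖cohFun s q η x‖ = gaussAmp s (x - q) := by
  rw [cohFun, Circle.norm_smul, Complex.norm_of_nonneg (gaussAmp_nonneg hs _)]

lemma integrable_cohFun {s : ℝ} (hs : 0 < s) (q η : R3) : Integrable (cohFun s q η) := by
  refine Integrable.mono' ((integrable_gaussAmp hs).comp_sub_right q)
    (continuous_cohFun s q η).aestronglyMeasurable (Filter.Eventually.of_forall fun x => ?_)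
  rw [norm_cohFun hs]

lemma memLp_cohFun {s : ℝ} (hs : 0 < s) (q η : R3) : MemLp (cohFun s q η) 2 := by
  rw [memLp_two_iff_integrable_sq_norm (continuous_cohFun s q η).aestronglyMeasurable]
  simp_rw [norm_cohFun hs]
  exact (integrable_gaussAmp_sq hs).comp_sub_right q

/-- The Gaussian coherent state centred at the phase space point `(q, η)`. -/
def cohState {s : ℝ} (hs : 0 < s) (q η : R3) : L2R3 := (memLp_cohFun hs q η).toLp _

lemma coeFn_cohState {s : ℝ} (hs : 0 < s) (q η : R3) :
    (cohState hs q η : R3 → ℂ) =ᵐ[volume] cohFun s q η := MemLp.coeFn_toLp _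

lemma norm_sq_Lp (u : L2R3) : ‖u‖ ^ 2 = ∫ x, ‖u x‖ ^ 2 := by
  have := lintegral_enorm_sq_Lp u
  rw [integral_eq_lintegral_of_nonneg_ae (Filter.Eventually.of_forall fun x => sq_nonneg _)
    ((Lp.aestronglyMeasurable u).norm.pow 2)]
  simp_rw [ENNReal.ofReal_pow (norm_nonneg _), ofReal_norm]
  rw [this]
  simp

lemma integrable_norm_sq_Lp (u : L2R3) : Integrable (fun x => ‖u x‖ ^ 2) :=
  (memLp_two_iff_integrable_sq_norm (Lp.aestronglyMeasurable u)).1 (Lp.memLp u)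

lemma norm_cohState {s : ℝ} (hs : 0 < s) (q η : R3) : ‖cohState hs q η‖ = 1 := by
  have h1 : ‖cohState hs q η‖ ^ 2 = 1 := by
    rw [norm_sq_Lp]
    have : ∀ᵐ x : R3, ‖cohState hs q η x‖ ^ 2 = gaussAmp s (x - q) ^ 2 := by
      filter_upwards [coeFn_cohState hs q η] with x hx
      rw [hx, norm_cohFun hs]
    rw [integral_congr_ae this, integral_sub_right_eq_self (fun x => gaussAmp s x ^ 2) q,
      integral_gaussAmp_sq hs]
  exact (pow_eq_one_iff_of_nonneg (norm_nonneg _) two_ne_zero).1 h1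

lemma memLp_gaussAmp_mul {s : ℝ} (hs : 0 < s) (q : R3) (f : L2R3) :
    MemLp (fun x => (gaussAmp s (x - q) : ℂ) * f x) 2 := by
  have h1 := continuous_gaussAmp s
  refine (Lp.memLp f).of_le_mul (c := (2 / s) ^ (3 / 4 : ℝ)) ?_
    (Filter.Eventually.of_forall fun x => ?_)
  · refine (Continuous.aestronglyMeasurable ?_).mul (Lp.aestronglyMeasurable f)
    fun_prop
  · rw [norm_mul, Complex.norm_of_nonneg (gaussAmp_nonneg hs _)]
    gcongr
    exact gaussAmp_le hs _

lemma integrable_gaussAmp_mul {s : ℝ} (hs : 0 < s) (q : R3) (f : L2R3) :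
    Integrable (fun x => (gaussAmp s (x - q) : ℂ) * f x) := by
  have h : MemLp (fun x => (gaussAmp s (x - q) : ℂ)) 2 := by
    refine (memLp_cohFun hs q 0).congr_norm ?_ (Filter.Eventually.of_forall fun x => ?_)
    · have h1 := continuous_gaussAmp s
      refine Continuous.aestronglyMeasurable ?_
      fun_prop
    · rw [norm_cohFun hs, Complex.norm_of_nonneg (gaussAmp_nonneg hs _)]
  exact h.integrable_mul (Lp.memLp f)

/-- Pairing with a coherent state is a windowed Fourier transform. -/
lemma inner_cohState {s : ℝ} (hs : 0 < s) (q η : R3) (f : L2R3) :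
    ⟪cohState hs q η, f⟫_ℂ = 𝓕 (fun x => (gaussAmp s (x - q) : ℂ) * f x) η := by
  rw [L2.inner_def, Real.fourier_eq]
  apply integral_congr_ae
  filter_upwards [coeFn_cohState hs q η] with x hx
  rw [hx, cohFun, Circle.smul_def, Circle.smul_def, RCLike.inner_apply, smul_eq_mul, smul_eq_mul,
    map_mul, Complex.conj_ofReal, AddChar.map_neg_eq_inv, Circle.coe_inv_eq_conj,
    real_inner_comm x η]
  ring

/-- Plancherel in the frequency at a fixed centre `q`, the pairing being a windowed Fourier
transform. This produces the position marginal of the Husimi density. -/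
lemma lintegral_inner_cohState {s : ℝ} (hs : 0 < s) (q : R3) (f : L2R3) :
    ∫⁻ η, ‖⟪cohState hs q η, f⟫_ℂ‖ₑ ^ 2 =
      ∫⁻ x, ‖(gaussAmp s (x - q) : ℂ) * f x‖ₑ ^ 2 := by
  simp_rw [inner_cohState]
  exact lintegral_enorm_fourier_sq (integrable_gaussAmp_mul hs q f) (memLp_gaussAmp_mul hs q f)

lemma integrable_gaussAmp_sq_mul {s : ℝ} (hs : 0 < s) (q : R3) (f : L2R3) :
    Integrable (fun x => gaussAmp s (x - q) ^ 2 * ‖f x‖ ^ 2) := by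
  have := (memLp_gaussAmp_mul hs q f)
  rw [memLp_two_iff_integrable_sq_norm this.1] at this
  refine this.congr (Filter.Eventually.of_forall fun x => ?_)
  simp only
  rw [norm_mul, mul_pow, Complex.norm_of_nonneg (gaussAmp_nonneg hs _)]

/-- The Husimi density of `f` at the phase space point `z = (q, η)`. -/
def husimi {s : ℝ} (hs : 0 < s) (f : L2R3) (z : R3 × R3) : ℝ :=
  ‖⟪cohState hs z.1 z.2, f⟫_ℂ‖ ^ 2

lemma husimi_nonneg {s : ℝ} (hs : 0 < s) (f : L2R3) (z : R3 × R3) : 0 ≤ husimi hs f z :=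
  sq_nonneg _

lemma stronglyMeasurable_inner_cohState {s : ℝ} (hs : 0 < s) (f : L2R3) :
    StronglyMeasurable (fun z : R3 × R3 => ⟪cohState hs z.1 z.2, f⟫_ℂ) := by
  simp_rw [inner_cohState, Real.fourier_eq]
  have h1 := continuous_gaussAmp s
  refine StronglyMeasurable.integral_prod_right (f := fun (z : R3 × R3) (x : R3) =>
    𝐞 (-⟪x, z.2⟫_ℝ) • ((gaussAmp s (x - z.1) : ℂ) * f x)) ?_
  simp_rw [Function.uncurry_def, Circle.smul_def, smul_eq_mul]
  refine StronglyMeasurable.mul ?_ (StronglyMeasurable.mul ?_ ?_)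
  · refine (Continuous.stronglyMeasurable ?_)
    refine continuous_subtype_val.comp (Real.continuous_fourierChar.comp ?_)
    fun_prop
  · refine (Continuous.stronglyMeasurable ?_)
    fun_prop
  · exact (Lp.stronglyMeasurable f).comp_measurable measurable_snd

lemma stronglyMeasurable_husimi {s : ℝ} (hs : 0 < s) (f : L2R3) :
    StronglyMeasurable (husimi hs f) :=
  (stronglyMeasurable_inner_cohState hs f).norm.pow 2

lemma integral_husimi_right {s : ℝ} (hs : 0 < s) (q : R3) (f : L2R3) :
    Integrable (fun η => husimi hs f (q, η)) ∧
      ∫ η, husimi hs f (q, η) = ∫ x, gaussAmp s (x - q) ^ 2 * ‖f x‖ ^ 2 := by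
  have hm : StronglyMeasurable (fun η => husimi hs f (q, η)) :=
    (stronglyMeasurable_husimi hs f).comp_measurable measurable_prodMk_left
  have h1 : ∫⁻ η, ENNReal.ofReal (husimi hs f (q, η)) =
      ENNReal.ofReal (∫ x, gaussAmp s (x - q) ^ 2 * ‖f x‖ ^ 2) := by
    rw [ofReal_integral_eq_lintegral_ofReal (integrable_gaussAmp_sq_mul hs q f)
      (Filter.Eventually.of_forall fun x => by positivity)]
    calc _ = ∫⁻ η, ‖⟪cohState hs q η, f⟫_ℂ‖ₑ ^ 2 := by
          refine lintegral_congr fun η => ?_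
          rw [husimi, ENNReal.ofReal_pow (norm_nonneg _), ofReal_norm]
      _ = _ := by
          rw [lintegral_inner_cohState]
          refine lintegral_congr fun x => ?_
          rw [← ofReal_norm, ← ENNReal.ofReal_pow (norm_nonneg _), norm_mul, mul_pow,
            Complex.norm_of_nonneg (gaussAmp_nonneg hs _)]
  refine ⟨⟨hm.aestronglyMeasurable, ?_⟩, ?_⟩
  · rw [hasFiniteIntegral_iff_ofReal (Filter.Eventually.of_forall fun x => husimi_nonneg hs f _),
      h1]
    exact ENNReal.ofReal_lt_top
  · rw [integral_eq_lintegral_of_nonneg_ae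
      (Filter.Eventually.of_forall fun x => husimi_nonneg hs f _) hm.aestronglyMeasurable, h1,
      ENNReal.toReal_ofReal (integral_nonneg fun x => by positivity)]

/-- The position marginal of the Husimi density, tested against a Lipschitz function. -/
lemma integral_fst_mul_husimi {s L : ℝ} (hs : 0 < s) {a : R3 → ℝ}
    (ha : ∀ x y, |a x - a y| ≤ L * ‖x - y‖) (f : L2R3)
    (haf : Integrable (fun x => a x * ‖f x‖ ^ 2)) :
    Integrable (fun z : R3 × R3 => a z.1 * husimi hs f z) ∧
      |(∫ z : R3 × R3, a z.1 * husimi hs f z) - ∫ x, a x * ‖f x‖ ^ 2| ≤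
        L * (3 * √s) * ‖f‖ ^ 2 := by
  have hL : 0 ≤ L := by
    obtain ⟨v, hv⟩ := exists_ne (0 : R3)
    have h1 := (abs_nonneg _).trans (ha v 0)
    rw [sub_zero] at h1
    exact nonneg_of_mul_nonneg_left h1 (norm_pos_iff.mpr hv)
  have hac : Continuous a := by
    have : LipschitzWith ⟨L, hL⟩ a := LipschitzWith.of_dist_le_mul fun x y => by
      rw [Real.dist_eq, dist_eq_norm]; exact ha x y
    exact this.continuous
  have hg := continuous_gaussAmp s
  -- `|a|` has the same Lipschitz constant, so the averaging estimate also bounds the integrals of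
  -- absolute values used for integrability.
  have ha' : ∀ x y, |(|a x| - |a y|)| ≤ L * ‖x - y‖ := fun x y =>
    (abs_abs_sub_abs_le _ _).trans (ha x y)
  have hf := integrable_norm_sq_Lp f
  -- With `z = (x, q)`, integration over `q` first gives a Gaussian average of `a` near `x`, while
  -- integration over `x` first gives the position marginal of the Husimi density weighted by `a q`.
  -- Fubini identifies the two.
  set F : R3 × R3 → ℝ := fun z => a z.2 * gaussAmp s (z.1 - z.2) ^ 2 * ‖f z.1‖ ^ 2 with hF
  have hFm : AEStronglyMeasurable F (volume.prod volume) := by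
    refine (Continuous.aestronglyMeasurable ?_).mul
      (((Lp.stronglyMeasurable f).comp_measurable measurable_fst).norm.pow 2).aestronglyMeasurable
    fun_prop
  have hFi : Integrable F (volume.prod volume) := by
    rw [integrable_prod_iff hFm]
    refine ⟨Filter.Eventually.of_forall fun x =>
      (lipschitz_mul_gaussAmp_sq hs ha x).1.mul_const (‖f x‖ ^ 2), ?_⟩
    refine Integrable.mono' (haf.norm.add (hf.const_mul (L * (3 * √s))))
      hFm.norm.integral_prod_right' (Filter.Eventually.of_forall fun x => ?_)
    have h1 : ∀ q, ‖F (x, q)‖ = |a q| * gaussAmp s (x - q) ^ 2 * ‖f x‖ ^ 2 := fun q => by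
      simp only [hF, norm_mul, Real.norm_eq_abs, abs_pow, abs_norm, sq_abs]
    simp_rw [h1]
    rw [integral_mul_const, Real.norm_of_nonneg (mul_nonneg (integral_nonneg fun q => by
      positivity) (by positivity))]
    have h2 := (abs_le.1 (lipschitz_mul_gaussAmp_sq hs ha' x).2).2
    simp only [Pi.add_apply, norm_mul, Real.norm_eq_abs, abs_pow, abs_norm]
    rw [← add_mul]
    gcongr
    linarith
  have hswap : ∀ q, ∫ η, husimi hs f (q, η) = ∫ x, gaussAmp s (x - q) ^ 2 * ‖f x‖ ^ 2 :=
    fun q => (integral_husimi_right hs q f).2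
  have hmeas : AEStronglyMeasurable (fun z : R3 × R3 => a z.1 * husimi hs f z)
      (volume.prod volume) :=
    (hac.comp continuous_fst).aestronglyMeasurable.mul
      (stronglyMeasurable_husimi hs f).aestronglyMeasurable
  have hi : Integrable (fun z : R3 × R3 => a z.1 * husimi hs f z) (volume.prod volume) := by
    rw [integrable_prod_iff hmeas]
    refine ⟨Filter.Eventually.of_forall fun q =>
      (integral_husimi_right hs q f).1.const_mul (a q), ?_⟩
    refine hFi.norm.integral_prod_right.congr (Filter.Eventually.of_forall fun q => ?_)
    simp only [hF, norm_mul, Real.norm_eq_abs, abs_pow, abs_norm, sq_abs,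
      abs_of_nonneg (husimi_nonneg hs f _)]
    rw [integral_const_mul, hswap, ← integral_const_mul]
    simp_rw [mul_assoc]
  refine ⟨hi, ?_⟩
  have h1 : ∫ z : R3 × R3, a z.1 * husimi hs f z = ∫ x, ∫ q, F (x, q) := by
    rw [Measure.volume_eq_prod, integral_prod _ hi]
    rw [integral_integral_swap (f := fun x q => F (x, q)) hFi]
    refine integral_congr_ae (Filter.Eventually.of_forall fun q => ?_)
    simp only [hF]
    rw [integral_const_mul, hswap, ← integral_const_mul]
    simp_rw [mul_assoc]
  rw [h1, ← integral_sub hFi.integral_prod_left haf, norm_sq_Lp, ← integral_const_mul]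
  refine (norm_integral_le_integral_norm _).trans
    (integral_mono (hFi.integral_prod_left.sub haf).norm (hf.const_mul _) fun x => ?_)
  simp only [hF, Pi.sub_apply]
  rw [integral_mul_const, ← sub_mul, norm_mul, Real.norm_eq_abs, Real.norm_of_nonneg (sq_nonneg _)]
  gcongr
  exact (lipschitz_mul_gaussAmp_sq hs ha x).2

/-- The Husimi density is a probability density. -/
lemma integral_husimi {s : ℝ} (hs : 0 < s) (f : L2R3) :
    Integrable (husimi hs f) ∧ ∫ z, husimi hs f z = ‖f‖ ^ 2 := by
  -- The weight `1` has Lipschitz constant `0`, so the averaging error vanishes.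
  have h := integral_fst_mul_husimi hs (L := 0) (a := fun _ => 1) (by simp) f
    (by simpa using integrable_norm_sq_Lp f)
  simp only [one_mul, zero_mul, ← norm_sq_Lp] at h
  exact ⟨h.1, by linarith [abs_nonpos_iff.1 h.2]⟩

/-! ### Fourier transforms of coherent states and the momentum marginal -/

lemma fourier_gaussAmp {s : ℝ} (hs : 0 < s) (w : R3) :
    𝓕 (fun x : R3 => (gaussAmp s x : ℂ)) w = (gaussAmp s⁻¹ w : ℂ) := by
  have h1 : (fun x : R3 => (gaussAmp s x : ℂ)) =
      (((2 / s) ^ (3 / 4 : ℝ) : ℝ) : ℂ) •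
        fun x : R3 => Complex.exp (-((Real.pi / s : ℝ) : ℂ) * ‖x‖ ^ 2) := by
    ext x
    simp only [gaussAmp, Pi.smul_apply, smul_eq_mul]
    push_cast
    congr 2
    ring
  have h2 := fourier_gaussian_innerProductSpace (V := R3) (b := ((Real.pi / s : ℝ) : ℂ))
    (by rw [Complex.ofReal_re]; positivity) w
  have h3 : 𝓕 ((((2 / s) ^ (3 / 4 : ℝ) : ℝ) : ℂ) • fun x : R3 =>
      Complex.exp (-((Real.pi / s : ℝ) : ℂ) * ‖x‖ ^ 2)) w =
      (((2 / s) ^ (3 / 4 : ℝ) : ℝ) : ℂ) • 𝓕 (fun x : R3 =>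
      Complex.exp (-((Real.pi / s : ℝ) : ℂ) * ‖x‖ ^ 2)) w := by
    rw [Real.fourier_eq, Real.fourier_eq, ← integral_smul]
    refine integral_congr_ae (Filter.Eventually.of_forall fun x => ?_)
    simp only [Pi.smul_apply]
    rw [smul_comm]
  rw [h1, h3, h2, smul_eq_mul]
  have h4 : (Real.pi / ((Real.pi / s : ℝ) : ℂ)) ^ ((Module.finrank ℝ R3 : ℂ) / 2) =
      ((s ^ (3 / 2 : ℝ) : ℝ) : ℂ) := by
    have : (Real.pi : ℂ) / ((Real.pi / s : ℝ) : ℂ) = (s : ℂ) := by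
      push_cast
      have := hs.ne'
      have h5 : (s : ℂ) ≠ 0 := by exact_mod_cast this
      have h6 : (Real.pi : ℂ) ≠ 0 := by exact_mod_cast Real.pi_ne_zero
      field_simp
    rw [this, Complex.ofReal_cpow hs.le]
    simp
  have h5 : Complex.exp (-(Real.pi : ℂ) ^ 2 * (‖w‖ : ℂ) ^ 2 / ((Real.pi / s : ℝ) : ℂ)) =
      ((Real.exp (-Real.pi * ‖w‖ ^ 2 / s⁻¹) : ℝ) : ℂ) := by
    rw [Complex.ofReal_exp]
    congr 1
    have : -(Real.pi) ^ 2 * ‖w‖ ^ 2 / (Real.pi / s) = -Real.pi * ‖w‖ ^ 2 / s⁻¹ := by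
      have := Real.pi_ne_zero
      field_simp
    rw [← this]
    push_cast
    rfl
  rw [h4, h5, gaussAmp, ← Complex.ofReal_mul, ← Complex.ofReal_mul, ← mul_assoc]
  congr 2
  -- Matching the normalizations: `(2/s)^(3/4) s^(3/2) = (2s)^(3/4)`.
  rw [show (3 / 2 : ℝ) = 3 / 4 + 3 / 4 by norm_num, Real.rpow_add hs, ← mul_assoc,
    ← Real.mul_rpow (by positivity) hs.le, ← Real.mul_rpow (by positivity) hs.le]
  congr 1
  field_simp

lemma fourier_cohFun {s : ℝ} (hs : 0 < s) (q η ξ : R3) :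
    𝓕 (cohFun s q η) ξ = 𝐞 ⟪η, q⟫_ℝ • cohFun s⁻¹ η (-q) ξ := by
  have h1 := fourier_gaussAmp hs (ξ - η)
  rw [Real.fourier_eq] at h1 ⊢
  rw [cohFun, ← h1, ← integral_add_right_eq_self _ q, smul_smul, ← AddChar.map_add_eq_mul,
    Circle.smul_def, ← integral_smul]
  refine integral_congr_ae (Filter.Eventually.of_forall fun x => ?_)
  simp only [cohFun]
  rw [← Circle.smul_def, smul_smul, smul_smul, ← AddChar.map_add_eq_mul,
    ← AddChar.map_add_eq_mul, add_sub_cancel_right]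
  congr 2
  simp only [inner_sub_right, inner_add_left, inner_add_right, inner_neg_left,
    real_inner_comm q η, real_inner_comm x η]
  ring

lemma FL2_cohState {s : ℝ} (hs : 0 < s) (q η : R3) :
    FL2 (cohState hs q η) = (𝐞 ⟪η, q⟫_ℝ : ℂ) • cohState (inv_pos.2 hs) η (-q) := by
  apply Lp.ext
  filter_upwards [coeFn_FL2_toLp (integrable_cohFun hs q η) (memLp_cohFun hs q η),
    Lp.coeFn_smul (𝐞 ⟪η, q⟫_ℝ : ℂ) (cohState (inv_pos.2 hs) η (-q)),
    coeFn_cohState (inv_pos.2 hs) η (-q)] with ξ h1 h2 h3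
  rw [cohState, h1, h2, Pi.smul_apply, h3, fourier_cohFun hs]
  rfl

lemma norm_inner_cohState_FL2 {s : ℝ} (hs : 0 < s) (q η : R3) (f : L2R3) :
    ‖⟪cohState hs q η, f⟫_ℂ‖ = ‖⟪cohState (inv_pos.2 hs) η (-q), FL2 f⟫_ℂ‖ := by
  rw [← FL2.inner_map_map, FL2_cohState, inner_smul_left, norm_mul, RCLike.norm_conj,
    Circle.norm_coe, one_mul]

/-- Up to a phase, the Fourier transform sends a coherent state at `(q, η)` to one of inverse width
at `(η, -q)`. This rotation of phase space turns statements about the momentum marginal into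
statements about the position marginal. -/
lemma husimi_FL2 {s : ℝ} (hs : 0 < s) (f : L2R3) (z : R3 × R3) :
    husimi hs f z = husimi (inv_pos.2 hs) (FL2 f) (z.2, -z.1) := by
  rw [husimi, husimi, norm_inner_cohState_FL2]

lemma measurePreserving_swap_neg :
    MeasurePreserving (fun z : R3 × R3 => (z.2, -z.1)) volume volume := by
  have h1 : MeasurePreserving (Prod.swap : R3 × R3 → R3 × R3) volume volume :=
    Measure.measurePreserving_swap
  have h2 : MeasurePreserving (Prod.map id Neg.neg : R3 × R3 → R3 × R3) volume volume :=
    (MeasurePreserving.id volume).prod (Measure.measurePreserving_neg volume)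
  exact h2.comp h1

/-- The momentum marginal of the Husimi density, tested against a Lipschitz function. -/
lemma integral_snd_mul_husimi {s L : ℝ} (hs : 0 < s) {a : R3 → ℝ}
    (ha : ∀ x y, |a x - a y| ≤ L * ‖x - y‖) (f : L2R3)
    (haf : Integrable (fun ξ => a ξ * ‖FL2 f ξ‖ ^ 2)) :
    Integrable (fun z : R3 × R3 => a z.2 * husimi hs f z) ∧
      |(∫ z : R3 × R3, a z.2 * husimi hs f z) - ∫ ξ, a ξ * ‖FL2 f ξ‖ ^ 2| ≤
        L * (3 * √s⁻¹) * ‖f‖ ^ 2 := by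
  have h := integral_fst_mul_husimi (inv_pos.2 hs) ha (FL2 f) haf
  rw [FL2.norm_map] at h
  simp_rw [husimi_FL2 hs f]
  have he : MeasurableEmbedding (fun z : R3 × R3 => (z.2, -z.1)) :=
    ((MeasurableEquiv.prodComm (α := R3) (β := R3)).trans
      ((MeasurableEquiv.refl R3).prodCongr (MeasurableEquiv.neg R3))).measurableEmbedding
  have h1 := measurePreserving_swap_neg.integral_comp he
    (fun z : R3 × R3 => a z.1 * husimi (inv_pos.2 hs) (FL2 f) z)
  have h2 := (measurePreserving_swap_neg.integrable_comp_emb he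
    (g := fun z : R3 × R3 => a z.1 * husimi (inv_pos.2 hs) (FL2 f) z)).2 h.1
  refine ⟨h2, ?_⟩
  rw [← h1] at h
  exact h.2

/-! ### The kinetic energy and its self-adjointness -/

/-- The symbol of `√(1 - ħ²Δ) - 1` in the variable `ξ` dual to `x`. -/
def relSymbol (h : ℝ) (ξ : R3) : ℝ := √(1 + (h * (2 * Real.pi * ‖ξ‖)) ^ 2) - 1

lemma continuous_relSymbol (h : ℝ) : Continuous (relSymbol h) := by
  unfold relSymbol; fun_prop

lemma relSymbol_nonneg (h : ℝ) (ξ : R3) : 0 ≤ relSymbol h ξ := by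
  unfold relSymbol
  have : 1 ≤ √(1 + (h * (2 * Real.pi * ‖ξ‖)) ^ 2) := by
    rw [Real.one_le_sqrt]; nlinarith [sq_nonneg (h * (2 * Real.pi * ‖ξ‖))]
  linarith

lemma abs_sqrt_one_add_sq_sub_le (x y : ℝ) : |√(1 + x ^ 2) - √(1 + y ^ 2)| ≤ |x - y| := by
  have hx : 0 < √(1 + x ^ 2) := by positivity
  have hy : 0 < √(1 + y ^ 2) := by positivity
  have h1 : (√(1 + x ^ 2) - √(1 + y ^ 2)) * (√(1 + x ^ 2) + √(1 + y ^ 2)) = (x - y) * (x + y) := by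
    ring_nf
    rw [Real.sq_sqrt (by positivity), Real.sq_sqrt (by positivity)]; ring
  have hx' : |x| ≤ √(1 + x ^ 2) := Real.abs_le_sqrt (by linarith)
  have hy' : |y| ≤ √(1 + y ^ 2) := Real.abs_le_sqrt (by linarith)
  have h2 : |√(1 + x ^ 2) - √(1 + y ^ 2)| * (√(1 + x ^ 2) + √(1 + y ^ 2)) =
      |x - y| * |x + y| := by
    rw [← abs_mul, ← h1, abs_mul, abs_of_pos (add_pos hx hy)]
  have h3 : |x + y| ≤ √(1 + x ^ 2) + √(1 + y ^ 2) := (abs_add_le _ _).trans (add_le_add hx' hy')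
  refine le_of_mul_le_mul_right (h2.trans_le ?_) (add_pos hx hy)
  gcongr

/-- The function `√(1 + t²)` is `1`-Lipschitz. The factor `ħ` in the constant is essential: it
offsets the momentum spread, of order `ħ^(-1/2)`, of the coherent states. -/
lemma relSymbol_lipschitz {h : ℝ} (hh : 0 ≤ h) (ξ ζ : R3) :
    |relSymbol h ξ - relSymbol h ζ| ≤ 2 * Real.pi * h * ‖ξ - ζ‖ := by
  unfold relSymbol
  rw [sub_sub_sub_cancel_right]
  refine (abs_sqrt_one_add_sq_sub_le _ _).trans ?_
  have : h * (2 * Real.pi * ‖ξ‖) - h * (2 * Real.pi * ‖ζ‖) = 2 * Real.pi * h * (‖ξ‖ - ‖ζ‖) := by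
    ring
  rw [this, abs_mul, abs_of_nonneg (by positivity)]
  gcongr
  exact abs_norm_sub_norm_le _ _

lemma le_relSymbol {h : ℝ} (ξ : R3) : 2 * Real.pi * h * ‖ξ‖ - 1 ≤ relSymbol h ξ := by
  unfold relSymbol
  have : 2 * Real.pi * h * ‖ξ‖ ≤ √(1 + (h * (2 * Real.pi * ‖ξ‖)) ^ 2) :=
    Real.le_sqrt_of_sq_le (by nlinarith)
  linarith

lemma mem_relKinetic {h : ℝ} {u : L2R3} :
    u ∈ (relKinetic h).domain ↔ MemLp (fun ξ => (relSymbol h ξ : ℂ) * FL2 u ξ) 2 := Iff.rfl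

lemma FL2_relKinetic {h : ℝ} (u : (relKinetic h).domain) :
    (FL2 (relKinetic h u) : R3 → ℂ) =ᵐ[volume] fun ξ => (relSymbol h ξ : ℂ) * FL2 (u : L2R3) ξ := by
  have h1 : FL2 (relKinetic h u) = (mem_relKinetic.1 u.2).toLp _ :=
    FL2.apply_symm_apply _
  rw [h1]
  exact MemLp.coeFn_toLp _

lemma relKinetic_symm {h : ℝ} (u v : (relKinetic h).domain) :
    ⟪relKinetic h u, (v : L2R3)⟫_ℂ = ⟪(u : L2R3), relKinetic h v⟫_ℂ := by
  rw [← FL2.inner_map_map, ← FL2.inner_map_map (u : L2R3), L2.inner_def, L2.inner_def]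
  apply integral_congr_ae
  filter_upwards [FL2_relKinetic u, FL2_relKinetic v] with ξ h1 h2
  rw [h1, h2, RCLike.inner_apply, RCLike.inner_apply, map_mul, Complex.conj_ofReal]
  ring

lemma integrable_relSymbol_mul {h : ℝ} (u : (relKinetic h).domain) :
    Integrable (fun ξ => relSymbol h ξ * ‖FL2 (u : L2R3) ξ‖ ^ 2) := by
  have h1 := ((mem_relKinetic.1 u.2).norm).integrable_mul (Lp.memLp (FL2 (u : L2R3))).norm
  refine h1.congr (Filter.Eventually.of_forall fun ξ => ?_)
  simp only [Pi.mul_apply, norm_mul, Complex.norm_of_nonneg (relSymbol_nonneg h ξ)]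
  ring

lemma inner_relKinetic {h : ℝ} (u : (relKinetic h).domain) :
    ⟪(u : L2R3), relKinetic h u⟫_ℂ =
      ((∫ ξ, relSymbol h ξ * ‖FL2 (u : L2R3) ξ‖ ^ 2 : ℝ) : ℂ) := by
  rw [← FL2.inner_map_map, L2.inner_def, ← integral_complex_ofReal]
  apply integral_congr_ae
  filter_upwards [FL2_relKinetic u] with ξ h1
  rw [h1, RCLike.inner_apply, mul_assoc, RCLike.mul_conj]
  push_cast
  rfl

/-- On the Fourier side the inverse of `T + 1` is multiplication by a function bounded by `1`.
Together with symmetry, this surjectivity gives self-adjointness. -/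
lemma exists_relKinetic_add_eq (h : ℝ) (w : L2R3) :
    ∃ u : (relKinetic h).domain, relKinetic h u + u = w := by
  have hc := continuous_relSymbol h
  have hp : ∀ ξ, 0 < relSymbol h ξ + 1 := fun ξ => by linarith [relSymbol_nonneg h ξ]
  have h1 : MemLp (fun ξ => ((relSymbol h ξ + 1)⁻¹ : ℂ) * FL2 w ξ) 2 := by
    refine (Lp.memLp (FL2 w)).of_le_mul (c := 1) ?_ (Filter.Eventually.of_forall fun x => ?_)
    · refine (Measurable.aestronglyMeasurable ?_).mul (Lp.aestronglyMeasurable _)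
      have := hc.measurable
      fun_prop
    · rw [norm_mul]
      gcongr
      rw [norm_inv, ← Complex.ofReal_one, ← Complex.ofReal_add,
        Complex.norm_of_nonneg (hp x).le]
      exact inv_le_one_of_one_le₀ (by linarith [relSymbol_nonneg h x])
  set v : L2R3 := FL2.symm (h1.toLp _) with hv
  have h2 : (FL2 v : R3 → ℂ) =ᵐ[volume] fun ξ => ((relSymbol h ξ + 1)⁻¹ : ℂ) * FL2 w ξ := by
    rw [hv, FL2.apply_symm_apply]; exact MemLp.coeFn_toLp _
  have h3 : (fun ξ => (relSymbol h ξ : ℂ) * FL2 v ξ) =ᵐ[volume]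
      fun ξ => FL2 w ξ - FL2 v ξ := by
    filter_upwards [h2] with ξ hξ
    rw [hξ]
    have : ((relSymbol h ξ : ℂ) + 1) ≠ 0 := by exact_mod_cast (hp ξ).ne'
    field_simp
    ring
  have hmem : v ∈ (relKinetic h).domain :=
    mem_relKinetic.2 ((memLp_congr_ae h3).2 ((Lp.memLp _).sub (Lp.memLp _)))
  refine ⟨⟨v, hmem⟩, FL2.injective ?_⟩
  rw [map_add]
  apply Lp.ext
  filter_upwards [FL2_relKinetic ⟨v, hmem⟩, h3,
    Lp.coeFn_add (FL2 (relKinetic h ⟨v, hmem⟩)) (FL2 v)] with ξ h4 h5 h6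
  rw [h6, Pi.add_apply, h4, h5]
  ring

/-- Self-adjointness of the kinetic energy. -/
lemma relKinetic_of_forall_inner {h : ℝ} {u w : L2R3}
    (H : ∀ v : (relKinetic h).domain, ⟪relKinetic h v, u⟫_ℂ = ⟪(v : L2R3), w⟫_ℂ) :
    ∃ hu : u ∈ (relKinetic h).domain, relKinetic h ⟨u, hu⟩ = w := by
  obtain ⟨u', hu'⟩ := exists_relKinetic_add_eq h (w + u)
  -- The difference `u - u'` is orthogonal to the range of `T + 1`, which is everything.
  have h1 : u = u' := by
    obtain ⟨v, hv⟩ := exists_relKinetic_add_eq h (u - u')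
    have h2 : ⟪u - u', u - u'⟫_ℂ = 0 := by
      nth_rewrite 1 [← hv]
      have h3 : ⟪relKinetic h v + v, (u' : L2R3)⟫_ℂ = ⟪(v : L2R3), w + u⟫_ℂ := by
        rw [inner_add_left, relKinetic_symm, ← inner_add_right, hu']
      rw [inner_sub_right, h3, inner_add_left, H, inner_add_right, sub_self]
    exact sub_eq_zero.1 (inner_self_eq_zero.1 h2)
  subst h1
  exact ⟨u'.2, by rw [add_left_inj] at hu'; exact hu'⟩

/-! ### The potential and the full Hamiltonian -/

lemma mem_mulDomain_of_bounded {V : R3 → ℝ} {κ : ℝ} (hV : Continuous V) (hκ : ∀ x, |V x| ≤ κ)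
    (u : L2R3) : u ∈ mulDomain V := by
  refine (Lp.memLp u).of_le_mul (c := κ) ?_ (Filter.Eventually.of_forall fun x => ?_)
  · refine (Continuous.aestronglyMeasurable ?_).mul (Lp.aestronglyMeasurable _)
    fun_prop
  · rw [norm_mul, Complex.norm_real, Real.norm_eq_abs]
    gcongr
    exact hκ x

lemma coeFn_mulOp (m : R3 → ℝ) (u : (mulOp m).domain) :
    (mulOp m u : R3 → ℂ) =ᵐ[volume] fun x => (m x : ℂ) * (u : L2R3) x :=
  MemLp.coeFn_toLp (mem_mulDomain.1 u.2)

lemma inner_mulOp_symm (m : R3 → ℝ) (u v : (mulOp m).domain) :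
    ⟪mulOp m u, (v : L2R3)⟫_ℂ = ⟪(u : L2R3), mulOp m v⟫_ℂ := by
  rw [L2.inner_def, L2.inner_def]
  apply integral_congr_ae
  filter_upwards [coeFn_mulOp m u, coeFn_mulOp m v] with ξ h1 h2
  rw [h1, h2, RCLike.inner_apply, RCLike.inner_apply, map_mul, Complex.conj_ofReal]
  ring

lemma inner_mulOp (m : R3 → ℝ) (u : (mulOp m).domain) :
    ⟪(u : L2R3), mulOp m u⟫_ℂ = ((∫ x, m x * ‖(u : L2R3) x‖ ^ 2 : ℝ) : ℂ) := by
  rw [L2.inner_def, ← integral_complex_ofReal]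
  apply integral_congr_ae
  filter_upwards [coeFn_mulOp m u] with ξ h1
  rw [h1, RCLike.inner_apply, mul_assoc, RCLike.mul_conj]
  push_cast
  rfl

lemma norm_Lp_le_of_ae {u v : L2R3} {κ : ℝ} (h : ∀ᵐ x, ‖u x‖ ≤ κ * ‖v x‖) :
    ‖u‖ ≤ κ * ‖v‖ := Lp.norm_le_mul_norm_of_ae_le_mul h

/-- Multiplication by a bounded continuous potential as a bounded operator. -/
def potentialOp {V : R3 → ℝ} {κ : ℝ} (hV : Continuous V) (hκ : ∀ x, |V x| ≤ κ) :
    L2R3 →L[ℂ] L2R3 :=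
  LinearMap.mkContinuous
    ((mulOp V).toFun ∘ₗ LinearMap.codRestrict (mulOp V).domain LinearMap.id
      (mem_mulDomain_of_bounded hV hκ)) κ fun u => by
    refine norm_Lp_le_of_ae ?_
    filter_upwards [coeFn_mulOp V ⟨u, mem_mulDomain_of_bounded hV hκ u⟩] with x hx
    refine (congrArg norm hx).trans_le ?_
    rw [norm_mul, Complex.norm_real, Real.norm_eq_abs]
    gcongr
    exact hκ x

lemma potentialOp_symm {V : R3 → ℝ} {κ : ℝ} (hV : Continuous V) (hκ : ∀ x, |V x| ≤ κ)
    (u v : L2R3) : ⟪potentialOp hV hκ u, v⟫_ℂ = ⟪u, potentialOp hV hκ v⟫_ℂ :=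
  inner_mulOp_symm V ⟨u, mem_mulDomain_of_bounded hV hκ u⟩ ⟨v, mem_mulDomain_of_bounded hV hκ v⟩

lemma inner_potentialOp {V : R3 → ℝ} {κ : ℝ} (hV : Continuous V) (hκ : ∀ x, |V x| ≤ κ)
    (u : L2R3) :
    ⟪u, potentialOp hV hκ u⟫_ℂ = ((∫ x, V x * ‖u x‖ ^ 2 : ℝ) : ℂ) :=
  inner_mulOp V ⟨u, mem_mulDomain_of_bounded hV hκ u⟩

lemma integrable_potential_mul {V : R3 → ℝ} {κ : ℝ} (hV : Continuous V) (hκ : ∀ x, |V x| ≤ κ)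
    (u : L2R3) : Integrable (fun x => V x * ‖u x‖ ^ 2) :=
  (integrable_norm_sq_Lp u).bdd_mul (c := κ) hV.aestronglyMeasurable
    (Filter.Eventually.of_forall hκ)

lemma mem_relHamiltonian {h κ : ℝ} {V : R3 → ℝ} {A : L2R3 →L[ℂ] L2R3} (hV : Continuous V)
    (hκ : ∀ x, |V x| ≤ κ) {u : L2R3} :
    u ∈ (relHamiltonian h V A).domain ↔ u ∈ (relKinetic h).domain :=
  ⟨fun hu => hu.1.1, fun hu => ⟨⟨hu, mem_mulDomain_of_bounded hV hκ u⟩, trivial⟩⟩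

lemma relHamiltonian_apply {h κ : ℝ} {V : R3 → ℝ} {A : L2R3 →L[ℂ] L2R3} (hV : Continuous V)
    (hκ : ∀ x, |V x| ≤ κ) (u : (relHamiltonian h V A).domain) :
    relHamiltonian h V A u = relKinetic h ⟨u, u.2.1.1⟩ +
      (potentialOp hV hκ + A) (u : L2R3) := by
  rw [add_apply, ← add_assoc]
  rfl

/-! ### The variational principle below the essential spectrum -/

section Hilbert

variable {𝓗 : Type*} [NormedAddCommGroup 𝓗] [InnerProductSpace ℂ 𝓗]

/-- Bounded sequences in a separable Hilbert space have weakly convergent subsequences. -/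
lemma exists_weakly_convergent_subseq [CompleteSpace 𝓗] [TopologicalSpace.SeparableSpace 𝓗]
    {u : ℕ → 𝓗}
    (hu : ∀ n, ‖u n‖ ≤ 1) :
    ∃ (w : 𝓗) (φ : ℕ → ℕ), StrictMono φ ∧
      ∀ v, Tendsto (fun n => ⟪u (φ n), v⟫_ℂ) atTop (𝓝 ⟪w, v⟫_ℂ) := by
  have h := WeakDual.isSeqCompact_closedBall ℂ 𝓗 0 1
  obtain ⟨a, -, φ, hφ, ha⟩ := h
    (x := fun n => StrongDual.toWeakDual (InnerProductSpace.toDual ℂ 𝓗 (u n))) (fun n => by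
      simpa using hu n)
  refine ⟨(InnerProductSpace.toDual ℂ 𝓗).symm (WeakDual.toStrongDual a), φ, hφ, fun v => ?_⟩
  have h2 := ((WeakDual.eval_continuous v).tendsto a).comp ha
  rw [InnerProductSpace.toDual_symm_apply]
  exact h2

/-- For small `c` the linear term dominates, and the choice `c = -ε β̄` makes it negative unless `β
= 0`. This is the first variation at a minimizer. -/
lemma eq_zero_of_forall_re_mul_nonneg {β : ℂ} {q : ℝ}
    (h : ∀ c : ℂ, 0 ≤ 2 * (c * β).re + ‖c‖ ^ 2 * q) : β = 0 := by
  by_contra hβ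
  have hp : 0 < ‖β‖ ^ 2 := by positivity
  have key : ∀ ε : ℝ, 0 ≤ -2 * ε + ε ^ 2 * q := by
    intro ε
    have h1 := h (-(ε : ℂ) * (starRingEnd ℂ) β)
    have h2 : (-(ε : ℂ) * (starRingEnd ℂ) β * β).re = -ε * ‖β‖ ^ 2 := by
      rw [mul_assoc, Complex.conj_mul', ← Complex.ofReal_neg, ← Complex.ofReal_pow,
        ← Complex.ofReal_mul, Complex.ofReal_re]
    rw [h2] at h1
    simp only [norm_mul, norm_neg, Complex.norm_real, RCLike.norm_conj, Real.norm_eq_abs,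
      mul_pow, sq_abs] at h1
    have h3 : 0 ≤ (-2 * ε + ε ^ 2 * q) * ‖β‖ ^ 2 := by linarith
    exact nonneg_of_mul_nonneg_left h3 hp
  -- With this `ε` the quadratic term is at most `ε`, which cannot compensate `-2ε`.
  have h1 := key (1 / (|q| + 1))
  have h2 : (1 / (|q| + 1)) ^ 2 * q ≤ 1 / (|q| + 1) := by
    have : q ≤ |q| + 1 := (le_abs_self q).trans (by linarith)
    calc _ ≤ (1 / (|q| + 1)) ^ 2 * (|q| + 1) := by gcongr
      _ = _ := by field_simp
  have h3 : 0 < 1 / (|q| + 1) := by positivity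
  linarith

variable {H : 𝓗 →ₗ.[ℂ] 𝓗}

/-- The energy form of a symmetric operator on `u + c v`. -/
lemma re_inner_add_smul (hsymm : ∀ u v : H.domain, ⟪H u, (v : 𝓗)⟫_ℂ = ⟪(u : 𝓗), H v⟫_ℂ)
    (u v : H.domain) (c : ℂ) :
    (⟪((u + c • v : H.domain) : 𝓗), H (u + c • v)⟫_ℂ).re =
      (⟪(u : 𝓗), H u⟫_ℂ).re + 2 * (c * ⟪(u : 𝓗), H v⟫_ℂ).re +
        ‖c‖ ^ 2 * (⟪(v : 𝓗), H v⟫_ℂ).re := by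
  have h1 : ⟪(v : 𝓗), H u⟫_ℂ = (starRingEnd ℂ) ⟪(u : 𝓗), H v⟫_ℂ := by
    rw [← hsymm, inner_conj_symm]
  have h2 : (starRingEnd ℂ) c * c = ((‖c‖ ^ 2 : ℝ) : ℂ) := by rw [Complex.conj_mul']; simp
  simp only [LinearPMap.map_add, LinearPMap.map_smul, Submodule.coe_add, Submodule.coe_smul,
    inner_add_left, inner_add_right, inner_smul_left, inner_smul_right, h1]
  rw [mul_add, ← mul_assoc c, mul_comm c ((starRingEnd ℂ) c), h2, ← map_mul]
  simp only [Complex.add_re, Complex.conj_re, Complex.re_ofReal_mul]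
  ring

lemma norm_sq_add_smul (u v : 𝓗) (c : ℂ) :
    ‖u + c • v‖ ^ 2 = ‖u‖ ^ 2 + 2 * (c * ⟪u, v⟫_ℂ).re + ‖c‖ ^ 2 * ‖v‖ ^ 2 := by
  rw [@norm_add_sq ℂ, inner_smul_right, norm_smul, mul_pow]
  rfl

variable {ι : Type*} [Fintype ι] {f : ι → H.domain} {e : ι → ℝ}

/-- The projection of a domain vector to the complement of finitely many eigenvectors. -/
lemma inner_sub_sum_eq_zero (hf : Orthonormal ℂ (fun i => (f i : 𝓗))) (v : H.domain) (i : ι) :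
    ⟪(f i : 𝓗), ((v - ∑ j, ⟪(f j : 𝓗), (v : 𝓗)⟫_ℂ • f j : H.domain) : 𝓗)⟫_ℂ = 0 := by
  rw [Submodule.coe_sub, inner_sub_right, Submodule.coe_sum]
  simp only [Submodule.coe_smul]
  rw [hf.inner_right_fintype, sub_self]

/-- If `f` exhausts the eigenvectors below `E`, and the form is at least `E` along weak null
sequences, then the form is at least `E` on the complement of `f`. -/
theorem le_re_inner_of_orthogonal [CompleteSpace 𝓗] [TopologicalSpace.SeparableSpace 𝓗] {E b : ℝ}
    (hsymm : ∀ u v : H.domain, ⟪H u, (v : 𝓗)⟫_ℂ = ⟪(u : 𝓗), H v⟫_ℂ)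
    (hsa : ∀ u w : 𝓗, (∀ v : H.domain, ⟪H v, u⟫_ℂ = ⟪(v : 𝓗), w⟫_ℂ) →
      ∃ hu : u ∈ H.domain, H ⟨u, hu⟩ = w)
    (hbdd : ∀ u : H.domain, b * ‖(u : 𝓗)‖ ^ 2 ≤ (⟪(u : 𝓗), H u⟫_ℂ).re)
    (hcpt : ∀ u : ℕ → H.domain, (∀ n, ‖(u n : 𝓗)‖ = 1) →
      (∀ v, Tendsto (fun n => ⟪(u n : 𝓗), v⟫_ℂ) atTop (𝓝 0)) →
      ∀ μ, Tendsto (fun n => (⟪(u n : 𝓗), H (u n)⟫_ℂ).re) atTop (𝓝 μ) → E ≤ μ)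
    (hf : Orthonormal ℂ (fun i => (f i : 𝓗))) (he : ∀ i, H (f i) = (e i : ℂ) • (f i : 𝓗))
    (hcomplete : ∀ (u : H.domain) (l : ℝ), l < E → H u = (l : ℂ) • (u : 𝓗) →
      (∀ i, ⟪(f i : 𝓗), (u : 𝓗)⟫_ℂ = 0) → (u : 𝓗) = 0)
    (u : H.domain) (hu : ∀ i, ⟪(f i : 𝓗), (u : 𝓗)⟫_ℂ = 0) :
    E * ‖(u : 𝓗)‖ ^ 2 ≤ (⟪(u : 𝓗), H u⟫_ℂ).re := by
  by_contra! hlt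
  have hscale : ∀ (c : ℝ) (v : H.domain), (⟪(((c : ℂ) • v : H.domain) : 𝓗), H ((c : ℂ) • v)⟫_ℂ).re =
      c ^ 2 * (⟪(v : 𝓗), H v⟫_ℂ).re := fun c v => by
    rw [LinearPMap.map_smul, Submodule.coe_smul, inner_smul_left, inner_smul_right,
      Complex.conj_ofReal, Complex.re_ofReal_mul, Complex.re_ofReal_mul]
    ring
  set S : Set ℝ := {r | ∃ v : H.domain, ‖(v : 𝓗)‖ = 1 ∧ (∀ i, ⟪(f i : 𝓗), (v : 𝓗)⟫_ℂ = 0) ∧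
    (⟪(v : 𝓗), H v⟫_ℂ).re = r} with hS
  have hnormal : ∀ v : H.domain, (v : 𝓗) ≠ 0 → (∀ i, ⟪(f i : 𝓗), (v : 𝓗)⟫_ℂ = 0) →
      (‖(v : 𝓗)‖⁻¹) ^ 2 * (⟪(v : 𝓗), H v⟫_ℂ).re ∈ S := by
    intro v hv hvf
    refine ⟨((‖(v : 𝓗)‖⁻¹ : ℝ) : ℂ) • v, ?_, fun i => ?_, hscale _ _⟩
    · rw [Submodule.coe_smul, norm_smul, Complex.norm_real, norm_inv, norm_norm]
      exact inv_mul_cancel₀ (norm_ne_zero_iff.2 hv)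
    · rw [Submodule.coe_smul, inner_smul_right, hvf, mul_zero]
  have hSb : BddBelow S := by
    refine ⟨b, ?_⟩
    rintro r ⟨v, hv, -, rfl⟩
    simpa [hv] using hbdd v
  have hu0 : (u : 𝓗) ≠ 0 := by
    intro h0
    rw [h0] at hlt
    simp at hlt
  have hSn : S.Nonempty := ⟨_, hnormal u hu0 hu⟩
  -- If the claim fails, the infimum of the form over normalized vectors orthogonal to `f` lies
  -- below `E`. The weak limit `w` of a minimizing sequence is shown to be an eigenvector for `μ`,
  -- hence zero by exhaustion, which contradicts the assumption on weakly null sequences.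
  set μ := sInf S with hμ
  have hμE : μ < E := by
    refine (csInf_le hSb (hnormal u hu0 hu)).trans_lt ?_
    have : 0 < ‖(u : 𝓗)‖ := norm_pos_iff.2 hu0
    rw [inv_pow, inv_mul_lt_iff₀ (by positivity)]
    linarith
  have hq : ∀ v : H.domain, (∀ i, ⟪(f i : 𝓗), (v : 𝓗)⟫_ℂ = 0) →
      0 ≤ (⟪(v : 𝓗), H v⟫_ℂ).re - μ * ‖(v : 𝓗)‖ ^ 2 := by
    intro v hvf
    by_cases hv : (v : 𝓗) = 0
    · rw [hv]; simp
    · have h1 := csInf_le hSb (hnormal v hv hvf)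
      have : 0 < ‖(v : 𝓗)‖ := norm_pos_iff.2 hv
      rw [inv_pow, le_inv_mul_iff₀ (by positivity)] at h1
      linarith
  obtain ⟨r, -, hr, hrS⟩ := exists_seq_tendsto_sInf hSn hSb
  choose un hun1 hunf hunr using hrS
  obtain ⟨w, φ, hφ, hw⟩ := exists_weakly_convergent_subseq (u := fun n => (un n : 𝓗))
    (fun n => (hun1 n).le)
  have hlim : Tendsto (fun n => (⟪(un (φ n) : 𝓗), H (un (φ n))⟫_ℂ).re) atTop (𝓝 μ) := by
    simp_rw [hunr]
    exact hr.comp hφ.tendsto_atTop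
  have hwf : ∀ i, ⟪(f i : 𝓗), w⟫_ℂ = 0 := fun i => by
    have h1 := hw (f i)
    have h2 : ∀ n, ⟪(un (φ n) : 𝓗), (f i : 𝓗)⟫_ℂ = 0 := fun n =>
      inner_eq_zero_symm.1 (hunf _ i)
    simp_rw [h2] at h1
    exact inner_eq_zero_symm.1 (tendsto_nhds_unique h1 tendsto_const_nhds)
  -- The nonnegative form `⟨u, (H - μ)u⟩` is evaluated at `u_n + c v`. As `n → ∞` its value at `u_n`
  -- tends to `0`, leaving `2 Re(c ⟨w, (H - μ)v⟩)` and a term quadratic in `c`. Weak convergence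
  -- suffices, and `w` need not yet lie in the domain.
  have horth : ∀ v : H.domain, (∀ i, ⟪(f i : 𝓗), (v : 𝓗)⟫_ℂ = 0) →
      ⟪w, H v - (μ : ℂ) • (v : 𝓗)⟫_ℂ = 0 := by
    intro v hvf
    refine eq_zero_of_forall_re_mul_nonneg
      (q := (⟪(v : 𝓗), H v⟫_ℂ).re - μ * ‖(v : 𝓗)‖ ^ 2) fun c => ?_
    have h1 : ∀ n, 0 ≤ ((⟪(un (φ n) : 𝓗), H (un (φ n))⟫_ℂ).re - μ) +
        2 * (c * ⟪(un (φ n) : 𝓗), H v - (μ : ℂ) • (v : 𝓗)⟫_ℂ).re +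
        ‖c‖ ^ 2 * ((⟪(v : 𝓗), H v⟫_ℂ).re - μ * ‖(v : 𝓗)‖ ^ 2) := by
      intro n
      have h2 := hq (un (φ n) + c • v) (fun i => by
        rw [Submodule.coe_add, Submodule.coe_smul, inner_add_right, inner_smul_right,
          hunf, hvf]; simp)
      rw [re_inner_add_smul hsymm, Submodule.coe_add, Submodule.coe_smul, norm_sq_add_smul,
        hun1] at h2
      have h3 : (c * ⟪(un (φ n) : 𝓗), H v - (μ : ℂ) • (v : 𝓗)⟫_ℂ).re =
          (c * ⟪(un (φ n) : 𝓗), H v⟫_ℂ).re - μ * (c * ⟪(un (φ n) : 𝓗), (v : 𝓗)⟫_ℂ).re := by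
        rw [inner_sub_right, inner_smul_right, mul_sub, mul_left_comm, Complex.sub_re,
          Complex.re_ofReal_mul]
      rw [h3]
      linarith
    have h2 := ((hlim.sub_const μ).add (((Complex.continuous_re.tendsto _).comp
      ((hw (H v - (μ : ℂ) • (v : 𝓗))).const_mul c)).const_mul 2)).add_const
        (‖c‖ ^ 2 * ((⟪(v : 𝓗), H v⟫_ℂ).re - μ * ‖(v : 𝓗)‖ ^ 2))
    have h3 := ge_of_tendsto' h2 h1
    linarith
  -- The restriction on `v` is removed by subtracting its projection to the span of `f`, which `H`
  -- preserves and to which `w` is orthogonal. Self-adjointness then puts `w` into the domain.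
  have horth' : ∀ v : H.domain, ⟪w, H v - (μ : ℂ) • (v : 𝓗)⟫_ℂ = 0 := by
    intro v
    have h1 := horth _ (inner_sub_sum_eq_zero hf v)
    have h2 : H (v - ∑ j, ⟪(f j : 𝓗), (v : 𝓗)⟫_ℂ • f j) =
        H v - ∑ j, ⟪(f j : 𝓗), (v : 𝓗)⟫_ℂ • (e j : ℂ) • (f j : 𝓗) := by
      rw [LinearPMap.map_sub]
      congr 1
      change H.toFun _ = _
      rw [map_sum]
      refine Finset.sum_congr rfl fun j _ => ?_
      rw [map_smul]
      congr 1
      exact he j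
    have h3 : ⟪w, ∑ j, ⟪(f j : 𝓗), (v : 𝓗)⟫_ℂ • (e j : ℂ) • (f j : 𝓗)⟫_ℂ = 0 := by
      rw [inner_sum]
      refine Finset.sum_eq_zero fun j _ => ?_
      rw [inner_smul_right, inner_smul_right, inner_eq_zero_symm.1 (hwf j)]
      simp
    have h4 : ⟪w, ∑ j, ⟪(f j : 𝓗), (v : 𝓗)⟫_ℂ • (f j : 𝓗)⟫_ℂ = 0 := by
      rw [inner_sum]
      refine Finset.sum_eq_zero fun j _ => ?_
      rw [inner_smul_right, inner_eq_zero_symm.1 (hwf j)]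
      simp
    rw [h2, Submodule.coe_sub, Submodule.coe_sum] at h1
    simp only [Submodule.coe_smul] at h1
    rw [inner_sub_right, inner_sub_right, inner_smul_right, inner_sub_right, h3, h4] at h1
    rw [inner_sub_right, inner_smul_right]
    simpa using h1
  obtain ⟨hwD, hHw⟩ := hsa w ((μ : ℂ) • w) (fun v => by
    have h1 := horth' v
    rw [inner_sub_right, sub_eq_zero] at h1
    rw [← inner_conj_symm, h1, inner_smul_right, inner_smul_right, map_mul, inner_conj_symm,
      Complex.conj_ofReal])
  have hw0 := hcomplete ⟨w, hwD⟩ μ hμE hHw hwf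
  refine absurd (hcpt (fun n => un (φ n)) (fun n => hun1 _) (fun v => ?_) μ hlim) (not_le.2 hμE)
  have := hw v
  change w = 0 at hw0
  rwa [hw0, inner_zero_left] at this

/-- The variational lower bound in terms of the eigenvectors below `E`. -/
theorem sum_mul_inner_sq_le {E : ℝ}
    (hsymm : ∀ u v : H.domain, ⟪H u, (v : 𝓗)⟫_ℂ = ⟪(u : 𝓗), H v⟫_ℂ)
    (hf : Orthonormal ℂ (fun i => (f i : 𝓗))) (he : ∀ i, H (f i) = (e i : ℂ) • (f i : 𝓗))
    (hge : ∀ u : H.domain, (∀ i, ⟪(f i : 𝓗), (u : 𝓗)⟫_ℂ = 0) →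
      E * ‖(u : 𝓗)‖ ^ 2 ≤ (⟪(u : 𝓗), H u⟫_ℂ).re)
    (u : H.domain) :
    ∑ i, (e i - E) * ‖⟪(f i : 𝓗), (u : 𝓗)⟫_ℂ‖ ^ 2 ≤
      (⟪(u : 𝓗), H u⟫_ℂ).re - E * ‖(u : 𝓗)‖ ^ 2 := by
  set p : H.domain := ∑ j, ⟪(f j : 𝓗), (u : 𝓗)⟫_ℂ • f j with hp
  have h0 := inner_sub_sum_eq_zero hf u
  rw [← hp] at h0
  have hpc : (p : 𝓗) = ∑ j, ⟪(f j : 𝓗), (u : 𝓗)⟫_ℂ • (f j : 𝓗) := by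
    rw [hp, Submodule.coe_sum]; rfl
  have hHp : H p = ∑ j, (⟪(f j : 𝓗), (u : 𝓗)⟫_ℂ * (e j : ℂ)) • (f j : 𝓗) := by
    change H.toFun _ = _
    rw [hp, map_sum]
    refine Finset.sum_congr rfl fun j _ => ?_
    rw [map_smul, mul_smul]
    congr 1
    exact he j
  have h1 := hge _ h0
  -- Since `H` preserves the span of `f`, the form splits without cross terms along `u = (u - p) +
  -- p`. The first part is bounded by `hge` and the second is computed exactly.
  have hcross : ⟪((u - p : H.domain) : 𝓗), H p⟫_ℂ = 0 := by
    rw [hHp, inner_sum]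
    refine Finset.sum_eq_zero fun j _ => ?_
    rw [inner_smul_right, inner_eq_zero_symm.1 (h0 j), mul_zero]
  have hcross2 : ⟪((u - p : H.domain) : 𝓗), (p : 𝓗)⟫_ℂ = 0 := by
    rw [hpc, inner_sum]
    refine Finset.sum_eq_zero fun j _ => ?_
    rw [inner_smul_right, inner_eq_zero_symm.1 (h0 j), mul_zero]
  have h2 := re_inner_add_smul hsymm (u - p) p 1
  have h3 := norm_sq_add_smul ((u - p : H.domain) : 𝓗) (p : 𝓗) 1
  have h4 : u - p + (1 : ℂ) • p = u := by rw [one_smul, sub_add_cancel]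
  have h5 : ((u - p : H.domain) : 𝓗) + (1 : ℂ) • (p : 𝓗) = u := by
    rw [← Submodule.coe_smul, ← Submodule.coe_add, h4]
  rw [h4, hcross] at h2
  rw [h5, hcross2] at h3
  have h6 : (⟪(p : 𝓗), H p⟫_ℂ).re = ∑ i, e i * ‖⟪(f i : 𝓗), (u : 𝓗)⟫_ℂ‖ ^ 2 := by
    rw [hpc, hHp, hf.inner_sum, Complex.re_sum]
    refine Finset.sum_congr rfl fun j _ => ?_
    rw [← mul_assoc, Complex.conj_mul', ← Complex.ofReal_pow, ← Complex.ofReal_mul,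
      Complex.ofReal_re, mul_comm]
  have h7 : ‖(p : 𝓗)‖ ^ 2 = ∑ i, ‖⟪(f i : 𝓗), (u : 𝓗)⟫_ℂ‖ ^ 2 := by
    have : ((‖(p : 𝓗)‖ ^ 2 : ℝ) : ℂ) = ⟪(p : 𝓗), (p : 𝓗)⟫_ℂ := by
      rw [inner_self_eq_norm_sq_to_K]; simp
    have h8 := congrArg Complex.re this
    rw [Complex.ofReal_re] at h8
    rw [h8, hpc, hf.inner_sum, Complex.re_sum]
    refine Finset.sum_congr rfl fun j _ => ?_
    rw [Complex.conj_mul', ← Complex.ofReal_pow, Complex.ofReal_re]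
  simp_rw [sub_mul]
  rw [Finset.sum_sub_distrib, ← Finset.mul_sum, ← h6, ← h7]
  simp at h2 h3
  simp at h1
  rw [h2, h3]
  linarith

end Hilbert

/-! ### Orthonormal eigenvector families, multiplicities and Riesz sums -/

section Eigenfamily

variable {H : L2R3 →ₗ.[ℂ] L2R3}

/-- An orthonormal family of eigenvectors of `H` with eigenvalues below `E`. -/
structure IsEigenfamily (H : L2R3 →ₗ.[ℂ] L2R3) (E : ℝ) {ι : Type*} (f : ι → H.domain)
    (e : ι → ℝ) : Prop where
  orthonormal : Orthonormal ℂ (fun i => (f i : L2R3))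
  map_eq : ∀ i, H (f i) = (e i : ℂ) • (f i : L2R3)
  lt : ∀ i, e i < E

/-- A family of vectors meeting every eigenvector of `H` with eigenvalue below `E`. -/
def ExhaustsBelow (H : L2R3 →ₗ.[ℂ] L2R3) (E : ℝ) {ι : Type*} (f : ι → H.domain) : Prop :=
  ∀ (u : H.domain) (l : ℝ), l < E → H u = (l : ℂ) • (u : L2R3) →
    (∀ i, ⟪(f i : L2R3), (u : L2R3)⟫_ℂ = 0) → (u : L2R3) = 0

lemma inner_eq_zero_of_eigenvalue_ne
    (hsymm : ∀ u v : H.domain, ⟪H u, (v : L2R3)⟫_ℂ = ⟪(u : L2R3), H v⟫_ℂ)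
    {u v : H.domain} {l m : ℝ} (hu : H u = (l : ℂ) • (u : L2R3))
    (hv : H v = (m : ℂ) • (v : L2R3)) (hlm : l ≠ m) : ⟪(u : L2R3), (v : L2R3)⟫_ℂ = 0 := by
  have h := hsymm u v
  rw [hu, hv, inner_smul_left, inner_smul_right, Complex.conj_ofReal] at h
  have h2 : ((l : ℂ) - m) * ⟪(u : L2R3), (v : L2R3)⟫_ℂ = 0 := by rw [sub_mul, h, sub_self]
  refine (mul_eq_zero.1 h2).resolve_left ?_
  exact sub_ne_zero.2 (by exact_mod_cast hlm)

/-- If the size of eigenfamilies is bounded, there is one that exhausts the eigenvectors. -/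
theorem exists_eigenfamily_exhausting {E N : ℝ}
    (hN : ∀ (n : ℕ) (f : Fin n → H.domain) (e : Fin n → ℝ), IsEigenfamily H E f e → (n : ℝ) ≤ N) :
    ∃ (n : ℕ) (f : Fin n → H.domain) (e : Fin n → ℝ),
      IsEigenfamily H E f e ∧ ExhaustsBelow H E f := by
  set P : ℕ → Prop := fun n => ∃ (f : Fin n → H.domain) (e : Fin n → ℝ), IsEigenfamily H E f e
  have h0 : ∃ n, P n := ⟨0, Fin.elim0, Fin.elim0, ⟨fun i => i.elim0, fun i => i.elim0⟩,
    fun i => i.elim0, fun i => i.elim0⟩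
  have hb : BddAbove {n | P n} := by
    refine ⟨⌊N⌋₊, ?_⟩
    rintro n ⟨f, e, hfe⟩
    exact Nat.le_floor (hN n f e hfe)
  -- A family of maximal size exhausts: an eigenvector orthogonal to all its members could be
  -- normalized and adjoined.
  have hmem : P (sSup {n | P n}) := Nat.sSup_mem h0 hb
  obtain ⟨f, e, hfe⟩ := hmem
  refine ⟨_, f, e, hfe, ?_⟩
  intro u l hl hHu hfu
  by_contra hu0
  have hn : ‖(u : L2R3)‖ ≠ 0 := norm_ne_zero_iff.2 hu0
  set v : H.domain := ((‖(u : L2R3)‖⁻¹ : ℝ) : ℂ) • u with hv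
  have hv1 : ‖(v : L2R3)‖ = 1 := by
    rw [hv, Submodule.coe_smul, norm_smul, Complex.norm_real, norm_inv, norm_norm,
      inv_mul_cancel₀ hn]
  have hvf : ∀ i, ⟪(f i : L2R3), (v : L2R3)⟫_ℂ = 0 := fun i => by
    rw [hv, Submodule.coe_smul, inner_smul_right, hfu, mul_zero]
  have hHv : H v = (l : ℂ) • (v : L2R3) := by
    rw [hv, LinearPMap.map_smul, hHu, Submodule.coe_smul, smul_comm]
  have hP : P (sSup {n | P n} + 1) := by
    refine ⟨Fin.cons v f, Fin.cons l e, ⟨⟨?_, ?_⟩, ?_, ?_⟩⟩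
    · intro i
      refine Fin.cases ?_ (fun j => ?_) i
      · simpa using hv1
      · simpa using hfe.orthonormal.1 j
    · intro i j
      refine Fin.cases ?_ (fun i' => ?_) i <;> refine Fin.cases ?_ (fun j' => ?_) j
      · simp
      · intro _
        simpa using inner_eq_zero_symm.1 (hvf j')
      · intro _
        simpa using hvf i'
      · intro hij
        simpa using hfe.orthonormal.2 (fun h => hij (by rw [h]))
    · intro i
      refine Fin.cases ?_ (fun j => ?_) i
      · simpa using hHv
      · simpa using hfe.map_eq j
    · intro i
      refine Fin.cases ?_ (fun j => ?_) i
      · simpa using hl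
      · simpa using hfe.lt j
  have := le_csSup hb hP
  omega

variable {E : ℝ} {ι : Type} [Fintype ι] {f : ι → H.domain} {e : ι → ℝ}

/-- Only those `f i` with eigenvalue `l` can have a component along an eigenvector for `l`. Removing
its projection leaves an eigenvector for `l` orthogonal to the whole family, which vanishes by
exhaustion. -/
lemma eigenspaceOf_eq_span
    (hsymm : ∀ u v : H.domain, ⟪H u, (v : L2R3)⟫_ℂ = ⟪(u : L2R3), H v⟫_ℂ)
    (hfe : IsEigenfamily H E f e) (hex : ExhaustsBelow H E f) {l : ℝ} (hl : l < E) :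
    eigenspaceOf H l =
      Submodule.span ℂ (range fun i : {i // e i = l} => (f i : L2R3)) := by
  apply le_antisymm
  · rintro u ⟨hu, hHu⟩
    have hfl : ∀ i, e i ≠ l → ⟪(f i : L2R3), u⟫_ℂ = 0 := fun i hi =>
      inner_eq_zero_of_eigenvalue_ne hsymm (hfe.map_eq i) (v := ⟨u, hu⟩) hHu hi
    set p : H.domain := ∑ j, ⟪(f j : L2R3), u⟫_ℂ • f j with hp
    have hpl : H p = (l : ℂ) • (p : L2R3) := by
      change H.toFun _ = _
      rw [hp, map_sum, Submodule.coe_sum, Finset.smul_sum]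
      refine Finset.sum_congr rfl fun j _ => ?_
      rw [map_smul, Submodule.coe_smul, smul_comm]
      by_cases hj : e j = l
      · congr 1
        rw [← hj]; exact hfe.map_eq j
      · rw [hfl j hj, zero_smul, zero_smul]
    have h0 := hex (⟨u, hu⟩ - p) l hl
      (by rw [LinearPMap.map_sub, hHu, hpl, Submodule.coe_sub, smul_sub])
      (inner_sub_sum_eq_zero hfe.orthonormal ⟨u, hu⟩)
    rw [Submodule.coe_sub, sub_eq_zero] at h0
    change u = _ at h0
    rw [h0, hp, Submodule.coe_sum]
    refine Submodule.sum_mem _ fun j _ => ?_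
    rw [Submodule.coe_smul]
    by_cases hj : e j = l
    · exact Submodule.smul_mem _ _ (Submodule.subset_span ⟨⟨j, hj⟩, rfl⟩)
    · rw [hfl j hj, zero_smul]; exact Submodule.zero_mem _
  · rw [Submodule.span_le]
    rintro _ ⟨⟨i, rfl⟩, rfl⟩
    exact ⟨(f i).2, hfe.map_eq i⟩

open Classical in
lemma multiplicityOf_eq_card
    (hsymm : ∀ u v : H.domain, ⟪H u, (v : L2R3)⟫_ℂ = ⟪(u : L2R3), H v⟫_ℂ)
    (hfe : IsEigenfamily H E f e) (hex : ExhaustsBelow H E f) {l : ℝ} (hl : l < E) :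
    multiplicityOf H l = ((∑ i, if e i = l then 1 else 0 : ℕ) : ℕ∞) := by
  rw [multiplicityOf, eigenspaceOf_eq_span hsymm hfe hex hl]
  have hli : LinearIndependent ℂ (fun i : {i // e i = l} => (f i : L2R3)) :=
    hfe.orthonormal.linearIndependent.comp (Subtype.val) Subtype.val_injective
  rw [rank_span hli, Cardinal.mk_range_eq _ hli.injective, Cardinal.mk_fintype, map_natCast,
    Fintype.card_subtype, Finset.card_filter]

lemma tsum_Iio_ite {M : Type*} [AddCommMonoid M] [TopologicalSpace M] [T2Space M] {E' x : ℝ}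
    (hx : x < E') (g : ℝ → M) [DecidableEq ℝ] :
    ∑' l : Iio E', (if x = l then g l else 0) = g x := by
  rw [tsum_eq_single (⟨x, hx⟩ : Iio E')]
  · simp
  · rintro ⟨l, hl⟩ hne
    rw [if_neg]
    rintro rfl
    exact hne rfl

open Classical in
/-- The eigenvalue count in terms of an exhausting eigenfamily. -/
lemma eigenvalueCount_eq
    (hsymm : ∀ u v : H.domain, ⟪H u, (v : L2R3)⟫_ℂ = ⟪(u : L2R3), H v⟫_ℂ)
    (hfe : IsEigenfamily H E f e) (hex : ExhaustsBelow H E f) {E' : ℝ} (hE : E' ≤ E) :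
    eigenvalueCount H E' = ((∑ i, if e i < E' then 1 else 0 : ℕ) : ℝ≥0∞) := by
  have h1 : ∀ l : Iio E', ((multiplicityOf H l : ℕ∞) : ℝ≥0∞) =
      ∑ i, if e i = l then (1 : ℝ≥0∞) else 0 := fun l => by
    rw [multiplicityOf_eq_card hsymm hfe hex (lt_of_lt_of_le l.2 hE),
      ENat.toENNReal_coe]
    push_cast
    exact Finset.sum_congr rfl fun i _ => by split_ifs <;> rfl
  rw [eigenvalueCount, tsum_congr h1, Summable.tsum_finsetSum fun i _ => ENNReal.summable]
  push_cast
  refine Finset.sum_congr rfl fun i _ => ?_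
  split_ifs with hi
  · exact tsum_Iio_ite hi (fun _ => (1 : ℝ≥0∞))
  · rw [ENNReal.tsum_eq_zero]
    rintro ⟨l, hl⟩
    rw [if_neg]
    rintro rfl
    exact hi hl

open Classical in
/-- The Riesz sum in terms of an exhausting eigenfamily. -/
lemma rieszSum_eq
    (hsymm : ∀ u v : H.domain, ⟪H u, (v : L2R3)⟫_ℂ = ⟪(u : L2R3), H v⟫_ℂ)
    (hfe : IsEigenfamily H E f e) (hex : ExhaustsBelow H E f) {E' : ℝ} (hE : E' ≤ E) :
    rieszSum H E' = ∑ i, min (e i - E') 0 := by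
  have h1 : ∀ l : Iio E', ((multiplicityOf H l).toNat : ℝ) * ((l : ℝ) - E') =
      ∑ i, if e i = l then ((l : ℝ) - E') else 0 := fun l => by
    rw [multiplicityOf_eq_card hsymm hfe hex (lt_of_lt_of_le l.2 hE), ENat.toNat_natCast]
    push_cast
    rw [Finset.sum_mul]
    refine Finset.sum_congr rfl fun i _ => ?_
    split_ifs <;> simp
  rw [rieszSum, tsum_congr h1, Summable.tsum_finsetSum]
  · refine Finset.sum_congr rfl fun i _ => ?_
    by_cases hi : e i < E'
    · rw [tsum_Iio_ite hi (fun l => l - E'), min_eq_left (by linarith)]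
    · rw [min_eq_right (by linarith)]
      convert tsum_zero with l
      rw [if_neg]
      intro h
      exact hi (h ▸ l.2)
  · intro i _
    by_cases hi : e i < E'
    · refine summable_of_ne_finset_zero (s := {⟨e i, hi⟩}) fun l hl => ?_
      rw [if_neg]
      intro h
      exact hl (Finset.mem_singleton.2 (Subtype.ext h.symm))
    · refine summable_of_ne_finset_zero (s := ∅) fun l _ => ?_
      rw [if_neg]
      intro h
      exact hi (h ▸ l.2)

end Eigenfamily

/-! ### Hilbert–Schmidt perturbations -/

section HilbertSchmidt

/-- A Hilbert-Schmidt operator is represented by a square summable family of vectors. -/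
lemma exists_frame_of_hsNorm_le {A : L2R3 →L[ℂ] L2R3} {k : ℝ} (hk : 0 ≤ k)
    (hA : hsNorm A ≤ ENNReal.ofReal k) :
    ∃ (ι : Type) (g : ι → L2R3), Summable (fun i => ‖g i‖ ^ 2) ∧ ∑' i, ‖g i‖ ^ 2 ≤ k ^ 2 ∧
      ∀ u, HasSum (fun i => ‖⟪g i, u⟫_ℂ‖ ^ 2) (‖A u‖ ^ 2) := by
  obtain ⟨w, b, -⟩ := exists_hilbertBasis ℂ L2R3
  have h1 : ∑' i, ‖ContinuousLinearMap.adjoint A (b i)‖ₑ ^ 2 ≤ ENNReal.ofReal (k ^ 2) := by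
    rw [hsNorm_eq b, tsum_enorm_sq_eq_adjoint b b] at hA
    have h2 := ENNReal.rpow_le_rpow hA (z := 2) (by norm_num)
    rw [← ENNReal.rpow_mul] at h2
    norm_num at h2
    rwa [ENNReal.ofReal_pow hk]
  have h2 : ∀ i, ‖ContinuousLinearMap.adjoint A (b i)‖ₑ ^ 2 =
      ENNReal.ofReal (‖ContinuousLinearMap.adjoint A (b i)‖ ^ 2) := fun i => by
    rw [ENNReal.ofReal_pow (norm_nonneg _), ofReal_norm]
  simp_rw [h2] at h1
  have hs : Summable fun i => ‖ContinuousLinearMap.adjoint A (b i)‖ ^ 2 := by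
    have h3 := ENNReal.summable_toReal (ne_top_of_le_ne_top ENNReal.ofReal_ne_top h1)
    refine h3.congr fun i => ?_
    rw [ENNReal.toReal_ofReal (sq_nonneg _)]
  -- The vectors are `A* b_i`; Parseval for `A u` in the basis `b` gives the representation.
  refine ⟨w, fun i => ContinuousLinearMap.adjoint A (b i), hs, ?_, fun u => ?_⟩
  · rw [← ENNReal.ofReal_tsum_of_nonneg (fun i => sq_nonneg _) hs] at h1
    exact (ENNReal.ofReal_le_ofReal_iff (sq_nonneg _)).1 h1
  · have h3 := lp.hasSum_norm (p := 2) (by norm_num) (b.repr (A u))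
    simp only [ENNReal.toReal_ofNat, Real.rpow_ofNat, b.repr_apply_apply,
      LinearIsometryEquiv.norm_map] at h3
    simpa only [ContinuousLinearMap.adjoint_inner_left] using h3

variable {A : L2R3 →L[ℂ] L2R3} {k : ℝ}

lemma norm_apply_le_of_hsNorm_le (hk : 0 ≤ k) (hA : hsNorm A ≤ ENNReal.ofReal k) (u : L2R3) :
    ‖A u‖ ≤ k * ‖u‖ := by
  obtain ⟨ι, g, hg, hgk, hAu⟩ := exists_frame_of_hsNorm_le hk hA
  refine le_of_sq_le_sq ?_ (by positivity)
  rw [← (hAu u).tsum_eq, mul_pow]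
  calc _ ≤ ∑' i, ‖g i‖ ^ 2 * ‖u‖ ^ 2 :=
        (hAu u).summable.tsum_le_tsum (fun i => by
          rw [← mul_pow]; gcongr; exact norm_inner_le_norm _ _) (hg.mul_right _)
    _ = (∑' i, ‖g i‖ ^ 2) * ‖u‖ ^ 2 := tsum_mul_right
    _ ≤ _ := by gcongr

/-- After exchanging the sums, Bessel's inequality applies to each `g i`. -/
lemma sum_norm_apply_sq_le_of_hsNorm_le (hk : 0 ≤ k) (hA : hsNorm A ≤ ENNReal.ofReal k)
    {ι : Type*} [Fintype ι] {f : ι → L2R3} (hf : Orthonormal ℂ f) :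
    ∑ j, ‖A (f j)‖ ^ 2 ≤ k ^ 2 := by
  obtain ⟨κ, g, hg, hgk, hAu⟩ := exists_frame_of_hsNorm_le hk hA
  refine le_trans ?_ hgk
  have h1 := hasSum_sum (s := Finset.univ) (fun j _ => hAu (f j))
  rw [← h1.tsum_eq]
  refine h1.summable.tsum_le_tsum (fun i => ?_) hg
  simp_rw [← norm_inner_symm (f _)]
  exact hf.sum_inner_products_le (g i)

/-- Compactness of Hilbert–Schmidt operators: each term of the series for `‖A u_n‖²` tends to zero
and is dominated by the summable `‖g i‖²`. -/
lemma tendsto_norm_apply_of_weakly_null (hk : 0 ≤ k) (hA : hsNorm A ≤ ENNReal.ofReal k)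
    {u : ℕ → L2R3} (hu : ∀ n, ‖u n‖ = 1)
    (hw : ∀ v, Tendsto (fun n => ⟪u n, v⟫_ℂ) atTop (𝓝 0)) :
    Tendsto (fun n => ‖A (u n)‖ ^ 2) atTop (𝓝 0) := by
  obtain ⟨ι, g, hg, hgk, hAu⟩ := exists_frame_of_hsNorm_le hk hA
  have h := tendsto_tsum_of_dominated_convergence (f := fun n i => ‖⟪g i, u n⟫_ℂ‖ ^ 2)
    (g := fun _ => (0 : ℝ)) hg (fun i => ?_) (Eventually.of_forall (f := atTop) fun n i => ?_)
  · simpa only [(hAu _).tsum_eq, tsum_zero] using h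
  · have h1 := ((hw (g i)).norm).pow 2
    simp only [norm_zero, ne_eq, OfNat.ofNat_ne_zero, not_false_eq_true, zero_pow] at h1
    exact h1.congr fun n => by rw [norm_inner_symm]
  · rw [Real.norm_of_nonneg (sq_nonneg _)]
    gcongr
    simpa [hu n] using norm_inner_le_norm (𝕜 := ℂ) (g i) (u n)

end HilbertSchmidt

/-! ### Low frequency mass in a set of finite volume -/

section LowFrequency

/-- The plane wave `ξ ↦ exp(-2πi ξ·x)` cut off to the ball of radius `R`. -/
def planeWaveFun (R : ℝ) (x ξ : R3) : ℂ :=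
  (Metric.closedBall (0 : R3) R).indicator (fun ξ => (𝐞 (-⟪ξ, x⟫_ℝ) : ℂ)) ξ

lemma measurable_planeWaveFun (R : ℝ) (x : R3) : Measurable (planeWaveFun R x) := by
  refine Measurable.indicator (Continuous.measurable ?_) Metric.isClosed_closedBall.measurableSet
  refine continuous_subtype_val.comp (Real.continuous_fourierChar.comp ?_)
  fun_prop

lemma memLp_planeWaveFun (R : ℝ) (x : R3) : MemLp (planeWaveFun R x) 2 := by
  have h1 : MemLp ((Metric.closedBall (0 : R3) R).indicator fun _ => (1 : ℂ)) 2 :=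
    memLp_indicator_const 2 Metric.isClosed_closedBall.measurableSet 1
      (Or.inr measure_closedBall_lt_top.ne)
  refine h1.congr_norm (measurable_planeWaveFun R x).aestronglyMeasurable
    (Eventually.of_forall fun ξ => ?_)
  rw [planeWaveFun, norm_indicator_eq_indicator_norm, norm_indicator_eq_indicator_norm]
  simp only [norm_one]
  congr 1
  ext η
  exact (Circle.norm_coe _).symm

/-- The cut off plane wave as a vector of `L²`. -/
def planeWave (R : ℝ) (x : R3) : L2R3 := (memLp_planeWaveFun R x).toLp _

lemma norm_planeWave_sq (R : ℝ) (x : R3) :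
    ‖planeWave R x‖ ^ 2 = (volume (Metric.closedBall (0 : R3) R)).toReal := by
  rw [norm_sq_Lp]
  have h1 : ∀ᵐ ξ : R3, ‖planeWave R x ξ‖ ^ 2 =
      (Metric.closedBall (0 : R3) R).indicator (fun _ => (1 : ℝ)) ξ := by
    filter_upwards [(memLp_planeWaveFun R x).coeFn_toLp] with ξ hξ
    rw [planeWave, hξ, planeWaveFun, norm_indicator_eq_indicator_norm]
    by_cases h : ξ ∈ Metric.closedBall (0 : R3) R
    · rw [indicator_of_mem h, indicator_of_mem h, Circle.norm_coe, one_pow]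
    · simp [h]
  rw [integral_congr_ae h1, integral_indicator_const _ Metric.isClosed_closedBall.measurableSet]
  simp [Measure.real]

/-- The value at `x` of the part of `u` with frequencies at most `R`. -/
def lowVal (R : ℝ) (u : L2R3) (x : R3) : ℂ := ⟪planeWave R x, FL2 u⟫_ℂ

lemma integrable_indicator_FL2 (R : ℝ) (u : L2R3) :
    Integrable ((Metric.closedBall (0 : R3) R).indicator (FL2 u)) := by
  rw [integrable_indicator_iff Metric.isClosed_closedBall.measurableSet]
  have : IsFiniteMeasure ((volume : Measure R3).restrict (Metric.closedBall (0 : R3) R)) :=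
    ⟨by rw [Measure.restrict_apply_univ]; exact measure_closedBall_lt_top⟩
  exact ((Lp.memLp (FL2 u)).restrict _).integrable (by norm_num)

lemma memLp_indicator_FL2 (R : ℝ) (u : L2R3) :
    MemLp ((Metric.closedBall (0 : R3) R).indicator (FL2 u)) 2 :=
  (Lp.memLp (FL2 u)).indicator Metric.isClosed_closedBall.measurableSet

lemma lowVal_eq_fourierInv (R : ℝ) (u : L2R3) (x : R3) :
    lowVal R u x = 𝓕⁻ ((Metric.closedBall (0 : R3) R).indicator (FL2 u)) x := by
  rw [lowVal, L2.inner_def, Real.fourierInv_eq]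
  apply integral_congr_ae
  filter_upwards [(memLp_planeWaveFun R x).coeFn_toLp] with ξ hξ
  rw [planeWave, hξ, planeWaveFun, RCLike.inner_apply]
  by_cases h : ξ ∈ Metric.closedBall (0 : R3) R
  · rw [indicator_of_mem h, indicator_of_mem h, Circle.smul_def, smul_eq_mul,
      AddChar.map_neg_eq_inv, Circle.coe_inv_eq_conj, Complex.conj_conj, mul_comm]
  · rw [indicator_of_notMem h, indicator_of_notMem h]
    simp

lemma continuous_lowVal (R : ℝ) (u : L2R3) : Continuous (lowVal R u) := by
  have : lowVal R u = 𝓕⁻ ((Metric.closedBall (0 : R3) R).indicator (FL2 u)) :=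
    funext (lowVal_eq_fourierInv R u)
  rw [this]
  exact continuous_fourierInv_of_integrable (integrable_indicator_FL2 R u)

lemma norm_lowVal_sq_le (R : ℝ) (u : L2R3) (x : R3) :
    ‖lowVal R u x‖ ^ 2 ≤ (volume (Metric.closedBall (0 : R3) R)).toReal * ‖u‖ ^ 2 := by
  rw [← norm_planeWave_sq R x, ← mul_pow, ← FL2.norm_map u]
  gcongr
  exact norm_inner_le_norm _ _

/-- The mass of `u` in `Ω` is controlled by its low frequencies and its kinetic energy. -/
lemma setIntegral_norm_sq_le {h R : ℝ} (hh : 0 < h) (hR : 0 < R) (Ω : Set R3)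
    (u : (relKinetic h).domain) :
    ∫ x in Ω, ‖(u : L2R3) x‖ ^ 2 ≤ 2 * (∫ x in Ω, ‖lowVal R u x‖ ^ 2) +
      2 / (2 * Real.pi * h * R) *
        ((∫ ξ, relSymbol h ξ * ‖FL2 (u : L2R3) ξ‖ ^ 2) + ‖(u : L2R3)‖ ^ 2) := by
  -- `v` is the part of `u` with frequencies in the ball. Off the ball `relSymbol + 1 ≥ 2πħR`, so
  -- the remainder is controlled by the kinetic energy as in Chebyshev's inequality.
  set v : L2R3 := FL2.symm ((memLp_indicator_FL2 R u).toLp _) with hv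
  have hvx : (v : R3 → ℂ) =ᵐ[volume] lowVal R u := by
    have h1 := coeFn_FL2_symm_toLp (integrable_indicator_FL2 R u) (memLp_indicator_FL2 R u)
    filter_upwards [h1] with x hx
    rw [hv, hx, lowVal_eq_fourierInv]
  have hvξ : (FL2 v : R3 → ℂ) =ᵐ[volume] (Metric.closedBall (0 : R3) R).indicator (FL2 u) := by
    rw [hv, FL2.apply_symm_apply]; exact MemLp.coeFn_toLp _
  have hdiff : ‖(u : L2R3) - v‖ ^ 2 ≤ 1 / (2 * Real.pi * h * R) *
      ((∫ ξ, relSymbol h ξ * ‖FL2 (u : L2R3) ξ‖ ^ 2) + ‖(u : L2R3)‖ ^ 2) := by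
    rw [← FL2.norm_map (u - v), norm_sq_Lp, ← FL2.norm_map (u : L2R3), norm_sq_Lp (FL2 u),
      ← integral_add (integrable_relSymbol_mul u) (integrable_norm_sq_Lp _), ← integral_const_mul]
    refine integral_mono_ae (integrable_norm_sq_Lp _)
      (((integrable_relSymbol_mul u).add (integrable_norm_sq_Lp _)).const_mul _) ?_
    have h2 : (FL2 ((u : L2R3) - v) : R3 → ℂ) =ᵐ[volume] fun ξ => FL2 (u : L2R3) ξ - FL2 v ξ := by
      rw [map_sub]; exact Lp.coeFn_sub _ _
    filter_upwards [h2, hvξ] with ξ h3 h4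
    rw [h3, h4]
    have h5 := relSymbol_nonneg h ξ
    by_cases hξ : ξ ∈ Metric.closedBall (0 : R3) R
    · rw [indicator_of_mem hξ, sub_self]
      simp only [norm_zero, ne_eq, OfNat.ofNat_ne_zero, not_false_eq_true, zero_pow]
      positivity
    · rw [indicator_of_notMem hξ, sub_zero, ← add_one_mul, ← mul_assoc]
      refine le_mul_of_one_le_left (sq_nonneg _) ?_
      rw [one_div, ← div_eq_inv_mul, one_le_div (by positivity)]
      have h6 : R < ‖ξ‖ := by simpa using hξ
      have h7 := le_relSymbol (h := h) ξ
      have h8 : 2 * Real.pi * h * R ≤ 2 * Real.pi * h * ‖ξ‖ := by gcongr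
      linarith
  have hd : ∫ x in Ω, ‖((u : L2R3) - v : L2R3) x‖ ^ 2 ≤ ‖(u : L2R3) - v‖ ^ 2 := by
    rw [norm_sq_Lp]
    exact setIntegral_le_integral (integrable_norm_sq_Lp _)
      (Eventually.of_forall fun x => sq_nonneg _)
  have hv2 : ∫ x in Ω, ‖v x‖ ^ 2 = ∫ x in Ω, ‖lowVal R u x‖ ^ 2 := by
    apply integral_congr_ae
    filter_upwards [ae_restrict_of_ae hvx] with x hx
    rw [hx]
  have hmain : ∫ x in Ω, ‖(u : L2R3) x‖ ^ 2 ≤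
      ∫ x in Ω, (2 * ‖v x‖ ^ 2 + 2 * ‖((u : L2R3) - v : L2R3) x‖ ^ 2) := by
    refine integral_mono_ae (integrable_norm_sq_Lp _).integrableOn
      (((integrable_norm_sq_Lp _).integrableOn.const_mul 2).add
        ((integrable_norm_sq_Lp _).integrableOn.const_mul 2)) ?_
    filter_upwards [ae_restrict_of_ae (Lp.coeFn_sub (u : L2R3) v)] with x hx
    simp only [hx, Pi.sub_apply]
    have h1 : ‖(u : L2R3) x‖ ≤ ‖v x‖ + ‖(u : L2R3) x - v x‖ := by
      calc _ = ‖v x + ((u : L2R3) x - v x)‖ := by congr 1; ring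
        _ ≤ _ := norm_add_le _ _
    have h2 : ‖(u : L2R3) x‖ ^ 2 ≤ (‖v x‖ + ‖(u : L2R3) x - v x‖) ^ 2 := by gcongr
    nlinarith [sq_nonneg (‖v x‖ - ‖(u : L2R3) x - v x‖)]
  rw [integral_add ((integrable_norm_sq_Lp _).integrableOn.const_mul 2)
    ((integrable_norm_sq_Lp _).integrableOn.const_mul 2), integral_const_mul, integral_const_mul,
    hv2] at hmain
  have : 2 / (2 * Real.pi * h * R) = 2 * (1 / (2 * Real.pi * h * R)) := by ring
  rw [this, mul_assoc]
  linarith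

lemma integrableOn_lowVal_sq {R : ℝ} {Ω : Set R3} (hΩ : volume Ω ≠ ∞) (u : L2R3) :
    IntegrableOn (fun x => ‖lowVal R u x‖ ^ 2) Ω := by
  refine Measure.integrableOn_of_bounded hΩ
    ((continuous_lowVal R u).norm.pow 2).aestronglyMeasurable
    (M := (volume (Metric.closedBall (0 : R3) R)).toReal * ‖u‖ ^ 2)
    (Eventually.of_forall fun x => ?_)
  rw [Real.norm_of_nonneg (sq_nonneg _)]
  exact norm_lowVal_sq_le R u x

/-- Evaluation at `x` of the low frequency part is pairing with a plane wave of squared norm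
`|B_R|`. Bessel's inequality holds at each `x`, and integration over `Ω` gives the phase space
volume `|Ω| |B_R|`. -/
lemma sum_setIntegral_lowVal_sq_le {R : ℝ} {Ω : Set R3} (hΩ : volume Ω ≠ ∞) {ι : Type*}
    [Fintype ι] {f : ι → L2R3} (hf : Orthonormal ℂ f) :
    ∑ j, ∫ x in Ω, ‖lowVal R (f j) x‖ ^ 2 ≤
      (volume Ω).toReal * (volume (Metric.closedBall (0 : R3) R)).toReal := by
  rw [← integral_finsetSum _ fun j _ => integrableOn_lowVal_sq hΩ (f j)]
  calc _ ≤ ∫ x in Ω, (volume (Metric.closedBall (0 : R3) R)).toReal := by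
        refine integral_mono (integrable_finsetSum _ fun j _ => integrableOn_lowVal_sq hΩ (f j))
          (integrableOn_const hΩ) fun x => ?_
        simp only [lowVal, ← norm_planeWave_sq R x]
        have h1 := (hf.comp_linearIsometryEquiv FL2).sum_inner_products_le (planeWave R x)
          (s := Finset.univ)
        refine le_trans (le_of_eq ?_) h1
        exact Finset.sum_congr rfl fun j _ => by rw [norm_inner_symm]; rfl
    _ = _ := by simp [Measure.real]

/-- Pointwise evaluation is a weakly continuous functional with a bound independent of `x`, so
dominated convergence applies on the finite volume set. This is the local compactness that excludes
essential spectrum below `-c`. -/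
lemma tendsto_setIntegral_lowVal_sq {R : ℝ} {Ω : Set R3} (hΩ : volume Ω ≠ ∞) {u : ℕ → L2R3}
    (hu : ∀ n, ‖u n‖ = 1) (hw : ∀ v, Tendsto (fun n => ⟪u n, v⟫_ℂ) atTop (𝓝 0)) :
    Tendsto (fun n => ∫ x in Ω, ‖lowVal R (u n) x‖ ^ 2) atTop (𝓝 0) := by
  have h := tendsto_integral_of_dominated_convergence (μ := volume.restrict Ω)
    (F := fun n x => ‖lowVal R (u n) x‖ ^ 2) (f := fun _ => (0 : ℝ))
    (fun _ => (volume (Metric.closedBall (0 : R3) R)).toReal)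
    (fun n => ((continuous_lowVal R (u n)).norm.pow 2).aestronglyMeasurable)
    (integrableOn_const hΩ) (fun n => Eventually.of_forall fun x => ?_)
    (Eventually.of_forall fun x => ?_)
  · simpa using h
  · rw [Real.norm_of_nonneg (sq_nonneg _)]
    simpa [hu n] using norm_lowVal_sq_le R (u n) x
  · have h1 := ((hw (FL2.symm (planeWave R x))).norm).pow 2
    simp only [norm_zero, ne_eq, OfNat.ofNat_ne_zero, not_false_eq_true, zero_pow] at h1
    refine h1.congr fun n => ?_
    rw [lowVal, norm_inner_symm, ← FL2.inner_map_map, FL2.apply_symm_apply]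

end LowFrequency

/-! ### Discreteness of the spectrum below `-c` and the a priori eigenvalue bound -/

/-- The hypotheses on a potential `V` and a perturbation `A` at a fixed value of `ħ`, with the
constants on which the estimates depend. -/
structure IsAdmissible (h κ k c ω : ℝ) (V : R3 → ℝ) (A : L2R3 →L[ℂ] L2R3) : Prop where
  h_pos : 0 < h
  κ_pos : 0 < κ
  k_nonneg : 0 ≤ k
  c_pos : 0 < c
  ω_nonneg : 0 ≤ ω
  continuous : Continuous V
  abs_V_le : ∀ x, |V x| ≤ κ
  lipschitz : ∀ x y, |V x - V y| ≤ κ * ‖x - y‖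
  volume_le : volume {x | V x < -(c / 2)} ≤ ENNReal.ofReal ω
  selfAdjoint : IsSelfAdjoint A
  hsNorm_le : hsNorm A ≤ ENNReal.ofReal k

instance : TopologicalSpace.SeparableSpace L2R3 := by
  have : Fact ((2 : ℝ≥0∞) ≠ ∞) := ⟨by norm_num⟩
  infer_instance

lemma abs_re_inner_apply_le (A : L2R3 →L[ℂ] L2R3) (u : L2R3) : |(⟪u, A u⟫_ℂ).re| ≤ ‖u‖ * ‖A u‖ :=
  (Complex.abs_re_le_norm _).trans (norm_inner_le_norm _ _)

lemma integral_kinetic_nonneg (h : ℝ) (u : L2R3) : 0 ≤ ∫ ξ, relSymbol h ξ * ‖FL2 u ξ‖ ^ 2 :=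
  integral_nonneg fun ξ => mul_nonneg (relSymbol_nonneg h ξ) (sq_nonneg _)

namespace IsAdmissible

variable {h κ k c ω : ℝ} {V : R3 → ℝ} {A : L2R3 →L[ℂ] L2R3} (hyp : IsAdmissible h κ k c ω V A)
include hyp

lemma inner_A_symm (u v : L2R3) : ⟪A u, v⟫_ℂ = ⟪u, A v⟫_ℂ := by
  have h1 := hyp.selfAdjoint.adjoint_eq
  nth_rewrite 1 [← h1]
  exact ContinuousLinearMap.adjoint_inner_left _ _ _

lemma norm_A_le (u : L2R3) : ‖A u‖ ≤ k * ‖u‖ :=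
  norm_apply_le_of_hsNorm_le hyp.k_nonneg hyp.hsNorm_le u

lemma volume_ne_top : volume {x | V x < -(c / 2)} ≠ ∞ :=
  ne_top_of_le_ne_top ENNReal.ofReal_ne_top hyp.volume_le

lemma potential_add_symm (u v : L2R3) :
    ⟪(potentialOp hyp.continuous hyp.abs_V_le + A) u, v⟫_ℂ =
      ⟪u, (potentialOp hyp.continuous hyp.abs_V_le + A) v⟫_ℂ := by
  rw [add_apply, add_apply, inner_add_left, inner_add_right, potentialOp_symm, hyp.inner_A_symm]

lemma symm (u v : (relHamiltonian h V A).domain) :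
    ⟪relHamiltonian h V A u, (v : L2R3)⟫_ℂ = ⟪(u : L2R3), relHamiltonian h V A v⟫_ℂ := by
  rw [relHamiltonian_apply hyp.continuous hyp.abs_V_le, relHamiltonian_apply hyp.continuous
    hyp.abs_V_le, inner_add_left, inner_add_right, hyp.potential_add_symm]
  congr 1
  exact relKinetic_symm (⟨u, u.2.1.1⟩ : (relKinetic h).domain) ⟨v, v.2.1.1⟩

/-- Self-adjointness of the Hamiltonian. -/
lemma of_forall_inner (u w : L2R3)
    (H : ∀ v : (relHamiltonian h V A).domain, ⟪relHamiltonian h V A v, u⟫_ℂ = ⟪(v : L2R3), w⟫_ℂ) :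
    ∃ hu : u ∈ (relHamiltonian h V A).domain, relHamiltonian h V A ⟨u, hu⟩ = w := by
  obtain ⟨hu, hTu⟩ := relKinetic_of_forall_inner (h := h) (u := u)
    (w := w - (potentialOp hyp.continuous hyp.abs_V_le + A) u) (fun v => by
      have h1 := H ⟨v, (mem_relHamiltonian hyp.continuous hyp.abs_V_le).2 v.2⟩
      rw [relHamiltonian_apply hyp.continuous hyp.abs_V_le, inner_add_left,
        hyp.potential_add_symm] at h1
      rw [inner_sub_right, ← h1]
      exact (add_sub_cancel_right _ _).symm)
  refine ⟨(mem_relHamiltonian hyp.continuous hyp.abs_V_le).2 hu, ?_⟩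
  rw [relHamiltonian_apply hyp.continuous hyp.abs_V_le]
  change relKinetic h ⟨u, hu⟩ + _ = w
  rw [hTu, sub_add_cancel]

/-- The energy form of the Hamiltonian. -/
lemma re_inner (u : (relHamiltonian h V A).domain) :
    (⟪(u : L2R3), relHamiltonian h V A u⟫_ℂ).re =
      (∫ ξ, relSymbol h ξ * ‖FL2 (u : L2R3) ξ‖ ^ 2) + (∫ x, V x * ‖(u : L2R3) x‖ ^ 2) +
        (⟪(u : L2R3), A u⟫_ℂ).re := by
  rw [relHamiltonian_apply hyp.continuous hyp.abs_V_le, inner_add_right, add_apply, inner_add_right,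
    inner_potentialOp, ← add_assoc, Complex.add_re, Complex.add_re, Complex.ofReal_re]
  congr 2
  exact congrArg Complex.re (inner_relKinetic (⟨u, u.2.1.1⟩ : (relKinetic h).domain))

lemma neg_le_integral_potential (u : L2R3) : -(κ * ‖u‖ ^ 2) ≤ ∫ x, V x * ‖u x‖ ^ 2 := by
  rw [norm_sq_Lp, ← integral_const_mul, ← integral_neg]
  refine integral_mono ((integrable_norm_sq_Lp u).const_mul κ).neg
    (integrable_potential_mul hyp.continuous hyp.abs_V_le u) fun x => ?_
  simp only
  have := (abs_le.1 (hyp.abs_V_le x)).1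
  nlinarith [sq_nonneg ‖u x‖]

lemma bounded_below (u : (relHamiltonian h V A).domain) :
    -(κ + k) * ‖(u : L2R3)‖ ^ 2 ≤ (⟪(u : L2R3), relHamiltonian h V A u⟫_ℂ).re := by
  rw [hyp.re_inner]
  have h1 := integral_kinetic_nonneg h (u : L2R3)
  have h2 := hyp.neg_le_integral_potential (u : L2R3)
  have h3 := (abs_le.1 (abs_re_inner_apply_le A (u : L2R3))).1
  have h4 : ‖(u : L2R3)‖ * ‖A (u : L2R3)‖ ≤ ‖(u : L2R3)‖ * (k * ‖(u : L2R3)‖) := by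
    gcongr; exact hyp.norm_A_le _
  nlinarith

lemma measurableSet_well : MeasurableSet {x | V x < -(c / 2)} :=
  measurableSet_lt hyp.continuous.measurable measurable_const

/-- In the well `V ≥ -κ`, and outside it `V ≥ -c/2`. An energy of `-c` thus forces mass into the
well. -/
lemma le_integral_potential (u : L2R3) (hu : ‖u‖ = 1) :
    -(κ * ∫ x in {x | V x < -(c / 2)}, ‖u x‖ ^ 2) - c / 2 ≤ ∫ x, V x * ‖u x‖ ^ 2 := by
  have h1 : ∫ x, (c / 2) * ‖u x‖ ^ 2 = c / 2 := by
    rw [integral_const_mul, ← norm_sq_Lp, hu]; ring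
  have hi := (integrable_norm_sq_Lp u)
  have hs := hyp.measurableSet_well
  have h2 : -(κ * ∫ x in {x | V x < -(c / 2)}, ‖u x‖ ^ 2) - c / 2 =
      ∫ x, (-(κ * ({x | V x < -(c / 2)}.indicator (fun x => ‖u x‖ ^ 2) x)) -
        (c / 2) * ‖u x‖ ^ 2) := by
    rw [integral_sub (f := fun x => -(κ * ({x | V x < -(c / 2)}.indicator (fun x => ‖u x‖ ^ 2) x)))
      ((hi.indicator hs).const_mul κ).neg (hi.const_mul _), h1, integral_neg,
      integral_const_mul, integral_indicator hs]
  rw [h2]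
  refine integral_mono ((((hi.indicator hs).const_mul κ).neg).sub (hi.const_mul _))
    (integrable_potential_mul hyp.continuous hyp.abs_V_le u) fun x => ?_
  have h3 := (abs_le.1 (hyp.abs_V_le x)).1
  have hc := hyp.c_pos
  by_cases hx : x ∈ {x | V x < -(c / 2)}
  · simp only [indicator_of_mem hx]
    nlinarith [sq_nonneg ‖u x‖]
  · simp only [indicator_of_notMem hx]
    have : -(c / 2) ≤ V x := not_lt.1 hx
    nlinarith [sq_nonneg ‖u x‖]

/-- A normalized state of energy at most `-c` either is moved by `A` or has low frequency mass
in the potential well. -/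
lemma one_le_of_energy_le (u : (relHamiltonian h V A).domain) (hu : ‖(u : L2R3)‖ = 1)
    (he : (⟪(u : L2R3), relHamiltonian h V A u⟫_ℂ).re ≤ -c) :
    1 ≤ 16 / c ^ 2 * ‖A u‖ ^ 2 + 16 * κ / c * ∫ x in {x | V x < -(c / 2)},
      ‖lowVal (16 * κ * (κ + 1) / c / (2 * Real.pi * h)) u x‖ ^ 2 := by
  have hc := hyp.c_pos
  have hκ := hyp.κ_pos
  have hh := hyp.h_pos
  set R := 16 * κ * (κ + 1) / c / (2 * Real.pi * h) with hR
  have hRpos : 0 < R := by positivity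
  have hlow : 0 ≤ ∫ x in {x | V x < -(c / 2)}, ‖lowVal R u x‖ ^ 2 :=
    integral_nonneg fun x => sq_nonneg _
  by_cases hA : c / 4 ≤ ‖A u‖
  · have h1 : 1 ≤ 16 / c ^ 2 * ‖A u‖ ^ 2 := by
      calc (1 : ℝ) = 16 / c ^ 2 * (c / 4) ^ 2 := by field_simp; norm_num
        _ ≤ _ := by gcongr
    have h2 : 0 ≤ 16 * κ / c * ∫ x in {x | V x < -(c / 2)}, ‖lowVal R u x‖ ^ 2 := by positivity
    linarith
  push Not at hA
  rw [hyp.re_inner] at he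
  have h1 := integral_kinetic_nonneg h (u : L2R3)
  have h2 := hyp.neg_le_integral_potential (u : L2R3)
  have h3 := (abs_le.1 (abs_re_inner_apply_le A (u : L2R3))).1
  have h4 := hyp.le_integral_potential u hu
  rw [hu] at h2 h3
  -- With `|⟨u, Au⟩| < c/4` and nonnegative kinetic energy, `-c ≥ -κ·mass - c/2 - c/4`.
  have hmass : c / 4 ≤ κ * ∫ x in {x | V x < -(c / 2)}, ‖(u : L2R3) x‖ ^ 2 := by linarith
  have hkin : ∫ ξ, relSymbol h ξ * ‖FL2 (u : L2R3) ξ‖ ^ 2 ≤ κ := by linarith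
  have h5 := setIntegral_norm_sq_le hh hRpos {x | V x < -(c / 2)}
    (⟨u, u.2.1.1⟩ : (relKinetic h).domain)
  simp only [hu] at h5
  -- The radius `R` is chosen so that the high frequency mass, multiplied by `κ`, uses up at most
  -- `c/8`, half of the available `c/4`.
  have h6 : 2 / (2 * Real.pi * h * R) *
      ((∫ ξ, relSymbol h ξ * ‖FL2 (u : L2R3) ξ‖ ^ 2) + 1 ^ 2) ≤ c / (8 * κ) := by
    have h7 : 2 * Real.pi * h * R = 16 * κ * (κ + 1) / c := by
      rw [hR]; field_simp
    rw [h7]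
    calc _ ≤ 2 / (16 * κ * (κ + 1) / c) * (κ + 1 ^ 2) := by gcongr
      _ = c / (8 * κ) := by field_simp; norm_num
  have h8 : c / 4 ≤ κ * (2 * (∫ x in {x | V x < -(c / 2)}, ‖lowVal R u x‖ ^ 2) + c / (8 * κ)) := by
    refine hmass.trans ?_
    gcongr
    linarith
  have h9 : κ * (c / (8 * κ)) = c / 8 := by field_simp
  rw [mul_add, h9] at h8
  have h10 : 1 ≤ 16 * κ / c * ∫ x in {x | V x < -(c / 2)}, ‖lowVal R u x‖ ^ 2 := by
    rw [div_mul_eq_mul_div, one_le_div hc]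
    linarith
  have h11 : 0 ≤ 16 / c ^ 2 * ‖A u‖ ^ 2 := by positivity
  linarith

/-- A bound on the number of eigenvalues below `-c`. -/
lemma card_le {ι : Type} [Fintype ι] {f : ι → (relHamiltonian h V A).domain} {e : ι → ℝ}
    (hfe : IsEigenfamily (relHamiltonian h V A) (-c) f e) :
    (2 * Real.pi * h) ^ 3 * Fintype.card ι ≤ (2 * Real.pi * h) ^ 3 * (16 / c ^ 2 * k ^ 2) +
      16 * κ / c * (ω * ((16 * κ * (κ + 1) / c) ^ 3 *
        (volume (Metric.closedBall (0 : R3) 1)).toReal)) := by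
  have hc := hyp.c_pos
  have hκ := hyp.κ_pos
  have hh := hyp.h_pos
  set R := 16 * κ * (κ + 1) / c / (2 * Real.pi * h) with hR
  have hRpos : 0 < R := by positivity
  have h1 : ∀ i, 1 ≤ 16 / c ^ 2 * ‖A (f i)‖ ^ 2 + 16 * κ / c * ∫ x in {x | V x < -(c / 2)},
      ‖lowVal R (f i) x‖ ^ 2 := fun i => by
    refine hyp.one_le_of_energy_le (f i) (hfe.orthonormal.1 i) ?_
    rw [hfe.map_eq, inner_smul_right, inner_self_eq_norm_sq_to_K, hfe.orthonormal.1 i]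
    simpa using (hfe.lt i).le
  have h2 := Finset.sum_le_sum (s := Finset.univ) fun i _ => h1 i
  rw [Finset.sum_add_distrib, ← Finset.mul_sum, ← Finset.mul_sum] at h2
  simp only [Finset.sum_const, Finset.card_univ, nsmul_eq_mul, mul_one] at h2
  have h3 := sum_norm_apply_sq_le_of_hsNorm_le hyp.k_nonneg hyp.hsNorm_le hfe.orthonormal
  have h4 := sum_setIntegral_lowVal_sq_le (R := R) hyp.volume_ne_top hfe.orthonormal
  have h5 : (volume {x | V x < -(c / 2)}).toReal ≤ ω :=
    ENNReal.toReal_le_of_le_ofReal hyp.ω_nonneg hyp.volume_le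
  have h6 : (volume (Metric.closedBall (0 : R3) R)).toReal =
      R ^ 3 * (volume (Metric.closedBall (0 : R3) 1)).toReal := by
    rw [Measure.addHaar_closedBall' volume _ hRpos.le, ENNReal.toReal_mul, finrank_euclideanSpace,
      Fintype.card_fin, ENNReal.toReal_ofReal (by positivity)]
  have h7 : (Fintype.card ι : ℝ) ≤ 16 / c ^ 2 * k ^ 2 +
      16 * κ / c * (ω * (R ^ 3 * (volume (Metric.closedBall (0 : R3) 1)).toReal)) := by
    refine h2.trans ?_
    gcongr
    refine h4.trans ?_
    rw [h6]
    gcongr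
  calc _ ≤ (2 * Real.pi * h) ^ 3 * (16 / c ^ 2 * k ^ 2 +
      16 * κ / c * (ω * (R ^ 3 * (volume (Metric.closedBall (0 : R3) 1)).toReal))) := by gcongr
    -- The cube of `2πħ` is absorbed by `R³`, because `2πħR` does not depend on `ħ`.
    _ = (2 * Real.pi * h) ^ 3 * (16 / c ^ 2 * k ^ 2) + 16 * κ / c * (ω *
        ((2 * Real.pi * h * R) ^ 3 * (volume (Metric.closedBall (0 : R3) 1)).toReal)) := by ring
    _ = _ := by
      have h7 : 2 * Real.pi * h * R = 16 * κ * (κ + 1) / c := by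
        rw [hR]; field_simp
      rw [h7]

/-- There is no spectrum below `-c` along weak null sequences. -/
lemma neg_le_of_weakly_null (u : ℕ → (relHamiltonian h V A).domain)
    (hu : ∀ n, ‖(u n : L2R3)‖ = 1)
    (hw : ∀ v, Tendsto (fun n => ⟪(u n : L2R3), v⟫_ℂ) atTop (𝓝 0)) (μ : ℝ)
    (hμ : Tendsto (fun n => (⟪(u n : L2R3), relHamiltonian h V A (u n)⟫_ℂ).re) atTop (𝓝 μ)) :
    -c ≤ μ := by
  by_contra! hlt
  have h1 := hμ.eventually (gt_mem_nhds hlt)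
  have h2 := tendsto_norm_apply_of_weakly_null hyp.k_nonneg hyp.hsNorm_le hu hw
  have h3 := tendsto_setIntegral_lowVal_sq (R := 16 * κ * (κ + 1) / c / (2 * Real.pi * h))
    hyp.volume_ne_top hu hw
  have h4 := (h2.const_mul (16 / c ^ 2)).add (h3.const_mul (16 * κ / c))
  have h5 : (1 : ℝ) ≤ 16 / c ^ 2 * 0 + 16 * κ / c * 0 := by
    refine ge_of_tendsto h4 ?_
    filter_upwards [h1] with n hn
    exact hyp.one_le_of_energy_le (u n) (hu n) hn.le
  norm_num at h5

/-- The discrete spectrum below `E ≤ -c`, and the resulting variational bound. -/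
theorem exists_eigenfamily {E : ℝ} (hE : E ≤ -c) :
    ∃ (n : ℕ) (f : Fin n → (relHamiltonian h V A).domain) (e : Fin n → ℝ),
      IsEigenfamily (relHamiltonian h V A) E f e ∧ ExhaustsBelow (relHamiltonian h V A) E f ∧
      ∀ u : (relHamiltonian h V A).domain,
        ∑ i, (e i - E) * ‖⟪(f i : L2R3), (u : L2R3)⟫_ℂ‖ ^ 2 ≤
          (⟪(u : L2R3), relHamiltonian h V A u⟫_ℂ).re - E * ‖(u : L2R3)‖ ^ 2 := by
  have hh := hyp.h_pos
  have hp : 0 < (2 * Real.pi * h) ^ 3 := by positivity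
  obtain ⟨n, f, e, hfe, hex⟩ := exists_eigenfamily_exhausting (H := relHamiltonian h V A) (E := E)
    (N := ((2 * Real.pi * h) ^ 3 * (16 / c ^ 2 * k ^ 2) +
      16 * κ / c * (ω * ((16 * κ * (κ + 1) / c) ^ 3 *
        (volume (Metric.closedBall (0 : R3) 1)).toReal))) / (2 * Real.pi * h) ^ 3)
    (fun n f e hfe => by
      rw [le_div_iff₀ hp, mul_comm]
      have := hyp.card_le (f := f) (e := e)
        ⟨hfe.orthonormal, hfe.map_eq, fun i => (hfe.lt i).trans_le hE⟩
      simpa using this)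
  refine ⟨n, f, e, hfe, hex, ?_⟩
  exact sum_mul_inner_sq_le hyp.symm hfe.orthonormal hfe.map_eq
    (le_re_inner_of_orthogonal hyp.symm hyp.of_forall_inner hyp.bounded_below
      (fun u hu hw μ hμ => hE.trans (hyp.neg_le_of_weakly_null u hu hw μ hμ)) hfe.orthonormal
      hfe.map_eq hex)

end IsAdmissible

/-! ### Classical phase space volumes and integrals -/

lemma continuous_classicalHamiltonian {V : R3 → ℝ} (hV : Continuous V) :
    Continuous (classicalHamiltonian V) := by
  unfold classicalHamiltonian
  fun_prop

lemma volume_annulus_le {r₁ r₂ : ℝ} (h₁ : 0 ≤ r₁) (h₂ : 0 ≤ r₂) :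
    volume (Metric.closedBall (0 : R3) r₂ \ Metric.ball 0 r₁) ≤
      ENNReal.ofReal ((r₂ ^ 3 - r₁ ^ 3) * (volume (Metric.closedBall (0 : R3) 1)).toReal) := by
  by_cases h : r₁ ≤ r₂
  · have hsub : Metric.ball (0 : R3) r₁ ⊆ Metric.closedBall 0 r₂ :=
      Metric.ball_subset_closedBall.trans (Metric.closedBall_subset_closedBall h)
    have hB : volume (Metric.closedBall (0 : R3) 1) ≠ ∞ := measure_closedBall_lt_top.ne
    rw [measure_sdiff hsub measurableSet_ball.nullMeasurableSet measure_ball_lt_top.ne,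
      Measure.addHaar_closedBall' volume _ h₂, Measure.addHaar_ball volume _ h₁,
      ← Measure.addHaar_unitClosedBall_eq_addHaar_unitBall, finrank_euclideanSpace,
      Fintype.card_fin, ← ENNReal.sub_mul (fun _ _ => hB), ← ENNReal.ofReal_sub _ (by positivity),
      ENNReal.ofReal_mul' ENNReal.toReal_nonneg, ENNReal.ofReal_toReal hB]
  · have : Metric.closedBall (0 : R3) r₂ \ Metric.ball 0 r₁ = ∅ := by
      rw [sdiff_eq_empty]
      exact Metric.closedBall_subset_ball (not_le.1 h)
    rw [this]
    simp

/-- The kinetic energy shell `y₁ ≤ √(1+|p|²) - 1 ≤ y₂` has volume `O(y₂ - y₁)`. -/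
lemma volume_kinetic_shell_le {κ y₁ y₂ : ℝ} (h₂ : 0 ≤ y₂) (hκ : y₂ ≤ κ) (h : y₁ ≤ y₂) :
    volume {p : R3 | y₁ ≤ √(1 + ‖p‖ ^ 2) - 1 ∧ √(1 + ‖p‖ ^ 2) - 1 ≤ y₂} ≤
      ENNReal.ofReal (3 * (1 + κ) ^ 2 * (y₂ - y₁) *
        (volume (Metric.closedBall (0 : R3) 1)).toReal) := by
  -- Kinetic energies are nonnegative, so a negative lower limit may be replaced by `0`.
  set y₀ := max y₁ 0 with hy₀
  have hy₀0 : 0 ≤ y₀ := le_max_right _ _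
  have hy₀2 : y₀ ≤ y₂ := max_le h h₂
  have hy₀1 : y₁ ≤ y₀ := le_max_left _ _
  set r₁ := √((1 + y₀) ^ 2 - 1) with hr₁
  set r₂ := √((1 + y₂) ^ 2 - 1) with hr₂
  have hs₁ : r₁ ^ 2 = (1 + y₀) ^ 2 - 1 := Real.sq_sqrt (by nlinarith)
  have hs₂ : r₂ ^ 2 = (1 + y₂) ^ 2 - 1 := Real.sq_sqrt (by nlinarith)
  have hp₁ : 0 ≤ r₁ := Real.sqrt_nonneg _
  have hp₂ : 0 ≤ r₂ := Real.sqrt_nonneg _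
  have h12 : r₁ ≤ r₂ := Real.sqrt_le_sqrt (by nlinarith)
  have hr₂κ : r₂ ≤ 1 + κ := by
    refine (Real.sqrt_le_sqrt (y := (1 + κ) ^ 2) (by nlinarith)).trans ?_
    rw [Real.sqrt_sq (by linarith)]
  have hsub : {p : R3 | y₁ ≤ √(1 + ‖p‖ ^ 2) - 1 ∧ √(1 + ‖p‖ ^ 2) - 1 ≤ y₂} ⊆
      Metric.closedBall (0 : R3) r₂ \ Metric.ball 0 r₁ := by
    rintro p ⟨hp1, hp2⟩
    have hsq : √(1 + ‖p‖ ^ 2) ^ 2 = 1 + ‖p‖ ^ 2 := Real.sq_sqrt (by positivity)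
    have h1 : 1 ≤ √(1 + ‖p‖ ^ 2) := Real.one_le_sqrt.2 (by nlinarith [sq_nonneg ‖p‖])
    constructor
    · rw [mem_closedBall_zero_iff]
      exact Real.le_sqrt_of_sq_le (by nlinarith)
    · rw [mem_ball_zero_iff, not_lt, hr₁, Real.sqrt_le_left (norm_nonneg _)]
      have : 1 + y₀ ≤ √(1 + ‖p‖ ^ 2) := by
        have : y₀ ≤ √(1 + ‖p‖ ^ 2) - 1 := max_le hp1 (by linarith)
        linarith
      nlinarith
  refine (measure_mono hsub).trans ((volume_annulus_le hp₁ hp₂).trans ?_)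
  refine ENNReal.ofReal_le_ofReal (mul_le_mul_of_nonneg_right ?_ ENNReal.toReal_nonneg)
  -- Twice the gap is `(r₂ - r₁)²(r₂ + 2r₁) ≥ 0`. Squares of radii are used because `r² = (1 + y)² -
  -- 1` is Lipschitz on bounded ranges of `y`, whereas `r` itself behaves like `√y` at zero.
  have h3 : r₂ ^ 3 - r₁ ^ 3 ≤ 3 / 2 * r₂ * (r₂ ^ 2 - r₁ ^ 2) := by
    nlinarith [mul_nonneg (sub_nonneg.2 h12) (mul_nonneg (sub_nonneg.2 h12)
      (add_nonneg hp₂ (mul_nonneg two_pos.le hp₁)))]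
  have h4 : r₂ ^ 2 - r₁ ^ 2 ≤ (y₂ - y₁) * (2 * (1 + κ)) := by
    rw [hs₁, hs₂]
    have : (1 + y₂) ^ 2 - 1 - ((1 + y₀) ^ 2 - 1) = (y₂ - y₀) * (2 + y₂ + y₀) := by ring
    rw [this]
    apply mul_le_mul <;> linarith
  calc _ ≤ 3 / 2 * r₂ * (r₂ ^ 2 - r₁ ^ 2) := h3
    _ ≤ 3 / 2 * (1 + κ) * ((y₂ - y₁) * (2 * (1 + κ))) := by
        apply mul_le_mul _ h4
        · nlinarith
        · nlinarith
        · gcongr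
    _ = _ := by ring

lemma min_classical_eq_indicator (V : R3 → ℝ) (E : ℝ) :
    (fun z => min (classicalHamiltonian V z - E) 0) =
      {z : R3 × R3 | classicalHamiltonian V z < E}.indicator
        (fun z => classicalHamiltonian V z - E) := by
  ext z
  by_cases hz : classicalHamiltonian V z < E
  · rw [indicator_of_mem (show z ∈ {z | classicalHamiltonian V z < E} from hz),
      min_eq_left (by linarith)]
  · rw [indicator_of_notMem (show z ∉ {z | classicalHamiltonian V z < E} from hz),
      min_eq_right (by linarith)]

namespace IsAdmissible

variable {h κ k c ω : ℝ} {V : R3 → ℝ} {A : L2R3 →L[ℂ] L2R3} (hyp : IsAdmissible h κ k c ω V A)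
include hyp

/-- Kinetic energy is nonnegative, so `V q ≤ E < -c/2`; and `V ≥ -κ` bounds the momentum. -/
lemma classical_le_subset {E : ℝ} (hE : E ≤ -c) :
    {z : R3 × R3 | classicalHamiltonian V z ≤ E} ⊆
      {x | V x < -(c / 2)} ×ˢ Metric.closedBall 0 (1 + κ) := by
  rintro ⟨q, p⟩ hz
  change √(1 + ‖p‖ ^ 2) - 1 + V q ≤ E at hz
  have hc := hyp.c_pos
  have h1 : 1 ≤ √(1 + ‖p‖ ^ 2) := Real.one_le_sqrt.2 (by nlinarith [sq_nonneg ‖p‖])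
  have h2 : ‖p‖ ≤ √(1 + ‖p‖ ^ 2) := Real.le_sqrt_of_sq_le (by linarith)
  have h3 := (abs_le.1 (hyp.abs_V_le q)).1
  refine ⟨?_, ?_⟩
  · change V q < -(c / 2)
    linarith
  · rw [mem_closedBall_zero_iff]
    linarith

/-- The volume of the classically allowed region. -/
lemma volume_classical_le {E : ℝ} (hE : E ≤ -c) :
    volume {z : R3 × R3 | classicalHamiltonian V z ≤ E} ≤
      ENNReal.ofReal (ω * ((1 + κ) ^ 3 * (volume (Metric.closedBall (0 : R3) 1)).toReal)) := by
  have hκ := hyp.κ_pos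
  refine (measure_mono (hyp.classical_le_subset hE)).trans ?_
  rw [Measure.volume_eq_prod, Measure.prod_prod,
    Measure.addHaar_closedBall' volume _ (by positivity),
    finrank_euclideanSpace, Fintype.card_fin, ENNReal.ofReal_mul hyp.ω_nonneg,
    ENNReal.ofReal_mul (by positivity), ENNReal.ofReal_toReal measure_closedBall_lt_top.ne]
  gcongr
  exact hyp.volume_le

lemma volume_classical_ne_top {E : ℝ} (hE : E ≤ -c) :
    volume {z : R3 × R3 | classicalHamiltonian V z ≤ E} ≠ ∞ :=
  ne_top_of_le_ne_top ENNReal.ofReal_ne_top (hyp.volume_classical_le hE)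

/-- The volume of a classical energy shell. -/
lemma volume_shell_le {a b : ℝ} (hab : a ≤ b) (hb : b ≤ -c) :
    volume {z : R3 × R3 | a ≤ classicalHamiltonian V z ∧ classicalHamiltonian V z ≤ b} ≤
      ENNReal.ofReal (ω * (3 * (1 + κ) ^ 2 * (volume (Metric.closedBall (0 : R3) 1)).toReal) *
        (b - a)) := by
  have hκ := hyp.κ_pos
  have hc := hyp.c_pos
  have hcont := continuous_classicalHamiltonian hyp.continuous
  have hm : MeasurableSet
      {z : R3 × R3 | a ≤ classicalHamiltonian V z ∧ classicalHamiltonian V z ≤ b} :=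
    ((isClosed_le continuous_const hcont).inter (isClosed_le hcont continuous_const)).measurableSet
  rw [Measure.volume_eq_prod, Measure.prod_apply hm]
  set D := 3 * (1 + κ) ^ 2 * (b - a) * (volume (Metric.closedBall (0 : R3) 1)).toReal with hD
  have hslice : ∀ q, volume (Prod.mk q ⁻¹'
      {z : R3 × R3 | a ≤ classicalHamiltonian V z ∧ classicalHamiltonian V z ≤ b}) ≤
      {x | V x < -(c / 2)}.indicator (fun _ => ENNReal.ofReal D) q := by
    intro q
    by_cases hq : 0 ≤ b - V q
    · have hVq : V q < -(c / 2) := by linarith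
      rw [indicator_of_mem (show q ∈ {x | V x < -(c / 2)} from hVq)]
      have h3 := (abs_le.1 (hyp.abs_V_le q)).1
      have h4 := volume_kinetic_shell_le (κ := κ) (y₁ := a - V q) hq (by linarith) (by linarith)
      rw [sub_sub_sub_cancel_right] at h4
      refine le_trans (measure_mono ?_) h4
      rintro p ⟨hp1, hp2⟩
      change a ≤ √(1 + ‖p‖ ^ 2) - 1 + V q at hp1
      change √(1 + ‖p‖ ^ 2) - 1 + V q ≤ b at hp2
      exact ⟨by linarith, by linarith⟩
    · have : Prod.mk q ⁻¹' {z : R3 × R3 | a ≤ classicalHamiltonian V z ∧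
          classicalHamiltonian V z ≤ b} = ∅ := by
        rw [eq_empty_iff_forall_notMem]
        rintro p ⟨-, hp2⟩
        change √(1 + ‖p‖ ^ 2) - 1 + V q ≤ b at hp2
        have h1 : 1 ≤ √(1 + ‖p‖ ^ 2) := Real.one_le_sqrt.2 (by nlinarith [sq_nonneg ‖p‖])
        exact hq (by linarith)
      rw [this]
      simp
  refine (lintegral_mono hslice).trans ?_
  rw [lintegral_indicator_const hyp.measurableSet_well]
  have hD' : ω * (3 * (1 + κ) ^ 2 * (volume (Metric.closedBall (0 : R3) 1)).toReal) * (b - a) =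
      D * ω := by rw [hD]; ring
  rw [hD', ENNReal.ofReal_mul (mul_nonneg (mul_nonneg (by positivity) (by linarith))
    ENNReal.toReal_nonneg)]
  gcongr
  exact hyp.volume_le

lemma integrableOn_classical {E : ℝ} (hE : E ≤ -c) :
    IntegrableOn (fun z => classicalHamiltonian V z - E)
      {z : R3 × R3 | classicalHamiltonian V z ≤ E} := by
  have hcont := continuous_classicalHamiltonian hyp.continuous
  have hm : MeasurableSet {z : R3 × R3 | classicalHamiltonian V z ≤ E} :=
    (isClosed_le hcont continuous_const).measurableSet
  refine Measure.integrableOn_of_bounded (M := κ) (hyp.volume_classical_ne_top hE)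
    (hcont.sub continuous_const).aestronglyMeasurable ?_
  filter_upwards [ae_restrict_mem hm] with z hz
  have h3 := (abs_le.1 (hyp.abs_V_le z.1)).1
  have h1 : 1 ≤ √(1 + ‖z.2‖ ^ 2) := Real.one_le_sqrt.2 (by nlinarith [sq_nonneg ‖z.2‖])
  have hc := hyp.c_pos
  change √(1 + ‖z.2‖ ^ 2) - 1 + V z.1 ≤ E at hz
  rw [Real.norm_eq_abs, abs_le]
  unfold classicalHamiltonian
  constructor <;> linarith [hyp.κ_pos]

lemma measurableSet_classical_lt (E : ℝ) :
    MeasurableSet {z : R3 × R3 | classicalHamiltonian V z < E} :=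
  (isOpen_lt (continuous_classicalHamiltonian hyp.continuous) continuous_const).measurableSet

lemma integrableOn_classical_lt {E : ℝ} (hE : E ≤ -c) :
    IntegrableOn (fun z => classicalHamiltonian V z - E)
      {z : R3 × R3 | classicalHamiltonian V z < E} :=
  (hyp.integrableOn_classical hE).mono_set fun z hz =>
    le_of_lt (show classicalHamiltonian V z < E from hz)

lemma integrable_min_classical {E : ℝ} (hE : E ≤ -c) :
    Integrable (fun z => min (classicalHamiltonian V z - E) 0) := by
  rw [min_classical_eq_indicator, integrable_indicator_iff (hyp.measurableSet_classical_lt E)]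
  exact hyp.integrableOn_classical_lt hE

lemma integral_min_classical (E : ℝ) :
    ∫ z, min (classicalHamiltonian V z - E) 0 =
      ∫ z in {z : R3 × R3 | classicalHamiltonian V z < E}, (classicalHamiltonian V z - E) := by
  rw [min_classical_eq_indicator, integral_indicator (hyp.measurableSet_classical_lt E)]

end IsAdmissible

/-! ### Coherent states as trial vectors and the phase space symbol -/

/-- The linear weight is absorbed by doubling the width parameter. This shows that the kinetic
symbol, which grows linearly, keeps the transform of a coherent state in `L²`. -/
lemma norm_mul_gaussAmp_le {s : ℝ} (hs : 0 < s) (x : R3) :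
    ‖x‖ * gaussAmp s x ≤ (√s * 2 ^ (3 / 4 : ℝ)) * gaussAmp (2 * s) x := by
  have h1 := norm_le_sqrt_mul_exp hs x
  have h2 : Real.exp (‖x‖ ^ 2 / s) * Real.exp (-Real.pi * ‖x‖ ^ 2 / s) ≤
      Real.exp (-Real.pi * ‖x‖ ^ 2 / (2 * s)) := by
    rw [← Real.exp_add, Real.exp_le_exp]
    have h3 : 0 ≤ (Real.pi / 2 - 1) * (‖x‖ ^ 2 / s) :=
      mul_nonneg (by linarith [Real.pi_gt_three]) (by positivity)
    have h4 : ‖x‖ ^ 2 / s + -Real.pi * ‖x‖ ^ 2 / s - -Real.pi * ‖x‖ ^ 2 / (2 * s) =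
      -((Real.pi / 2 - 1) * (‖x‖ ^ 2 / s)) := by field_simp; ring
    linarith
  unfold gaussAmp
  have h5 : (2 / s) ^ (3 / 4 : ℝ) = 2 ^ (3 / 4 : ℝ) * (2 / (2 * s)) ^ (3 / 4 : ℝ) := by
    rw [← Real.mul_rpow (by positivity) (by positivity)]
    congr 1
    field_simp
  calc _ ≤ (√s * Real.exp (‖x‖ ^ 2 / s)) *
        ((2 / s) ^ (3 / 4 : ℝ) * Real.exp (-Real.pi * ‖x‖ ^ 2 / s)) := by gcongr
    _ = √s * (2 / s) ^ (3 / 4 : ℝ) *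
        (Real.exp (‖x‖ ^ 2 / s) * Real.exp (-Real.pi * ‖x‖ ^ 2 / s)) := by ring
    _ ≤ √s * (2 / s) ^ (3 / 4 : ℝ) * Real.exp (-Real.pi * ‖x‖ ^ 2 / (2 * s)) := by gcongr
    _ = _ := by rw [h5]; ring

lemma norm_FL2_cohState {s : ℝ} (hs : 0 < s) (q η : R3) :
    ∀ᵐ ξ : R3, ‖FL2 (cohState hs q η) ξ‖ = gaussAmp s⁻¹ (ξ - η) := by
  rw [FL2_cohState]
  filter_upwards [Lp.coeFn_smul (𝐞 ⟪η, q⟫_ℝ : ℂ) (cohState (inv_pos.2 hs) η (-q)),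
    coeFn_cohState (inv_pos.2 hs) η (-q)] with ξ h2 h3
  rw [h2, Pi.smul_apply, h3, norm_smul, Circle.norm_coe, one_mul, norm_cohFun (inv_pos.2 hs)]

lemma relSymbol_le {h : ℝ} (hh : 0 ≤ h) (ξ : R3) : relSymbol h ξ ≤ 2 * Real.pi * h * ‖ξ‖ := by
  have h1 := (abs_le.1 (relSymbol_lipschitz hh ξ 0)).2
  have h2 : relSymbol h 0 = 0 := by simp [relSymbol]
  rwa [h2, sub_zero, sub_zero] at h1

lemma cohState_mem_relKinetic {h s : ℝ} (hh : 0 ≤ h) (hs : 0 < s) (q η : R3) :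
    cohState hs q η ∈ (relKinetic h).domain := by
  have hs' := inv_pos.2 hs
  rw [mem_relKinetic]
  have h1 : MemLp (fun ξ : R3 => 2 * Real.pi * h * ((√s⁻¹ * 2 ^ (3 / 4 : ℝ)) *
      ‖cohFun (2 * s⁻¹) η 0 ξ‖ + ‖η‖ * ‖cohFun s⁻¹ η 0 ξ‖)) 2 :=
    (((memLp_cohFun (by positivity) η 0).norm.const_mul _).add
      ((memLp_cohFun hs' η 0).norm.const_mul _)).const_mul _
  refine h1.mono ?_ ?_
  · exact (Complex.continuous_ofReal.comp (continuous_relSymbol h)).aestronglyMeasurable.mul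
      (Lp.aestronglyMeasurable _)
  · filter_upwards [norm_FL2_cohState hs q η] with ξ hξ
    rw [norm_cohFun hs', norm_cohFun (by positivity), norm_mul, hξ,
      Complex.norm_of_nonneg (relSymbol_nonneg h ξ)]
    refine le_trans ?_ (le_abs_self _)
    have h2 := gaussAmp_nonneg hs' (ξ - η)
    have h3 : ‖ξ‖ ≤ ‖ξ - η‖ + ‖η‖ := norm_le_norm_sub_add ξ η
    have h4 := norm_mul_gaussAmp_le hs' (ξ - η)
    calc _ ≤ 2 * Real.pi * h * ‖ξ‖ * gaussAmp s⁻¹ (ξ - η) := by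
          gcongr; exact relSymbol_le hh ξ
      _ ≤ 2 * Real.pi * h * (‖ξ - η‖ + ‖η‖) * gaussAmp s⁻¹ (ξ - η) := by gcongr
      _ = 2 * Real.pi * h * (‖ξ - η‖ * gaussAmp s⁻¹ (ξ - η) + ‖η‖ * gaussAmp s⁻¹ (ξ - η)) := by
          ring
      _ ≤ _ := by gcongr

/-- The phase space symbol of the Hamiltonian in the variables `(q, η)`, `p = 2πħη`. -/
def phaseSymbol (h : ℝ) (V : R3 → ℝ) (z : R3 × R3) : ℝ := relSymbol h z.2 + V z.1

lemma phaseSymbol_eq (h : ℝ) (V : R3 → ℝ) (z : R3 × R3) (hh : 0 ≤ h) :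
    phaseSymbol h V z = classicalHamiltonian V (z.1, (2 * Real.pi * h) • z.2) := by
  simp only [phaseSymbol, relSymbol, classicalHamiltonian, norm_smul, Real.norm_eq_abs]
  rw [abs_of_nonneg (by positivity)]
  congr 5
  ring

/-- The substitution `p = 2πħη` is the source of the factor `(2πħ)³`. A general `F` covers both the
negative part of `σ - E` and the indicator of the allowed region. -/
lemma integral_phaseSymbol {h : ℝ} (hh : 0 < h) (V : R3 → ℝ) (F : ℝ → ℝ) :
    (Integrable (fun z => F (phaseSymbol h V z)) ↔
      Integrable (fun z => F (classicalHamiltonian V z))) ∧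
    (2 * Real.pi * h) ^ 3 * ∫ z, F (phaseSymbol h V z) =
      ∫ z, F (classicalHamiltonian V z) := by
  set r := 2 * Real.pi * h with hr
  have hr0 : 0 < r := by positivity
  set Φ : (R3 × R3) ≃ᵐ (R3 × R3) :=
    (MeasurableEquiv.refl R3).prodCongr (MeasurableEquiv.smul (Units.mk0 r hr0.ne')) with hΦ
  have hmap : Measure.map Φ (volume : Measure (R3 × R3)) =
      ENNReal.ofReal ((r ^ 3)⁻¹) • volume := by
    have h1 : (Φ : R3 × R3 → R3 × R3) = Prod.map id (fun p => r • p) := rfl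
    rw [h1, Measure.volume_eq_prod, ← Measure.map_prod_map _ _ measurable_id
      (measurable_const_smul r), Measure.map_id, Measure.map_addHaar_smul volume hr0.ne',
      finrank_euclideanSpace, Fintype.card_fin, abs_of_nonneg (by positivity),
      Measure.prod_smul_right]
  have hcomp : ∀ z, F (phaseSymbol h V z) = (fun w => F (classicalHamiltonian V w)) (Φ z) :=
    fun z => by rw [phaseSymbol_eq h V z hh.le]; rfl
  have hne : ENNReal.ofReal ((r ^ 3)⁻¹) ≠ 0 := by
    rw [ENNReal.ofReal_ne_zero_iff]; positivity
  constructor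
  · simp_rw [hcomp]
    have h2 := integrable_map_equiv Φ (fun w => F (classicalHamiltonian V w)) (μ := volume)
    rw [hmap, integrable_smul_measure hne ENNReal.ofReal_ne_top] at h2
    exact h2.symm
  · simp_rw [hcomp]
    rw [← integral_map_equiv Φ (fun w => F (classicalHamiltonian V w)), hmap,
      integral_smul_measure, ENNReal.toReal_ofReal (by positivity), smul_eq_mul, ← mul_assoc,
      mul_inv_cancel₀ (by positivity), one_mul]

namespace IsAdmissible

variable {h κ k c ω : ℝ} {V : R3 → ℝ} {A : L2R3 →L[ℂ] L2R3} (hyp : IsAdmissible h κ k c ω V A)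
include hyp

lemma cohState_mem (z : R3 × R3) :
    cohState hyp.h_pos z.1 z.2 ∈ (relHamiltonian h V A).domain :=
  (mem_relHamiltonian hyp.continuous hyp.abs_V_le).2
    (cohState_mem_relKinetic hyp.h_pos.le hyp.h_pos _ _)

lemma mul_sqrt_inv : 2 * Real.pi * h * (3 * √h⁻¹) = 6 * Real.pi * √h := by
  have hh := hyp.h_pos
  have : h * √h⁻¹ = √h := by
    rw [Real.sqrt_inv]
    nth_rewrite 1 [← Real.mul_self_sqrt hh.le]
    field_simp
  calc _ = 6 * Real.pi * (h * √h⁻¹) := by ring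
    _ = _ := by rw [this]

/-- The energy of a coherent state. -/
lemma re_inner_cohState_le (z : R3 × R3) :
    (⟪cohState hyp.h_pos z.1 z.2, relHamiltonian h V A ⟨_, hyp.cohState_mem z⟩⟫_ℂ).re ≤
      phaseSymbol h V z + (3 * κ * √h + 6 * Real.pi * √h + k) := by
  have hh := hyp.h_pos
  rw [hyp.re_inner ⟨_, hyp.cohState_mem z⟩]
  have h1 : ∫ ξ, relSymbol h ξ * ‖FL2 (cohState hh z.1 z.2) ξ‖ ^ 2 ≤
      relSymbol h z.2 + 6 * Real.pi * √h := by
    have h2 : ∫ ξ, relSymbol h ξ * ‖FL2 (cohState hh z.1 z.2) ξ‖ ^ 2 =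
        ∫ ξ, relSymbol h ξ * gaussAmp h⁻¹ (z.2 - ξ) ^ 2 := by
      apply integral_congr_ae
      filter_upwards [norm_FL2_cohState hh z.1 z.2] with ξ hξ
      rw [hξ, ← gaussAmp_neg, neg_sub]
    have h3 := (lipschitz_mul_gaussAmp_sq (inv_pos.2 hh) (relSymbol_lipschitz hh.le) z.2).2
    rw [h2]
    rw [hyp.mul_sqrt_inv] at h3
    linarith [(abs_le.1 h3).2]
  have h4 : ∫ x, V x * ‖cohState hh z.1 z.2 x‖ ^ 2 ≤ V z.1 + 3 * κ * √h := by
    have h2 : ∫ x, V x * ‖cohState hh z.1 z.2 x‖ ^ 2 =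
        ∫ x, V x * gaussAmp h (z.1 - x) ^ 2 := by
      apply integral_congr_ae
      filter_upwards [coeFn_cohState hh z.1 z.2] with ξ hξ
      rw [hξ, norm_cohFun hh, ← gaussAmp_neg, neg_sub]
    have h3 := (lipschitz_mul_gaussAmp_sq hh hyp.lipschitz z.1).2
    rw [h2]
    linarith [(abs_le.1 h3).2]
  have h5 := (abs_le.1 (abs_re_inner_apply_le A (cohState hh z.1 z.2))).2
  have h6 := hyp.norm_A_le (cohState hh z.1 z.2)
  rw [norm_cohState] at h5 h6
  simp only [phaseSymbol]
  linarith

/-- The Husimi density of a state computes its energy up to `O(√ħ)`. -/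
lemma integral_phaseSymbol_husimi_le (u : (relHamiltonian h V A).domain)
    (hu : ‖(u : L2R3)‖ = 1) :
    Integrable (fun z => phaseSymbol h V z * husimi hyp.h_pos u z) ∧
      ∫ z, phaseSymbol h V z * husimi hyp.h_pos u z ≤
        (⟪(u : L2R3), relHamiltonian h V A u⟫_ℂ).re +
          (3 * κ * √h + 6 * Real.pi * √h + k) := by
  have hh := hyp.h_pos
  obtain ⟨h1, h2⟩ := integral_snd_mul_husimi hh (relSymbol_lipschitz hh.le) (u : L2R3)
    (integrable_relSymbol_mul (⟨u, u.2.1.1⟩ : (relKinetic h).domain))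
  obtain ⟨h3, h4⟩ := integral_fst_mul_husimi hh hyp.lipschitz (u : L2R3)
    (integrable_potential_mul hyp.continuous hyp.abs_V_le _)
  simp only [phaseSymbol, add_mul]
  refine ⟨h1.add h3, ?_⟩
  rw [integral_add h1 h3, hyp.re_inner]
  have h5 := (abs_le.1 (abs_re_inner_apply_le A (u : L2R3))).1
  have h6 := hyp.norm_A_le (u : L2R3)
  rw [hu] at h2 h4 h5 h6
  rw [hyp.mul_sqrt_inv] at h2
  linarith [(abs_le.1 h2).2, (abs_le.1 h4).2]

/-! ### Two-sided bounds for the Riesz sum -/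

lemma integrable_min_phaseSymbol {E : ℝ} (hE : E ≤ -c) :
    Integrable (fun z => min (phaseSymbol h V z - E) 0) :=
  (integral_phaseSymbol hyp.h_pos V (fun x => min (x - E) 0)).1.2 (hyp.integrable_min_classical hE)

variable {E : ℝ} {n : ℕ} {f : Fin n → (relHamiltonian h V A).domain} {e : Fin n → ℝ}

/-- Bessel's inequality for the normalized coherent state at `z`. -/
lemma sum_husimi_le (hf : Orthonormal ℂ (fun i => (f i : L2R3))) (z : R3 × R3) :
    ∑ i, husimi hyp.h_pos (f i) z ≤ 1 := by
  have h1 := hf.sum_inner_products_le (cohState hyp.h_pos z.1 z.2) (s := Finset.univ)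
  rw [norm_cohState, one_pow] at h1
  refine le_trans (le_of_eq ?_) h1
  exact Finset.sum_congr rfl fun j _ => by rw [husimi, norm_inner_symm]

/-- Lower bound on the sum of the eigenvalues below `E`. -/
lemma integral_min_le_sum (hE : E ≤ -c) (hfe : IsEigenfamily (relHamiltonian h V A) E f e) :
    (∫ z, min (phaseSymbol h V z - E) 0) - n * (3 * κ * √h + 6 * Real.pi * √h + k) ≤
      ∑ i, (e i - E) := by
  have hh := hyp.h_pos
  have h1 : ∀ i, Integrable (fun z => (phaseSymbol h V z - E) * husimi hh (f i) z) ∧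
      (∫ z, (phaseSymbol h V z - E) * husimi hh (f i) z) -
        (3 * κ * √h + 6 * Real.pi * √h + k) ≤ e i - E := by
    intro i
    obtain ⟨h2, h3⟩ := hyp.integral_phaseSymbol_husimi_le (f i) (hfe.orthonormal.1 i)
    obtain ⟨h4, h5⟩ := integral_husimi hh (f i : L2R3)
    rw [hfe.orthonormal.1 i, one_pow] at h5
    rw [hfe.map_eq, inner_smul_right, inner_self_eq_norm_sq_to_K, hfe.orthonormal.1 i] at h3
    simp only [map_one, one_pow, mul_one, Complex.ofReal_re] at h3
    simp_rw [sub_mul]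
    refine ⟨h2.sub (h4.const_mul E), ?_⟩
    rw [integral_sub h2 (h4.const_mul E), integral_const_mul, h5]
    linarith
  -- Bathtub principle: a total density with values in `[0, 1]` cannot make the integral of `σ - E`
  -- smaller than filling exactly the region `σ < E`.
  have h2 : ∫ z, min (phaseSymbol h V z - E) 0 ≤
      ∑ i, ∫ z, (phaseSymbol h V z - E) * husimi hh (f i) z := by
    rw [← integral_finsetSum _ fun i _ => (h1 i).1]
    refine integral_mono (hyp.integrable_min_phaseSymbol hE)
      (integrable_finsetSum _ fun i _ => (h1 i).1) fun z => ?_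
    simp only
    rw [← Finset.mul_sum]
    have h3 := hyp.sum_husimi_le hfe.orthonormal z
    have h4 : 0 ≤ ∑ i, husimi hh (f i : L2R3) z :=
      Finset.sum_nonneg fun i _ => husimi_nonneg hh _ _
    rcases le_total (phaseSymbol h V z - E) 0 with h5 | h5
    · rw [min_eq_left h5]; nlinarith
    · rw [min_eq_right h5]; positivity
  have h3 := Finset.sum_le_sum (s := Finset.univ) fun i _ => (h1 i).2
  rw [Finset.sum_sub_distrib] at h3
  simp only [Finset.sum_const, Finset.card_univ, Fintype.card_fin, nsmul_eq_mul] at h3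
  linarith

/-- Upper bound on the sum of the eigenvalues below `E`. -/
lemma sum_le_integral_min (hE : E ≤ -c) (hfe : IsEigenfamily (relHamiltonian h V A) E f e)
    (hvar : ∀ u : (relHamiltonian h V A).domain,
        ∑ i, (e i - E) * ‖⟪(f i : L2R3), (u : L2R3)⟫_ℂ‖ ^ 2 ≤
          (⟪(u : L2R3), relHamiltonian h V A u⟫_ℂ).re - E * ‖(u : L2R3)‖ ^ 2) :
    (2 * Real.pi * h) ^ 3 * ∑ i, (e i - E) ≤
      (2 * Real.pi * h) ^ 3 * (∫ z, min (phaseSymbol h V z - E) 0) +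
        (3 * κ * √h + 6 * Real.pi * √h + k) *
          (ω * ((1 + κ) ^ 3 * (volume (Metric.closedBall (0 : R3) 1)).toReal)) := by
  have hh := hyp.h_pos
  have hκ := hyp.κ_pos
  have hk := hyp.k_nonneg
  set D := 3 * κ * √h + 6 * Real.pi * √h + k with hD
  have hD0 : 0 ≤ D := by positivity
  -- `J` selects the coherent states of the allowed region. The others are discarded, since the
  -- integral over the region `σ ≥ E` is not controlled.
  set J : ℝ → ℝ := (Iio E).indicator 1 with hJ
  have hJ0 : ∀ x, 0 ≤ J x := fun x => indicator_nonneg (fun _ _ => zero_le_one) x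
  have hJ1 : ∀ x, J x ≤ 1 := fun x => indicator_le_self' (fun _ _ => zero_le_one) x
  have hJmeas : Measurable J := measurable_one.indicator measurableSet_Iio
  have hσ : Continuous (phaseSymbol h V) :=
    ((continuous_relSymbol h).comp continuous_snd).add (hyp.continuous.comp continuous_fst)
  have hJc : (fun z => J (classicalHamiltonian V z)) =
      {z : R3 × R3 | classicalHamiltonian V z < E}.indicator 1 := rfl
  have hJint : Integrable (fun z => J (classicalHamiltonian V z)) := by
    rw [hJc, integrable_indicator_iff (hyp.measurableSet_classical_lt E)]
    refine integrableOn_const (ne_top_of_le_ne_top (hyp.volume_classical_ne_top hE)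
      (measure_mono fun z hz => ?_)) (C := (1 : ℝ))
    exact le_of_lt (show classicalHamiltonian V z < E from hz)
  obtain ⟨hs1, hs2⟩ := integral_phaseSymbol hh V J
  have hJσ : Integrable (fun z => J (phaseSymbol h V z)) := hs1.2 hJint
  have hJvol : ∫ z, J (classicalHamiltonian V z) ≤
      ω * ((1 + κ) ^ 3 * (volume (Metric.closedBall (0 : R3) 1)).toReal) := by
    rw [hJc, integral_indicator_one (hyp.measurableSet_classical_lt E)]
    refine ENNReal.toReal_le_of_le_ofReal (mul_nonneg hyp.ω_nonneg
      (mul_nonneg (by positivity) ENNReal.toReal_nonneg)) ?_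
    refine le_trans (measure_mono fun z hz => ?_) (hyp.volume_classical_le hE)
    exact le_of_lt (show classicalHamiltonian V z < E from hz)
  have hZ : ∀ i, Integrable (fun z => J (phaseSymbol h V z) * husimi hh (f i) z) ∧
      ∫ z, J (phaseSymbol h V z) * husimi hh (f i) z ≤ 1 := by
    intro i
    obtain ⟨h4, h5⟩ := integral_husimi hh (f i : L2R3)
    rw [hfe.orthonormal.1 i, one_pow] at h5
    have hi : Integrable (fun z => J (phaseSymbol h V z) * husimi hh (f i) z) :=
      h4.bdd_mul (c := 1) (hJmeas.comp hσ.measurable).aestronglyMeasurable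
        (Eventually.of_forall fun z => by
          rw [Real.norm_of_nonneg (hJ0 _)]; exact hJ1 _)
    refine ⟨hi, ?_⟩
    rw [← h5]
    exact integral_mono hi h4 fun z =>
      mul_le_of_le_one_left (husimi_nonneg hh _ _) (hJ1 _)
  -- Where `σ < E`, this is the variational inequality for the coherent state at `z`, with its
  -- energy replaced by the symbol up to `D`.
  have hpt : ∀ z, ∑ i, (e i - E) * (J (phaseSymbol h V z) * husimi hh (f i) z) ≤
      min (phaseSymbol h V z - E) 0 + D * J (phaseSymbol h V z) := by
    intro z
    have h1 := hvar ⟨_, hyp.cohState_mem z⟩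
    have h2 := hyp.re_inner_cohState_le z
    simp only [norm_cohState, one_pow, mul_one] at h1
    have h3 : ∑ i, (e i - E) * (J (phaseSymbol h V z) * husimi hh (f i) z) =
        J (phaseSymbol h V z) * ∑ i, (e i - E) *
          ‖⟪(f i : L2R3), cohState hh z.1 z.2⟫_ℂ‖ ^ 2 := by
      rw [Finset.mul_sum]
      refine Finset.sum_congr rfl fun i _ => ?_
      rw [husimi, norm_inner_symm]
      ring
    rw [h3]
    by_cases hz : phaseSymbol h V z < E
    · have : J (phaseSymbol h V z) = 1 := by
        rw [hJ, indicator_of_mem (show phaseSymbol h V z ∈ Iio E from hz), Pi.one_apply]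
      rw [this, one_mul, mul_one, min_eq_left (by linarith)]
      linarith
    · have : J (phaseSymbol h V z) = 0 := by
        rw [hJ, indicator_of_notMem (show phaseSymbol h V z ∉ Iio E from hz)]
      rw [this, zero_mul, mul_zero, min_eq_right (by linarith), add_zero]
  -- Each `e i - E` is negative and each cut off Husimi mass is at most `1`.
  have h1 : ∑ i, (e i - E) ≤ ∑ i, (e i - E) * ∫ z, J (phaseSymbol h V z) * husimi hh (f i) z := by
    refine Finset.sum_le_sum fun i _ => ?_
    have h2 := hfe.lt i
    nlinarith [(hZ i).2]
  have h2 : ∑ i, (e i - E) * ∫ z, J (phaseSymbol h V z) * husimi hh (f i) z ≤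
      (∫ z, min (phaseSymbol h V z - E) 0) + D * ∫ z, J (phaseSymbol h V z) := by
    simp_rw [← integral_const_mul]
    rw [← integral_finsetSum _ fun i _ => (hZ i).1.const_mul _,
      ← integral_add (hyp.integrable_min_phaseSymbol hE) (hJσ.const_mul D)]
    exact integral_mono (integrable_finsetSum _ fun i _ => (hZ i).1.const_mul _)
      ((hyp.integrable_min_phaseSymbol hE).add (hJσ.const_mul D)) hpt
  calc _ ≤ (2 * Real.pi * h) ^ 3 *
        ((∫ z, min (phaseSymbol h V z - E) 0) + D * ∫ z, J (phaseSymbol h V z)) := by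
        gcongr; exact h1.trans h2
    _ = (2 * Real.pi * h) ^ 3 * (∫ z, min (phaseSymbol h V z - E) 0) +
        D * ((2 * Real.pi * h) ^ 3 * ∫ z, J (phaseSymbol h V z)) := by ring
    _ ≤ _ := by
        rw [hs2]; gcongr

end IsAdmissible

/-! ### From Riesz sums to eigenvalue counts -/

section DifferenceQuotient

variable {H : L2R3 →ₗ.[ℂ] L2R3} {E : ℝ} {n : ℕ} {f : Fin n → H.domain} {e : Fin n → ℝ}

/-- The difference quotients of the Riesz sum bracket the eigenvalue count. -/
lemma mul_eigenvalueCount_le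
    (hsymm : ∀ u v : H.domain, ⟪H u, (v : L2R3)⟫_ℂ = ⟪(u : L2R3), H v⟫_ℂ)
    (hfe : IsEigenfamily H E f e) (hex : ExhaustsBelow H E f) {a b : ℝ} (hab : a ≤ b)
    (hb : b ≤ E) :
    (b - a) * (eigenvalueCount H a).toReal ≤ rieszSum H a - rieszSum H b ∧
      rieszSum H a - rieszSum H b ≤ (b - a) * (eigenvalueCount H b).toReal := by
  classical
  rw [rieszSum_eq hsymm hfe hex (hab.trans hb), rieszSum_eq hsymm hfe hex hb,
    eigenvalueCount_eq hsymm hfe hex (hab.trans hb), eigenvalueCount_eq hsymm hfe hex hb,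
    ENNReal.toReal_natCast, ENNReal.toReal_natCast, ← Finset.sum_sub_distrib]
  push_cast
  rw [Finset.mul_sum, Finset.mul_sum]
  -- Termwise, `min(e - a, 0) - min(e - b, 0)` lies between `b - a` times the indicators of `e < a`
  -- and of `e < b`.
  refine ⟨Finset.sum_le_sum fun i _ => ?_, Finset.sum_le_sum fun i _ => ?_⟩
  · split_ifs with h1
    · rw [min_eq_left (by linarith), min_eq_left (by linarith)]; linarith
    · rw [mul_zero, sub_nonneg]
      exact min_le_min (by linarith) le_rfl
  · split_ifs with h1
    · rw [min_eq_left (b := (0 : ℝ)) (by linarith : e i - b ≤ 0)]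
      have := min_le_left (e i - a) 0
      have h2 := min_le_right (e i - a) 0
      linarith
    · rw [min_eq_right (by linarith), min_eq_right (by linarith)]; linarith

end DifferenceQuotient

namespace IsAdmissible

variable {h κ k c ω : ℝ} {V : R3 → ℝ} {A : L2R3 →L[ℂ] L2R3} (hyp : IsAdmissible h κ k c ω V A)
include hyp

lemma weylN_ne_top {E : ℝ} (hE : E ≤ -c) : weylN h V A E ≠ ∞ := by
  classical
  obtain ⟨n, f, e, hfe, hex, -⟩ := hyp.exists_eigenfamily hE
  rw [weylN, eigenvalueCount_eq hyp.symm hfe hex le_rfl]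
  exact ENNReal.natCast_ne_top _

lemma mul_weylN_le {a b : ℝ} (hab : a ≤ b) (hb : b ≤ -c) :
    (b - a) * ((2 * Real.pi * h) ^ 3 * (weylN h V A a).toReal) ≤ weylS h V A a - weylS h V A b ∧
      weylS h V A a - weylS h V A b ≤
        (b - a) * ((2 * Real.pi * h) ^ 3 * (weylN h V A b).toReal) := by
  -- One family exhausting below the higher level `b` describes the Riesz sums and counts at both
  -- levels.
  obtain ⟨n, f, e, hfe, hex, -⟩ := hyp.exists_eigenfamily hb
  obtain ⟨h1, h2⟩ := mul_eigenvalueCount_le hyp.symm hfe hex hab le_rfl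
  have hh := hyp.h_pos
  have hp : 0 ≤ (2 * Real.pi * h) ^ 3 := by positivity
  rw [weylS, weylS, weylN, weylN, ← mul_sub]
  constructor
  · calc _ = (2 * Real.pi * h) ^ 3 *
          ((b - a) * (eigenvalueCount (relHamiltonian h V A) a).toReal) :=
          by ring
      _ ≤ _ := by gcongr
  · calc _ ≤ (2 * Real.pi * h) ^ 3 *
          ((b - a) * (eigenvalueCount (relHamiltonian h V A) b).toReal) :=
          by gcongr
      _ = _ := by ring

/-- The Weyl law for the Riesz sum. -/
theorem abs_weylS_sub_le {K E : ℝ} (hk : k = K * √h) (h1 : h ≤ 1) (hE : E ≤ -c) :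
    |weylS h V A E - ∫ z, min (classicalHamiltonian V z - E) 0| ≤
      (3 * κ + 6 * Real.pi + K) * (((2 * Real.pi) ^ 3 * (16 / c ^ 2 * K ^ 2) +
        16 * κ / c * (ω * ((16 * κ * (κ + 1) / c) ^ 3 *
          (volume (Metric.closedBall (0 : R3) 1)).toReal))) +
        ω * ((1 + κ) ^ 3 * (volume (Metric.closedBall (0 : R3) 1)).toReal)) * √h := by
  classical
  have hh := hyp.h_pos
  have hκ := hyp.κ_pos
  have hc := hyp.c_pos
  have hω := hyp.ω_nonneg
  have hK : 0 ≤ K := by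
    have h2 := hyp.k_nonneg
    rw [hk] at h2
    exact nonneg_of_mul_nonneg_left h2 (by positivity)
  obtain ⟨n, f, e, hfe, hex, hvar⟩ := hyp.exists_eigenfamily hE
  have hS : weylS h V A E = (2 * Real.pi * h) ^ 3 * ∑ i, (e i - E) := by
    rw [weylS, rieszSum_eq hyp.symm hfe hex le_rfl]
    congr 1
    exact Finset.sum_congr rfl fun i _ => min_eq_left (by linarith [hfe.lt i])
  have hcl := (integral_phaseSymbol hh V (fun x => min (x - E) 0)).2
  have hlo := hyp.integral_min_le_sum hE hfe
  have hup := hyp.sum_le_integral_min hE hfe hvar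
  have hcard := hyp.card_le (f := f) (e := e)
    ⟨hfe.orthonormal, hfe.map_eq, fun i => (hfe.lt i).trans_le hE⟩
  rw [Fintype.card_fin] at hcard
  set B := (volume (Metric.closedBall (0 : R3) 1)).toReal
  have hB : 0 ≤ B := ENNReal.toReal_nonneg
  have hD : 3 * κ * √h + 6 * Real.pi * √h + k = (3 * κ + 6 * Real.pi + K) * √h := by
    rw [hk]; ring
  rw [hD] at hlo hup
  set N₀ := (2 * Real.pi) ^ 3 * (16 / c ^ 2 * K ^ 2) +
        16 * κ / c * (ω * ((16 * κ * (κ + 1) / c) ^ 3 * B)) with hN₀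
  set V₀ := ω * ((1 + κ) ^ 3 * B) with hV₀
  have hN₀0 : 0 ≤ N₀ := by positivity
  have hV₀0 : 0 ≤ V₀ := by positivity
  -- Since `ħ ≤ 1`, the remaining powers of `ħ` in the a priori bound are replaced by `1`.
  have hcard' : (2 * Real.pi * h) ^ 3 * n ≤ N₀ := by
    refine hcard.trans ?_
    rw [hN₀]
    have hkK : k ≤ K := by
      rw [hk]
      exact mul_le_of_le_one_right hK (Real.sqrt_le_one.2 h1)
    have hk0 := hyp.k_nonneg
    have h2 : 2 * Real.pi * h ≤ 2 * Real.pi := mul_le_of_le_one_right (by positivity) h1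
    have h3 : (2 * Real.pi * h) ^ 3 ≤ (2 * Real.pi) ^ 3 := by gcongr
    have h4 : 16 / c ^ 2 * k ^ 2 ≤ 16 / c ^ 2 * K ^ 2 := by gcongr
    exact add_le_add (mul_le_mul h3 h4 (by positivity) (by positivity)) le_rfl
  have hD0 : 0 ≤ (3 * κ + 6 * Real.pi + K) * √h := by positivity
  have hp : 0 ≤ (2 * Real.pi * h) ^ 3 := by positivity
  have hlo' := mul_le_mul_of_nonneg_left hlo hp
  rw [mul_sub, hcl, ← hS, ← mul_assoc] at hlo'
  rw [hcl, ← hS] at hup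
  have h3 := mul_le_mul_of_nonneg_right hcard' hD0
  have h4 : (3 * κ + 6 * Real.pi + K) * (N₀ + V₀) * √h =
      N₀ * ((3 * κ + 6 * Real.pi + K) * √h) + (3 * κ + 6 * Real.pi + K) * √h * V₀ := by ring
  rw [h4, abs_le]
  have h5 := mul_nonneg hN₀0 hD0
  have h6 := mul_nonneg hD0 hV₀0
  constructor <;> linarith

lemma toReal_volume_lt_le {E : ℝ} (hE : E ≤ -c) :
    (volume {z : R3 × R3 | classicalHamiltonian V z < E}).toReal ≤
      (volume {z : R3 × R3 | classicalHamiltonian V z ≤ E}).toReal :=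
  ENNReal.toReal_mono (hyp.volume_classical_ne_top hE)
    (measure_mono fun _ hz => le_of_lt (mem_ofPred.1 hz))

/-- The difference quotients of the classical Riesz integral bracket the phase space volume. -/
lemma mul_volume_le {a b : ℝ} (hab : a ≤ b) (hb : b ≤ -c) :
    (b - a) * (volume {z : R3 × R3 | classicalHamiltonian V z < a}).toReal ≤
        (∫ z, min (classicalHamiltonian V z - a) 0) - ∫ z, min (classicalHamiltonian V z - b) 0 ∧
      (∫ z, min (classicalHamiltonian V z - a) 0) - (∫ z, min (classicalHamiltonian V z - b) 0) ≤
        (b - a) * (volume {z : R3 × R3 | classicalHamiltonian V z < b}).toReal := by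
  have key : ∀ E ≤ -c, Integrable (fun z => (b - a) *
      {z : R3 × R3 | classicalHamiltonian V z < E}.indicator (1 : R3 × R3 → ℝ) z) ∧
      ∫ z, (b - a) * {z : R3 × R3 | classicalHamiltonian V z < E}.indicator (1 : R3 × R3 → ℝ) z =
        (b - a) * (volume {z : R3 × R3 | classicalHamiltonian V z < E}).toReal := by
    intro E hE
    constructor
    · refine Integrable.const_mul ?_ _
      rw [integrable_indicator_iff (hyp.measurableSet_classical_lt E)]
      exact integrableOn_const (ne_top_of_le_ne_top (hyp.volume_classical_ne_top hE)
        (measure_mono fun z hz => le_of_lt (mem_ofPred.1 hz))) (C := (1 : ℝ))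
    · rw [integral_const_mul, integral_indicator_one (hyp.measurableSet_classical_lt E)]
      rfl
  rw [← (key a (hab.trans hb)).2, ← (key b hb).2, ← integral_sub
    (hyp.integrable_min_classical (hab.trans hb)) (hyp.integrable_min_classical hb)]
  have hi := (hyp.integrable_min_classical (hab.trans hb)).sub (hyp.integrable_min_classical hb)
  constructor
  · refine integral_mono (key a (hab.trans hb)).1 hi fun z => ?_
    simp only
    by_cases hz : classicalHamiltonian V z < a
    · rw [indicator_of_mem (show z ∈ {z | classicalHamiltonian V z < a} from hz), Pi.one_apply,
        min_eq_left (by linarith), min_eq_left (by linarith)]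
      linarith
    · rw [indicator_of_notMem (show z ∉ {z | classicalHamiltonian V z < a} from hz), mul_zero,
        sub_nonneg]
      exact min_le_min (by linarith) le_rfl
  · refine integral_mono hi (key b hb).1 fun z => ?_
    simp only
    by_cases hz : classicalHamiltonian V z < b
    · rw [indicator_of_mem (show z ∈ {z | classicalHamiltonian V z < b} from hz), Pi.one_apply,
        min_eq_left (b := (0 : ℝ)) (by linarith : classicalHamiltonian V z - b ≤ 0)]
      have := min_le_left (classicalHamiltonian V z - a) 0
      linarith
    · rw [indicator_of_notMem (show z ∉ {z | classicalHamiltonian V z < b} from hz), mul_zero,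
        min_eq_right (by linarith), min_eq_right (by linarith)]
      linarith

/-- The volume of the classically allowed region is Lipschitz in the energy. -/
lemma volume_le_add {a b : ℝ} (hab : a ≤ b) (hb : b ≤ -c) :
    (volume {z : R3 × R3 | classicalHamiltonian V z ≤ b}).toReal ≤
      (volume {z : R3 × R3 | classicalHamiltonian V z < a}).toReal +
        ω * (3 * (1 + κ) ^ 2 * (volume (Metric.closedBall (0 : R3) 1)).toReal) * (b - a) := by
  have hκ := hyp.κ_pos
  have hnn : 0 ≤ ω * (3 * (1 + κ) ^ 2 * (volume (Metric.closedBall (0 : R3) 1)).toReal) * (b - a) :=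
    mul_nonneg (mul_nonneg hyp.ω_nonneg (mul_nonneg (by positivity) ENNReal.toReal_nonneg))
      (by linarith)
  have hfin : volume {z : R3 × R3 | classicalHamiltonian V z < a} ≠ ∞ :=
    ne_top_of_le_ne_top (hyp.volume_classical_ne_top (hab.trans hb))
      (measure_mono fun z hz => le_of_lt (mem_ofPred.1 hz))
  rw [← ENNReal.toReal_ofReal hnn, ← ENNReal.toReal_add hfin ENNReal.ofReal_ne_top]
  refine ENNReal.toReal_mono (ENNReal.add_ne_top.2 ⟨hfin, ENNReal.ofReal_ne_top⟩) ?_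
  have hsub : {z : R3 × R3 | classicalHamiltonian V z ≤ b} ⊆
      {z | classicalHamiltonian V z < a} ∪
        {z | a ≤ classicalHamiltonian V z ∧ classicalHamiltonian V z ≤ b} := by
    intro z hz
    rcases lt_or_ge (classicalHamiltonian V z) a with h1 | h1
    · exact Or.inl h1
    · exact Or.inr ⟨h1, hz⟩
  exact (measure_mono hsub).trans ((measure_union_le _ _).trans
    (add_le_add le_rfl (hyp.volume_shell_le hab hb)))

/-- The Weyl law for the eigenvalue count follows from the one for the Riesz sum. -/
theorem abs_weylN_sub_le {E C : ℝ} (hE : E ≤ -(2 * c)) (h1 : h ≤ 1)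
    (hC : ∀ E' ≤ -c, |weylS h V A E' - ∫ z, min (classicalHamiltonian V z - E') 0| ≤ C * √h) :
    |(2 * Real.pi * h) ^ 3 * (weylN h V A E).toReal -
        (volume {z : R3 × R3 | classicalHamiltonian V z ≤ E}).toReal| ≤
      (ω * (3 * (1 + κ) ^ 2 * (volume (Metric.closedBall (0 : R3) 1)).toReal) * c + 2 * C / c) *
        h ^ (1 / 4 : ℝ) := by
  have hh := hyp.h_pos
  have hc := hyp.c_pos
  set r := h ^ (1 / 4 : ℝ) with hr
  have hr0 : 0 < r := by positivity
  have hr1 : r ≤ 1 := Real.rpow_le_one hh.le h1 (by norm_num)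
  have hrs : √h = r * r := by
    rw [Real.sqrt_eq_rpow, hr, ← Real.rpow_add hh]; norm_num
  -- The Riesz error divided by `δ` and the volume variation `L δ` are both of order `ħ^(1/4)`. The
  -- factor `c` ensures `δ ≤ c`, so that `E + δ` stays in the range `≤ -c` where the Riesz bound
  -- holds.
  set δ := c * r with hδ
  have hδ0 : 0 < δ := by positivity
  have hδc : δ ≤ c := mul_le_of_le_one_right hc.le hr1
  have hEp : E + δ ≤ -c := by linarith
  have hEc : E ≤ -c := by linarith
  set L := ω * (3 * (1 + κ) ^ 2 * (volume (Metric.closedBall (0 : R3) 1)).toReal) with hL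
  have hup1 := (hyp.mul_weylN_le (a := E) (b := E + δ) (by linarith) hEp).1
  have hup2 := (hyp.mul_volume_le (a := E) (b := E + δ) (by linarith) hEp).2
  have hup3 := hyp.toReal_volume_lt_le hEp
  have hup4 := hyp.volume_le_add (a := E) (b := E + δ) (by linarith) hEp
  have hup5 := hyp.toReal_volume_lt_le hEc
  have hlo1 := (hyp.mul_weylN_le (a := E - δ) (b := E) (by linarith) hEc).2
  have hlo2 := (hyp.mul_volume_le (a := E - δ) (b := E) (by linarith) hEc).1
  have hlo3 := hyp.volume_le_add (a := E - δ) (b := E) (by linarith) hEc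
  have hC0 := abs_le.1 (hC E hEc)
  have hC1 := abs_le.1 (hC (E + δ) hEp)
  have hC2 := abs_le.1 (hC (E - δ) (by linarith))
  simp only [add_sub_cancel_left, sub_sub_cancel] at hup1 hup2 hup4 hlo1 hlo2 hlo3
  rw [← hL] at hup4 hlo3
  set v := (volume {z : R3 × R3 | classicalHamiltonian V z ≤ E}).toReal
  set N := (2 * Real.pi * h) ^ 3 * (weylN h V A E).toReal
  have hu : δ * N ≤ δ * (v + L * δ) + 2 * (C * √h) := by
    have h2 : δ * (volume {z : R3 × R3 | classicalHamiltonian V z < E + δ}).toReal ≤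
        δ * (v + L * δ) := by
      gcongr
      linarith
    linarith [hC0.1, hC0.2, hC1.1, hC1.2]
  have hl : δ * (v - L * δ) - 2 * (C * √h) ≤ δ * N := by
    have h2 : δ * (v - L * δ) ≤
        δ * (volume {z : R3 × R3 | classicalHamiltonian V z < E - δ}).toReal := by
      gcongr
      linarith
    linarith [hC0.1, hC0.2, hC2.1, hC2.2]
  have h2 : (L * c + 2 * C / c) * r = L * δ + 2 * (C * √h) / δ := by
    rw [hrs, hδ]
    field_simp
  rw [h2, abs_le]
  have h3 : 2 * (C * √h) = δ * (2 * (C * √h) / δ) := by field_simp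
  rw [h3] at hu hl
  constructor
  · refine le_of_mul_le_mul_left ?_ hδ0
    linarith
  · refine le_of_mul_le_mul_left ?_ hδ0
    linarith

end IsAdmissible

/-! ### Uniform constants and conclusion -/

/-- The standing assumptions provide uniform constants. -/
lemma WeylAssumption.exists_isAdmissible {E₀ : ℝ} {V : ℝ → R3 → ℝ} {A : ℝ → L2R3 →L[ℂ] L2R3}
    (hVA : WeylAssumption E₀ V A) {c : ℝ} (hc : 0 < c) :
    ∃ κ K ω : ℝ, ∀ h ∈ Ioc (0 : ℝ) 1, IsAdmissible h κ (K * √h) c ω (V h) (A h) := by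
  obtain ⟨B, hB⟩ := hVA.weakL3_C1_bound
  obtain ⟨K, hK⟩ := hVA.hs_bound
  -- `B + 1` keeps `κ` positive. The third constant is the weak `L³` bound at height `t = c/2`,
  -- solved for the volume of the well.
  refine ⟨B + 1, K, (B / (c / 2)) ^ 3, fun h hh => ?_⟩
  have hB1 : c1Norm (V h) ≤ B := le_add_self.trans (hB h hh)
  have hB2 : weakLpNorm (V h) 3 ≤ B := le_self_add.trans (hB h hh)
  have hd := (hVA.contDiff h hh).differentiable one_ne_zero
  have hsup : ∀ x, ‖V h x‖ ≤ B := fun x => by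
    have h1 : ‖V h x‖ₑ ≤ B :=
      (le_iSup (fun x => ‖V h x‖ₑ) x).trans (le_self_add.trans hB1)
    exact_mod_cast h1
  have hgrad : ∀ x, ‖fderiv ℝ (V h) x‖ ≤ B := fun x => by
    have h1 : ‖fderiv ℝ (V h) x‖ₑ ≤ B :=
      (le_iSup (fun x => ‖fderiv ℝ (V h) x‖ₑ) x).trans (le_add_self.trans hB1)
    exact_mod_cast h1
  refine
    { h_pos := hh.1
      κ_pos := by positivity
      k_nonneg := by positivity
      c_pos := hc
      ω_nonneg := by positivity
      continuous := hd.continuous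
      abs_V_le := fun x => (hsup x).trans (by linarith)
      lipschitz := fun x y => ?_
      volume_le := ?_
      selfAdjoint := hVA.selfAdjoint h hh
      hsNorm_le := ?_ }
  · have h1 := Convex.norm_image_sub_le_of_norm_fderiv_le (𝕜 := ℝ) (f := V h) (C := B)
      (fun x _ => hd x) (fun x _ => hgrad x) convex_univ (mem_univ y) (mem_univ x)
    refine h1.trans ?_
    gcongr
    linarith
  · set t : ℝ≥0 := ⟨c / 2, by positivity⟩ with ht
    have h1 : (t : ℝ≥0∞) * volume {x | (t : ℝ) < |V h x|} ^ (1 / 3 : ℝ) ≤ B :=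
      (le_iSup (fun t : ℝ≥0 => (t : ℝ≥0∞) * volume {x | (t : ℝ) < |V h x|} ^ (1 / 3 : ℝ)) t).trans
        hB2
    have ht0 : (t : ℝ≥0∞) ≠ 0 := by
      rw [ENNReal.coe_ne_zero, ← NNReal.coe_ne_zero]
      exact (half_pos hc).ne'
    have h2 : volume {x | (t : ℝ) < |V h x|} ^ (1 / 3 : ℝ) ≤ B / t := by
      rwa [ENNReal.le_div_iff_mul_le (Or.inl ht0) (Or.inl ENNReal.coe_ne_top), mul_comm]
    have h3 := ENNReal.rpow_le_rpow h2 (z := 3) (by norm_num)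
    rw [← ENNReal.rpow_mul] at h3
    norm_num at h3
    have h4 : ENNReal.ofReal ((B / (c / 2)) ^ 3) = ((B : ℝ≥0∞) / t) ^ 3 := by
      rw [ENNReal.ofReal_pow (by positivity), ENNReal.ofReal_div_of_pos (by positivity),
        ENNReal.ofReal_coe_nnreal]
      congr 2
      exact ENNReal.ofReal_coe_nnreal (p := t)
    rw [h4]
    refine le_trans (measure_mono fun x hx => ?_) h3
    change c / 2 < |V h x|
    have h5 : V h x < -(c / 2) := hx
    have := neg_le_abs (V h x)
    linarith
  · refine (hK h hh).trans_eq ?_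
    rw [ENNReal.ofReal_mul (by positivity), ENNReal.ofReal_coe_nnreal]

end

theorem mainTheorem2 (E₀ : ℝ) (V : ℝ → R3 → ℝ) (A : ℝ → L2R3 →L[ℂ] L2R3)
    (hVA : WeylAssumption E₀ V A) :
    ∃ C : ℝ, ∀ h ∈ Ioc (0 : ℝ) 1, ∀ E ≤ E₀,
      weylN h (V h) (A h) E ≠ ∞ ∧
      IntegrableOn (fun z => classicalHamiltonian (V h) z - E)
        {z : R3 × R3 | classicalHamiltonian (V h) z < E} volume ∧
      volume {z : R3 × R3 | classicalHamiltonian (V h) z ≤ E} ≠ ∞ ∧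
      |weylS h (V h) (A h) E -
          ∫ z in {z : R3 × R3 | classicalHamiltonian (V h) z < E},
            (classicalHamiltonian (V h) z - E)| ≤ C * √h ∧
      |(2 * Real.pi * h) ^ 3 * (weylN h (V h) (A h) E).toReal -
          (volume {z : R3 × R3 | classicalHamiltonian (V h) z ≤ E}).toReal| ≤
        C * h ^ (1 / 4 : ℝ) := by
  -- Half of `-E₀` leaves a gap of length `c` between `E₀ = -2c` and `-c`, as room for the upward
  -- energy shift in the counting argument.
  have hc : 0 < -E₀ / 2 := by linarith [hVA.E₀_neg]
  obtain ⟨κ, K, ω, hyp⟩ := hVA.exists_isAdmissible hc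
  set c := -E₀ / 2 with hcdef
  set C := (3 * κ + 6 * Real.pi + K) * (((2 * Real.pi) ^ 3 * (16 / c ^ 2 * K ^ 2) +
        16 * κ / c * (ω * ((16 * κ * (κ + 1) / c) ^ 3 *
          (volume (Metric.closedBall (0 : R3) 1)).toReal))) +
        ω * ((1 + κ) ^ 3 * (volume (Metric.closedBall (0 : R3) 1)).toReal)) with hC
  set C' := ω * (3 * (1 + κ) ^ 2 * (volume (Metric.closedBall (0 : R3) 1)).toReal) * c +
    2 * C / c with hC'
  refine ⟨max C C', fun h hh E hE => ?_⟩
  have hE2 : E ≤ -(2 * c) := by rw [hcdef]; linarith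
  have hE1 : E ≤ -c := by linarith
  have hS := fun E' hE' => (hyp h hh).abs_weylS_sub_le (E := E') rfl hh.2 hE'
  refine ⟨(hyp h hh).weylN_ne_top hE1, (hyp h hh).integrableOn_classical_lt hE1,
    (hyp h hh).volume_classical_ne_top hE1, ?_, ?_⟩
  · rw [← (hyp h hh).integral_min_classical]
    refine (hS E hE1).trans ?_
    gcongr
    exact le_max_left _ _
  · refine ((hyp h hh).abs_weylN_sub_le hE2 hh.2 hS).trans ?_
    have := hh.1
    gcongr
    exact le_max_right _ _
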